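/- **Data.** Let $X$ be one of $A(m,n)$ ($m,n\ge 0$, $(m,n)\ne(0,0)$), $B(m,n)$ ($m\ge 0,\ n\ge 1$), $C(n)$ ($n\ge 1$), $D(m,n)$ ($m\ge 2,\ n\ge 1$), and let $\mathfrak g$ be the complex Lie superalgebra $\mathfrak{sl}(m+1|n+1)$ if $X=A(m,n)$, $m\neq n$; $\mathfrak{sl}(n+1|n+1)/\mathbb C I$ if $X=A(n,n)$; $\mathfrak{osp}(2m+1|2n)$, $\mathfrak{osp}(2|2n)$, $\mathfrak{osp}(2m|2n)$ if $X=B(m,n), C(n), D(m,n)$. Let $r=m+n+1,\ m+n,\ n+1,\ m+n$ for types $A,B,C,D$. Let $\varepsilon_i,\delta_j$ be orthogonal with $(\varepsilon_i|\varepsilon_i)=1$, $(\delta_j|\delta_j)=-1$, and let the extended distinguished simple roots $\alpha_0,\dots,\alpha_r$ (with $\alpha_0$ written modulo the null root, which is orthogonal to everything) be: * $A(m,n)$: $\alpha_0=\delta_{n+1}-\varepsilon_1$; $\alpha_i=\varepsilon_i-\varepsilon_{i+1}$ ($1\le i\le m$); $\alpha_{m+1}=\varepsilon_{m+1}-\delta_1$;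 $\alpha_{m+1+j}=\delta_j-\delta_{j+1}$ ($1\le j\le n$); odd: $\alpha_0,\alpha_{m+1}$; $(d_0,\dots,d_r)=(1,1^{m+1},(-1)^n)$. * $B(0,n)$: $\alpha_0=-2\varepsilon_1$; $\alpha_i=\varepsilon_i-\varepsilon_{i+1}$ ($1\le i<n$); $\alpha_n=\varepsilon_n$; odd: $\alpha_n$; $d=(2,1^{n-1},\tfrac12)$. * $B(m,n)$, $m\ge1$: $\alpha_0=-2\varepsilon_1$; $\alpha_i=\varepsilon_i-\varepsilon_{i+1}$ ($1\le i<n$); $\alpha_n=\varepsilon_n-\delta_1$; $\alpha_{n+j}=\delta_j-\delta_{j+1}$ ($1\le j<m$); $\alpha_{n+m}=\delta_m$; odd: $\alpha_n$; $d=(2,1^n,(-1)^{m-1},-\tfrac12)$. * $C(n)$: $\alpha_0=-\varepsilon_1-\delta_1$; $\alpha_1=\varepsilon_1-\delta_1$; $\alpha_i=\delta_{i-1}-\delta_i$ ($2\le i\le n$); $\alpha_{n+1}=2\delta_n$; odd: $\alpha_0,\alpha_1$; $d=(1,1,(-1)^{n-1},-2)$. * $D(m,n)$: $\alpha_0,\dots,\alpha_n$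 and $\alpha_{n+j}$ ($1\le j<m$) as for $B(m,n)$, $m\geq 1$; $\alpha_{n+m}=\delta_{m-1}+\delta_m$; odd: $\alpha_n$; $d=(2,1^n,(-1)^m)$. Put $a_{ij}=(\alpha_i|\alpha_j)/d_i$ for $0\le i,j\le r$; this is the extended distinguished Cartan matrix. The form $(\cdot|\cdot)$ on $\mathfrak g$ is the invariant form $c\cdot\mathrm{str}(xy)$ with $c=1$ in type $A$, $c=-\frac12$ in types $B,D$, $c=\frac12$ in type $C$. Let $e_i,f_i$, $h_i=[e_i,f_i]$ ($0\le i\le r$) be the standard Chevalley generators of $\mathfrak g$, explicit root vectors of weights $\alpha_i$ and $-\alpha_i$ (in particular $e_0,f_0$ are root vectors for $-\theta,\theta$, where $\theta$ is the highest root), normalized so that $(e_i|f_i)=1/d_i$, and then $[h_i,e_j]=a_{ij}e_j$. **The two algebras.** Let $R=\mathbb C[s^{\pm1},t^{\pm1}]$, let $\Omega_R$ be its Kähler differentials over $\mathbb C$, $d\Omega_R=\{da: a\in R\}$ the exact forms, and $\overline{\omega}$ the class of $\omega$ in $\Omega_R/d\Omega_R$. The toroidal Lie superalgebra is $T(\mathfrak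 g)=\mathfrak g\otimes R\oplus\Omega_R/d\Omega_R$ with $[x\otimes a,y\otimes b]=[x,y]\otimes ab+(x|y)\overline{(da)b}$, and $\Omega_R/d\Omega_R$ even and central. $\mathfrak T(X)$ is the Lie superalgebra generated by $\mathcal K,\alpha_i(k)$ (even) and $x_i^\pm(k)$ (of the parity of $\alpha_i$), $0\le i\le r$, $k\in\mathbb Z$, with the relations (for all $i,j,k,l$, subject to the stated conditions) 1. $[\mathcal K,\alpha_i(k)]=[\mathcal K,x_i^\pm(k)]=0$; 2. $[\alpha_i(k),\alpha_j(l)]=k(\alpha_i|\alpha_j)\delta_{k,-l}\mathcal K$; 3. $[\alpha_i(k),x_j^\pm(l)]=\pm(\alpha_i|\alpha_j)x_j^\pm(k+l)$; 4. $[x_i^+(k),x_j^-(l)]=0$ if $i\ne j$; $[x_i^+(k),x_i^-(l)]=-\{\alpha_i(k+l)+k\delta_{k,-l}\mathcal K\}$ if $(\alpha_i|\alpha_i)=0$; $[x_i^+(k),x_i^-(l)]=-\frac{2}{(\alpha_i|\alpha_i)}\{\alpha_i(k+l)+k\delta_{k,-l}\mathcal K\}$ if $(\alpha_i|\alpha_i)\ne0$;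 5. $[x_i^\pm(k),x_i^\pm(l)]=0$ unless $\alpha_i$ is odd and $(\alpha_i|\alpha_i)\neq 0$; $[x_i^\pm(k),x_j^\pm(l)]=0$ if $i\ne j$, $a_{ii}=a_{ij}=0$; $[x_i^\pm(k),[x_i^\pm(k),x_j^\pm(l)]]=0$ if $a_{ii}=0$, $a_{ij}\ne0$; $(\mathrm{ad}\,x_i^\pm(k))^{1-a_{ij}}x_j^\pm(l)=0$ if $i\ne j$, $a_{ii}\ne0$. **Proposition.** There is a unique homomorphism of Lie superalgebras $\mathfrak T(X)\to T(\mathfrak g)$ such that, for all $k\in\mathbb Z$, $$\mathcal K\mapsto\overline{s^{-1}ds},\qquad \alpha_i(k)\mapsto d_i\,h_i\otimes s^k-\delta_{i0}\,\overline{s^kt^{-1}dt}\quad(0\le i\le r),$$ $$x_i^+(k)\mapsto e_i\otimes s^k,\qquad x_i^-(k)\mapsto -f_i\otimes s^k\quad(1\le i\le r),$$ $$x_0^+(k)\mapsto e_0\otimes s^kt^{-1},\qquad x_0^-(k)\mapsto -f_0\otimes s^kt,$$ and it is surjective. -/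

import Mathlib

noncomputable section

namespace ToroidalSuper

open scoped TensorProduct

/-! ## Superalgebras and Lie superalgebras over `ℂ` -/

/-- The sign `(-1) ^ p` of a parity `p`. -/
def sg (p : ZMod 2) : ℂ := if p = 0 then 1 else -1

/-- A (not necessarily associative) complex superalgebra.  The `ℤ/2`-grading `L = L₀ ⊕ L₁` is
recorded by the parity involution, which is `(-1) ^ p` on `L_p` (see `homog` and
`isInternal_homog`), and the product `sbr` respects the grading (see `sbr_mem_homog`). -/
class Superalgebra (L : Type) [AddCommGroup L] [Module ℂ L] where
  parity : L →ₗ[ℂ] L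
  parity_parity : ∀ x, parity (parity x) = x
  sbr : L →ₗ[ℂ] L →ₗ[ℂ] L
  parity_sbr : ∀ x y, parity (sbr x y) = sbr (parity x) (parity y)

open Superalgebra

/-- The homogeneous part `L_p`. -/
def homog (L : Type) [AddCommGroup L] [Module ℂ L] [Superalgebra L] (p : ZMod 2) :
    Submodule ℂ L where
  carrier := {x | parity x = sg p • x}
  zero_mem' := by simp
  add_mem' := by
    intro x y hx hy
    simp only [Set.mem_ofPred_eq] at hx hy ⊢
    rw [map_add, hx, hy, smul_add]
  smul_mem' := by
    intro c x hx
    simp only [Set.mem_ofPred_eq] at hx ⊢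
    rw [map_smul, hx, smul_comm]

/-- The component in `L_p` of an element. -/
def comp (L : Type) [AddCommGroup L] [Module ℂ L] [Superalgebra L] (p : ZMod 2) : L →ₗ[ℂ] L :=
  (1 / 2 : ℂ) • (LinearMap.id + sg p • parity)

/-- A Lie superalgebra: graded antisymmetry and the graded Jacobi identity. -/
class IsLieSuperalgebra (L : Type) [AddCommGroup L] [Module ℂ L] [Superalgebra L] : Prop where
  skew : ∀ (p q : ZMod 2), ∀ x ∈ homog L p, ∀ y ∈ homog L q,
    sbr x y = -(sg (p * q) • sbr y x)
  jacobi : ∀ (p q r : ZMod 2), ∀ x ∈ homog L p, ∀ y ∈ homog L q, ∀ z ∈ homog L r,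
    sbr x (sbr y z) = sbr (sbr x y) z + sg (p * q) • sbr y (sbr x z)

/-- Homomorphisms of superalgebras: even linear maps that respect the brackets. -/
structure SuperHom (L M : Type) [AddCommGroup L] [Module ℂ L] [Superalgebra L]
    [AddCommGroup M] [Module ℂ M] [Superalgebra M] extends L →ₗ[ℂ] M where
  map_parity : ∀ x, toFun (parity x) = parity (toFun x)
  map_sbr : ∀ x y, toFun (sbr x y) = sbr (toFun x) (toFun y)

instance (L M : Type) [AddCommGroup L] [Module ℂ L] [Superalgebra L]
    [AddCommGroup M] [Module ℂ M] [Superalgebra M] : CoeFun (SuperHom L M) (fun _ => L → M) :=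
  ⟨fun φ => φ.toLinearMap⟩

@[simp] theorem sg_zero : sg 0 = 1 := by simp [sg]
@[simp] theorem sg_one : sg 1 = -1 := by simp [sg]

theorem zmod_two (p : ZMod 2) : p = 0 ∨ p = 1 := by revert p; decide

theorem sg_add (p q : ZMod 2) : sg (p + q) = sg p * sg q := by
  have h2 : (1 + 1 : ZMod 2) = 0 := by decide
  rcases zmod_two p with rfl | rfl <;> rcases zmod_two q with rfl | rfl <;> simp [h2]

theorem sg_mul_self (p : ZMod 2) : sg p * sg p = 1 := by
  rcases zmod_two p with rfl | rfl <;> simp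

section Generalities

variable {L : Type} [AddCommGroup L] [Module ℂ L] [Superalgebra L]

theorem mem_homog {p : ZMod 2} {x : L} : x ∈ homog L p ↔ parity x = sg p • x := Iff.rfl

theorem comp_apply (p : ZMod 2) (x : L) :
    comp L p x = (1 / 2 : ℂ) • (x + sg p • parity x) := by
  simp [comp]

theorem comp_of_mem {p : ZMod 2} {x : L} (hx : x ∈ homog L p) : comp L p x = x := by
  rw [comp_apply, mem_homog.1 hx, smul_smul, sg_mul_self]
  module

theorem comp_mem (p : ZMod 2) (x : L) : comp L p x ∈ homog L p := by
  rw [mem_homog, comp_apply, map_smul, map_add, map_smul, parity_parity, smul_comm (sg p),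
    smul_add, smul_add, smul_add, smul_smul (sg p) (sg p), sg_mul_self]
  module

theorem comp_add (x : L) : comp L 0 x + comp L 1 x = x := by
  rw [comp_apply, comp_apply, sg_zero, sg_one]
  module

theorem sbr_mem_homog {p q : ZMod 2} {x y : L} (hx : x ∈ homog L p) (hy : y ∈ homog L q) :
    sbr x y ∈ homog L (p + q) := by
  rw [mem_homog, parity_sbr, mem_homog.1 hx, mem_homog.1 hy, sg_add]
  simp [smul_smul, mul_comm]

/-- A superalgebra is the direct sum of its even and its odd part. -/
theorem isInternal_homog : DirectSum.IsInternal (homog L) := by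
  have hcompl : IsCompl (homog L 0) (homog L 1) := by
    constructor
    · rw [Submodule.disjoint_def]
      intro x h0 h1
      have h : x = -x := by
        have := (mem_homog.1 h0).symm.trans (mem_homog.1 h1)
        simpa using this
      have h2 : (2 : ℂ) • x = 0 := by rw [two_smul]; exact eq_neg_iff_add_eq_zero.1 h
      exact (smul_eq_zero.1 h2).resolve_left two_ne_zero
    · rw [codisjoint_iff, eq_top_iff]
      intro x _
      rw [← comp_add x]
      exact Submodule.add_mem_sup (comp_mem 0 x) (comp_mem 1 x)
  exact (DirectSum.isInternal_submodule_iff_isCompl (homog L) (i := 0) (j := 1) (by decide)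
    (by ext p; simpa using zmod_two p)).2 hcompl

/-- To prove a linear statement it is enough to treat homogeneous elements. -/
theorem homog_induction {P : L → Prop} (hadd : ∀ x y, P x → P y → P (x + y))
    (h : ∀ p, ∀ x ∈ homog L p, P x) (x : L) : P x := by
  rw [← comp_add x]
  exact hadd _ _ (h _ _ (comp_mem 0 x)) (h _ _ (comp_mem 1 x))

end Generalities

/-! ### Subalgebras and quotients -/

/-- Graded subspaces that are closed under the product. -/
structure IsSubalgebra {L : Type} [AddCommGroup L] [Module ℂ L] [Superalgebra L]
    (S : Submodule ℂ L) : Prop where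
  parity_mem : ∀ x ∈ S, parity x ∈ S
  sbr_mem : ∀ x ∈ S, ∀ y ∈ S, sbr x y ∈ S

/-- Graded two-sided ideals. -/
structure IsIdeal {L : Type} [AddCommGroup L] [Module ℂ L] [Superalgebra L]
    (J : Submodule ℂ L) : Prop where
  parity_mem : ∀ x ∈ J, parity x ∈ J
  sbr_mem_left : ∀ x, ∀ y ∈ J, sbr x y ∈ J
  sbr_mem_right : ∀ x ∈ J, ∀ y, sbr x y ∈ J

section SubQuot

variable {L : Type} [AddCommGroup L] [Module ℂ L] [Superalgebra L]

/-- A graded subspace closed under the product is a superalgebra. -/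
abbrev subSuperalgebra (S : Submodule ℂ L) (hS : IsSubalgebra S) : Superalgebra S where
  parity := parity.restrict hS.parity_mem
  parity_parity x := Subtype.ext (parity_parity x.1)
  sbr := LinearMap.mk₂ ℂ (fun x y => ⟨sbr x.1 y.1, hS.sbr_mem _ x.2 _ y.2⟩)
    (fun _ _ _ => Subtype.ext (by simp)) (fun _ _ _ => Subtype.ext (by simp))
    (fun _ _ _ => Subtype.ext (by simp)) (fun _ _ _ => Subtype.ext (by simp))
  parity_sbr x y := Subtype.ext (parity_sbr x.1 y.1)

theorem subSuperalgebra_isLie [IsLieSuperalgebra L] (S : Submodule ℂ L) (hS : IsSubalgebra S) :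
    @IsLieSuperalgebra S _ _ (subSuperalgebra S hS) := by
  let _ := subSuperalgebra S hS
  have hm : ∀ p, ∀ x ∈ homog S p, x.1 ∈ homog L p := fun p x hx => congrArg Subtype.val hx
  exact
  { skew := fun p q x hx y hy =>
      Subtype.ext (IsLieSuperalgebra.skew p q x.1 (hm p x hx) y.1 (hm q y hy))
    jacobi := fun p q r x hx y hy z hz =>
      Subtype.ext (IsLieSuperalgebra.jacobi p q r x.1 (hm p x hx) y.1 (hm q y hy) z.1
        (hm r z hz)) }

/-- The quotient of a superalgebra by a graded ideal. -/
abbrev quotSuperalgebra (J : Submodule ℂ L) (hJ : IsIdeal J) : Superalgebra (L ⧸ J) where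
  parity := J.mapQ J parity hJ.parity_mem
  parity_parity x := by
    induction x using Submodule.Quotient.induction_on with
    | _ x => simp [Submodule.mapQ_apply, parity_parity]
  sbr := J.liftQ
    { toFun := fun x => J.mapQ J (sbr x) (hJ.sbr_mem_left x)
      map_add' := fun x y => by ext z; simp
      map_smul' := fun c x => by ext z; simp }
    (fun x hx => by
      rw [LinearMap.mem_ker]
      ext z
      simpa using hJ.sbr_mem_right x hx z)
  parity_sbr x y := by
    induction x using Submodule.Quotient.induction_on with
    | _ x =>
      induction y using Submodule.Quotient.induction_on with
      | _ y => simp [Submodule.mapQ_apply, parity_sbr]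

/-- Homogeneous elements of a quotient have homogeneous representatives. -/
theorem exists_homog_rep (J : Submodule ℂ L) (hJ : IsIdeal J) (p : ZMod 2) (x : L ⧸ J)
    (hx : x ∈ @homog (L ⧸ J) _ _ (quotSuperalgebra J hJ) p) :
    ∃ x' ∈ homog L p, J.mkQ x' = x := by
  let _ := quotSuperalgebra J hJ
  obtain ⟨x', rfl⟩ := J.mkQ_surjective x
  refine ⟨comp L p x', comp_mem p x', ?_⟩
  rw [← comp_of_mem hx, comp_apply, comp_apply, map_smul, map_add, map_smul]
  rfl

/-- If the Lie axioms hold modulo a graded ideal, then the quotient is a Lie superalgebra. -/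
theorem quotSuperalgebra_isLie (J : Submodule ℂ L) (hJ : IsIdeal J)
    (hskew : ∀ p q, ∀ x ∈ homog L p, ∀ y ∈ homog L q, sbr x y + sg (p * q) • sbr y x ∈ J)
    (hjac : ∀ p q r, ∀ x ∈ homog L p, ∀ y ∈ homog L q, ∀ z ∈ homog L r,
      sbr x (sbr y z) - (sbr (sbr x y) z + sg (p * q) • sbr y (sbr x z)) ∈ J) :
    @IsLieSuperalgebra (L ⧸ J) _ _ (quotSuperalgebra J hJ) := by
  let _ := quotSuperalgebra J hJ
  constructor
  · intro p q x hx y hy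
    obtain ⟨x, hx', rfl⟩ := exists_homog_rep J hJ p x hx
    obtain ⟨y, hy', rfl⟩ := exists_homog_rep J hJ q y hy
    rw [eq_neg_iff_add_eq_zero]
    exact (Submodule.Quotient.mk_eq_zero J).2 (hskew p q x hx' y hy')
  · intro p q r x hx y hy z hz
    obtain ⟨x, hx', rfl⟩ := exists_homog_rep J hJ p x hx
    obtain ⟨y, hy', rfl⟩ := exists_homog_rep J hJ q y hy
    obtain ⟨z, hz', rfl⟩ := exists_homog_rep J hJ r z hz
    rw [← sub_eq_zero]
    exact (Submodule.Quotient.mk_eq_zero J).2 (hjac p q r x hx' y hy' z hz')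

end SubQuot

/-! ### Lie superalgebras given by generators and relations -/

/-- The free non-associative superalgebra on a set `G` of generators with parities `p`. -/
def FreeSuper {G : Type} (_p : G → ZMod 2) : Type := FreeNonUnitalNonAssocAlgebra ℂ G

namespace FreeSuper

variable {G : Type} (p : G → ZMod 2)

instance : NonUnitalNonAssocRing (FreeSuper p) :=
  inferInstanceAs (NonUnitalNonAssocRing (FreeNonUnitalNonAssocAlgebra ℂ G))
instance : Module ℂ (FreeSuper p) :=
  inferInstanceAs (Module ℂ (FreeNonUnitalNonAssocAlgebra ℂ G))
instance : IsScalarTower ℂ (FreeSuper p) (FreeSuper p) :=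
  inferInstanceAs (IsScalarTower ℂ (FreeNonUnitalNonAssocAlgebra ℂ G)
    (FreeNonUnitalNonAssocAlgebra ℂ G))
instance : SMulCommClass ℂ (FreeSuper p) (FreeSuper p) :=
  inferInstanceAs (SMulCommClass ℂ (FreeNonUnitalNonAssocAlgebra ℂ G)
    (FreeNonUnitalNonAssocAlgebra ℂ G))

/-- The generators. -/
def of (g : G) : FreeSuper p := FreeNonUnitalNonAssocAlgebra.of ℂ g

/-- The algebra automorphism that multiplies each generator `g` by `(-1) ^ p g`. -/
def parityHom : FreeSuper p →ₙₐ[ℂ] FreeSuper p :=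
  FreeNonUnitalNonAssocAlgebra.lift ℂ (fun g => sg (p g) • of p g)

theorem parityHom_of (g : G) : parityHom p (of p g) = sg (p g) • of p g :=
  FreeNonUnitalNonAssocAlgebra.lift_of_apply ℂ _ g

theorem parityHom_parityHom (x : FreeSuper p) : parityHom p (parityHom p x) = x := by
  have h : (parityHom p).comp (parityHom p) = NonUnitalAlgHom.id ℂ (FreeSuper p) := by
    refine FreeNonUnitalNonAssocAlgebra.hom_ext ℂ (fun g => ?_)
    change parityHom p (parityHom p (of p g)) = of p g
    rw [parityHom_of, map_smul, parityHom_of, smul_smul, sg_mul_self, one_smul]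
  exact congrArg (fun f => f x) h

instance : Superalgebra (FreeSuper p) where
  parity := ((parityHom p : FreeSuper p →ₙₐ[ℂ] FreeSuper p) : FreeSuper p →ₗ[ℂ] FreeSuper p)
  parity_parity := parityHom_parityHom p
  sbr := LinearMap.mul ℂ (FreeSuper p)
  parity_sbr x y := map_mul (parityHom p) x y

theorem of_mem_homog (g : G) : of p g ∈ homog (FreeSuper p) (p g) := parityHom_of p g

end FreeSuper

/-- The elements of a free superalgebra that have to vanish in the Lie superalgebra with
relations `u = v` for `R u v`. -/
inductive Relator {G : Type} (p : G → ZMod 2) (R : FreeSuper p → FreeSuper p → Prop) :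
    FreeSuper p → Prop
  | skew (a b : ZMod 2) (x y : FreeSuper p) (hx : x ∈ homog (FreeSuper p) a)
      (hy : y ∈ homog (FreeSuper p) b) : Relator p R (sbr x y + sg (a * b) • sbr y x)
  | jacobi (a b c : ZMod 2) (x y z : FreeSuper p) (hx : x ∈ homog (FreeSuper p) a)
      (hy : y ∈ homog (FreeSuper p) b) (hz : z ∈ homog (FreeSuper p) c) :
      Relator p R (sbr x (sbr y z) - (sbr (sbr x y) z + sg (a * b) • sbr y (sbr x z)))
  | rel (u v : FreeSuper p) (h : R u v) : Relator p R (u - v)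

/-- The two-sided ideal generated by the relators. -/
def relIdeal {G : Type} (p : G → ZMod 2) (R : FreeSuper p → FreeSuper p → Prop) :
    Submodule ℂ (FreeSuper p) :=
  sInf {J | (∀ x, Relator p R x → x ∈ J) ∧
    ∀ x, ∀ y ∈ J, sbr x y ∈ J ∧ sbr y x ∈ J}

/-- Both sides of every relation are homogeneous of the same parity. -/
def HomogRel {G : Type} (p : G → ZMod 2) (R : FreeSuper p → FreeSuper p → Prop) : Prop :=
  ∀ u v, R u v → ∃ a, u ∈ homog (FreeSuper p) a ∧ v ∈ homog (FreeSuper p) a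

section Presented

variable {G : Type} (p : G → ZMod 2) (R : FreeSuper p → FreeSuper p → Prop)

theorem relator_mem {x : FreeSuper p} (h : Relator p R x) : x ∈ relIdeal p R :=
  Submodule.mem_sInf.2 (fun _ hJ => hJ.1 x h)

theorem relIdeal_isIdeal (hR : HomogRel p R) : IsIdeal (relIdeal p R) := by
  have hl : ∀ x, ∀ y ∈ relIdeal p R, sbr x y ∈ relIdeal p R := fun x y hy =>
    Submodule.mem_sInf.2 (fun J hJ => (hJ.2 x y (Submodule.mem_sInf.1 hy J hJ)).1)
  have hr : ∀ x, ∀ y ∈ relIdeal p R, sbr y x ∈ relIdeal p R := fun x y hy =>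
    Submodule.mem_sInf.2 (fun J hJ => (hJ.2 x y (Submodule.mem_sInf.1 hy J hJ)).2)
  refine ⟨fun x hx => ?_, hl, fun x hx y => hr y x hx⟩
  have hle : relIdeal p R ≤ (relIdeal p R).comap parity := by
    refine sInf_le ⟨fun x h => ?_, fun x y hy => ⟨?_, ?_⟩⟩
    · have hh : ∃ a, x ∈ homog (FreeSuper p) a := by
        cases h with
        | skew a b x y hx hy =>
          exact ⟨a + b, Submodule.add_mem _ (sbr_mem_homog hx hy)
            (Submodule.smul_mem _ _ (add_comm b a ▸ sbr_mem_homog hy hx))⟩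
        | jacobi a b c x y z hx hy hz =>
          refine ⟨a + (b + c), Submodule.sub_mem _ (sbr_mem_homog hx (sbr_mem_homog hy hz))
            (Submodule.add_mem _ ?_ (Submodule.smul_mem _ _ ?_))⟩
          · exact add_assoc a b c ▸ sbr_mem_homog (sbr_mem_homog hx hy) hz
          · exact add_left_comm b a c ▸ sbr_mem_homog hy (sbr_mem_homog hx hz)
        | rel u v h =>
          obtain ⟨a, hu, hv⟩ := hR u v h
          exact ⟨a, Submodule.sub_mem _ hu hv⟩
      obtain ⟨a, ha⟩ := hh
      rw [Submodule.mem_comap, mem_homog.1 ha]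
      exact Submodule.smul_mem _ _ (relator_mem p R h)
    · rw [Submodule.mem_comap, parity_sbr]
      exact hl _ _ hy
    · rw [Submodule.mem_comap, parity_sbr]
      exact hr _ _ hy
  exact hle hx

theorem presented_isLie (hR : HomogRel p R) :
    @IsLieSuperalgebra (FreeSuper p ⧸ relIdeal p R) _ _
      (quotSuperalgebra _ (relIdeal_isIdeal p R hR)) :=
  quotSuperalgebra_isLie _ _
    (fun a b x hx y hy => relator_mem p R (.skew a b x y hx hy))
    (fun a b c x hx y hy z hz => relator_mem p R (.jacobi a b c x y z hx hy hz))

end Presented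

/-! ## Toroidal Lie superalgebras -/

/-- The Laurent polynomial ring `ℂ[s^±¹, t^±¹]`; the exponent `(k, l)` stands for `s^k t^l`. -/
abbrev R2 : Type := AddMonoidAlgebra ℂ (ℤ × ℤ)

/-- The monomial `s^k t^l`. -/
def mon (k l : ℤ) : R2 := AddMonoidAlgebra.single (k, l) 1

/-- The space `dΩ_R` of exact forms. -/
def exactForms : Submodule ℂ (Ω[R2⁄ℂ]) :=
  LinearMap.range (KaehlerDifferential.D ℂ R2 : R2 →ₗ[ℂ] Ω[R2⁄ℂ])

/-- Kähler differentials modulo exact forms. -/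
abbrev FormsModExact : Type := (Ω[R2⁄ℂ]) ⧸ exactForms

/-- The class of `b da`. -/
def cls (a b : R2) : FormsModExact := exactForms.mkQ (b • KaehlerDifferential.D ℂ R2 a)

/-- The bilinear map sending `(a, b)` to the class of `(da) b`. -/
def clsHom : R2 →ₗ[ℂ] R2 →ₗ[ℂ] FormsModExact :=
  LinearMap.mk₂ ℂ cls
    (fun a a' b => by simp [cls]) (fun c a b => by simp [cls, smul_comm b c])
    (fun a b b' => by simp [cls, add_smul]) (fun c a b => by simp [cls, smul_assoc])

theorem cls_symm (a b : R2) : cls a b = -cls b a := by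
  rw [eq_neg_iff_add_eq_zero, cls, cls, ← map_add]
  refine (Submodule.Quotient.mk_eq_zero _).2 ⟨a * b, ?_⟩
  change KaehlerDifferential.D ℂ R2 (a * b) = _
  rw [Derivation.leibniz, add_comm]

theorem cls_mul (a b c : R2) : cls a (b * c) = cls (a * b) c - cls b (a * c) := by
  rw [eq_sub_iff_add_eq, cls, cls, cls, ← map_add, Derivation.leibniz, smul_add, smul_smul,
    smul_smul, mul_comm c a, mul_comm c b, add_comm]

/-- Even supersymmetric invariant bilinear forms. -/
structure InvariantForm (g : Type) [AddCommGroup g] [Module ℂ g] [Superalgebra g] where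
  form : g →ₗ[ℂ] g →ₗ[ℂ] ℂ
  even : ∀ x y, form (parity x) (parity y) = form x y
  symm : ∀ p q, ∀ x ∈ homog g p, ∀ y ∈ homog g q, form x y = sg (p * q) • form y x
  invariant : ∀ x y z, form (sbr x y) z = form x (sbr y z)

/-- The underlying space `g ⊗ R ⊕ Ω_R / dΩ_R` of the toroidal superalgebra. -/
def Toroidal {g : Type} [AddCommGroup g] [Module ℂ g] [Superalgebra g]
    (_B : InvariantForm g) : Type := (g ⊗[ℂ] R2) × FormsModExact

namespace Toroidal

variable {g : Type} [AddCommGroup g] [Module ℂ g] [Superalgebra g] (B : InvariantForm g)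

instance : AddCommGroup (Toroidal B) :=
  inferInstanceAs (AddCommGroup ((g ⊗[ℂ] R2) × FormsModExact))
instance : Module ℂ (Toroidal B) :=
  inferInstanceAs (Module ℂ ((g ⊗[ℂ] R2) × FormsModExact))

/-- The element `x ⊗ a`. -/
def tens (x : g) (a : R2) : Toroidal B := (x ⊗ₜ[ℂ] a, 0)

/-- A class of differentials as an element of the toroidal superalgebra. -/
def cen (ω : FormsModExact) : Toroidal B := (0, ω)

/-- The bracket of the loop algebra: `(x ⊗ a, y ⊗ b) ↦ [x, y] ⊗ ab`. -/
def loopBr : g ⊗[ℂ] R2 →ₗ[ℂ] g ⊗[ℂ] R2 →ₗ[ℂ] g ⊗[ℂ] R2 :=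
  TensorProduct.map₂ sbr (LinearMap.mul ℂ R2)

/-- The cocycle: `(x ⊗ a, y ⊗ b)` is sent to `(x | y)` times the class of `(da) b`. -/
def cocycle : g ⊗[ℂ] R2 →ₗ[ℂ] g ⊗[ℂ] R2 →ₗ[ℂ] FormsModExact :=
  (TensorProduct.map₂ B.form clsHom).compr₂ (TensorProduct.lid ℂ FormsModExact).toLinearMap

@[simp] theorem loopBr_tmul (x y : g) (a b : R2) :
    loopBr (x ⊗ₜ[ℂ] a) (y ⊗ₜ[ℂ] b) = sbr x y ⊗ₜ[ℂ] (a * b) := rfl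

@[simp] theorem cocycle_tmul (x y : g) (a b : R2) :
    cocycle B (x ⊗ₜ[ℂ] a) (y ⊗ₜ[ℂ] b) = B.form x y • cls a b := rfl

/-- The bracket of the toroidal superalgebra; differentials are central. -/
def bracket : Toroidal B →ₗ[ℂ] Toroidal B →ₗ[ℂ] Toroidal B :=
  LinearMap.mk₂ ℂ (fun X Y => (loopBr X.1 Y.1, cocycle B X.1 Y.1))
    (fun X X' Y => Prod.ext
      ((congrArg (fun f => f Y.1) (map_add loopBr X.1 X'.1)))
      ((congrArg (fun f => f Y.1) (map_add (cocycle B) X.1 X'.1))))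
    (fun c X Y => Prod.ext
      ((congrArg (fun f => f Y.1) (map_smul loopBr c X.1)))
      ((congrArg (fun f => f Y.1) (map_smul (cocycle B) c X.1))))
    (fun X Y Y' => Prod.ext (map_add (loopBr X.1) Y.1 Y'.1) (map_add (cocycle B X.1) Y.1 Y'.1))
    (fun c X Y => Prod.ext (map_smul (loopBr X.1) c Y.1) (map_smul (cocycle B X.1) c Y.1))

/-- The parity involution: `p (x ⊗ a) = p x`, and differentials are even. -/
def par : Toroidal B →ₗ[ℂ] Toroidal B :=
  LinearMap.prodMap (TensorProduct.map parity LinearMap.id) LinearMap.id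

theorem map_parity_parity (w : g ⊗[ℂ] R2) :
    TensorProduct.map (parity : g →ₗ[ℂ] g) (LinearMap.id : R2 →ₗ[ℂ] R2)
      (TensorProduct.map parity LinearMap.id w) = w := by
  induction w with
  | zero => simp
  | tmul x a => simp [parity_parity]
  | add w w' h h' => rw [map_add, map_add, h, h']

theorem map_parity_loopBr (w w' : g ⊗[ℂ] R2) :
    TensorProduct.map (parity : g →ₗ[ℂ] g) (LinearMap.id : R2 →ₗ[ℂ] R2) (loopBr w w') =
      loopBr (TensorProduct.map parity LinearMap.id w)
        (TensorProduct.map parity LinearMap.id w') := by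
  induction w with
  | zero => simp
  | add w v h h' => simp only [map_add, LinearMap.add_apply, h, h']
  | tmul x a =>
    induction w' with
    | zero => simp
    | add w v h h' => simp only [map_add, h, h']
    | tmul y b => simp [parity_sbr]

theorem cocycle_parity (w w' : g ⊗[ℂ] R2) :
    cocycle B (TensorProduct.map parity LinearMap.id w)
        (TensorProduct.map parity LinearMap.id w') = cocycle B w w' := by
  induction w with
  | zero => simp
  | add w v h h' => simp only [map_add, LinearMap.add_apply, h, h']
  | tmul x a =>
    induction w' with
    | zero => simp
    | add w v h h' => simp only [map_add, h, h']
    | tmul y b => simp [B.even]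

instance : Superalgebra (Toroidal B) where
  parity := par B
  parity_parity X := Prod.ext (map_parity_parity X.1) rfl
  sbr := bracket B
  parity_sbr X Y := Prod.ext (map_parity_loopBr X.1 Y.1) (cocycle_parity B X.1 Y.1).symm

/-- Homogeneous elements of `g ⊗ R` are built from homogeneous pure tensors. -/
theorem homog_tensor_induction {p : ZMod 2} {P : g ⊗[ℂ] R2 → Prop}
    (hzero : P 0) (hadd : ∀ w w', P w → P w' → P (w + w'))
    (h : ∀ x ∈ homog g p, ∀ a, P (x ⊗ₜ[ℂ] a)) (X : Toroidal B)
    (hX : X ∈ homog (Toroidal B) p) : P X.1 := by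
  have key : ∀ w : g ⊗[ℂ] R2, P (TensorProduct.map (comp g p) LinearMap.id w) := by
    intro w
    induction w with
    | zero => simpa using hzero
    | tmul x a => exact h _ (comp_mem p x) a
    | add w w' hw hw' => rw [map_add]; exact hadd _ _ hw hw'
  have h1 : TensorProduct.map (parity : g →ₗ[ℂ] g) (LinearMap.id : R2 →ₗ[ℂ] R2) X.1
      = sg p • X.1 := congrArg Prod.fst hX
  have h2 : TensorProduct.map (comp g p) (LinearMap.id : R2 →ₗ[ℂ] R2) X.1 = X.1 := by
    rw [comp, TensorProduct.map_smul_left, TensorProduct.map_add_left,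
      TensorProduct.map_smul_left, LinearMap.smul_apply, LinearMap.add_apply,
      LinearMap.smul_apply, h1, smul_smul, sg_mul_self, TensorProduct.map_id]
    simp only [LinearMap.id_apply]
    module
  exact h2 ▸ key X.1

instance [IsLieSuperalgebra g] : IsLieSuperalgebra (Toroidal B) where
  skew p q X hX Y hY := by
    suffices h : loopBr X.1 Y.1 = -(sg (p * q) • loopBr Y.1 X.1) ∧
        cocycle B X.1 Y.1 = -(sg (p * q) • cocycle B Y.1 X.1) from Prod.ext h.1 h.2
    refine homog_tensor_induction B (p := p)
      (P := fun w => loopBr w Y.1 = -(sg (p * q) • loopBr Y.1 w) ∧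
        cocycle B w Y.1 = -(sg (p * q) • cocycle B Y.1 w)) (by simp) ?_ ?_ X hX
    · rintro w w' ⟨h1, h2⟩ ⟨h1', h2'⟩
      simp only [map_add, LinearMap.add_apply, h1, h2, h1', h2', smul_add, neg_add]
      exact ⟨trivial, trivial⟩
    intro x hx a
    refine homog_tensor_induction B (p := q)
      (P := fun w => loopBr (x ⊗ₜ[ℂ] a) w = -(sg (p * q) • loopBr w (x ⊗ₜ[ℂ] a)) ∧
        cocycle B (x ⊗ₜ[ℂ] a) w = -(sg (p * q) • cocycle B w (x ⊗ₜ[ℂ] a))) (by simp) ?_ ?_ Y hY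
    · rintro w w' ⟨h1, h2⟩ ⟨h1', h2'⟩
      simp only [map_add, LinearMap.add_apply, h1, h2, h1', h2', smul_add, neg_add]
      exact ⟨trivial, trivial⟩
    intro y hy b
    constructor
    · rw [loopBr_tmul, loopBr_tmul, IsLieSuperalgebra.skew p q x hx y hy, mul_comm b a,
        TensorProduct.neg_tmul, TensorProduct.smul_tmul']
    · rw [cocycle_tmul, cocycle_tmul, B.symm p q x hx y hy, cls_symm a b, smul_neg, smul_assoc]
  jacobi p q r X hX Y hY Z hZ := by
    suffices h : loopBr X.1 (loopBr Y.1 Z.1) =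
          loopBr (loopBr X.1 Y.1) Z.1 + sg (p * q) • loopBr Y.1 (loopBr X.1 Z.1) ∧
        cocycle B X.1 (loopBr Y.1 Z.1) =
          cocycle B (loopBr X.1 Y.1) Z.1 + sg (p * q) • cocycle B Y.1 (loopBr X.1 Z.1) from
      Prod.ext h.1 h.2
    refine homog_tensor_induction B (p := p)
      (P := fun w => loopBr w (loopBr Y.1 Z.1) =
          loopBr (loopBr w Y.1) Z.1 + sg (p * q) • loopBr Y.1 (loopBr w Z.1) ∧
        cocycle B w (loopBr Y.1 Z.1) =
          cocycle B (loopBr w Y.1) Z.1 + sg (p * q) • cocycle B Y.1 (loopBr w Z.1))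
      (by simp) ?_ ?_ X hX
    · rintro w w' ⟨h1, h2⟩ ⟨h1', h2'⟩
      simp only [map_add, LinearMap.add_apply, h1, h2, h1', h2', smul_add]
      constructor <;> abel
    intro x hx a
    refine homog_tensor_induction B (p := q)
      (P := fun w => loopBr (x ⊗ₜ[ℂ] a) (loopBr w Z.1) =
          loopBr (loopBr (x ⊗ₜ[ℂ] a) w) Z.1 + sg (p * q) • loopBr w (loopBr (x ⊗ₜ[ℂ] a) Z.1) ∧
        cocycle B (x ⊗ₜ[ℂ] a) (loopBr w Z.1) =
          cocycle B (loopBr (x ⊗ₜ[ℂ] a) w) Z.1 +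
            sg (p * q) • cocycle B w (loopBr (x ⊗ₜ[ℂ] a) Z.1))
      (by simp) ?_ ?_ Y hY
    · rintro w w' ⟨h1, h2⟩ ⟨h1', h2'⟩
      simp only [map_add, LinearMap.add_apply, h1, h2, h1', h2', smul_add]
      constructor <;> abel
    intro y hy b
    refine homog_tensor_induction B (p := r)
      (P := fun w => loopBr (x ⊗ₜ[ℂ] a) (loopBr (y ⊗ₜ[ℂ] b) w) =
          loopBr (loopBr (x ⊗ₜ[ℂ] a) (y ⊗ₜ[ℂ] b)) w +
            sg (p * q) • loopBr (y ⊗ₜ[ℂ] b) (loopBr (x ⊗ₜ[ℂ] a) w) ∧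
        cocycle B (x ⊗ₜ[ℂ] a) (loopBr (y ⊗ₜ[ℂ] b) w) =
          cocycle B (loopBr (x ⊗ₜ[ℂ] a) (y ⊗ₜ[ℂ] b)) w +
            sg (p * q) • cocycle B (y ⊗ₜ[ℂ] b) (loopBr (x ⊗ₜ[ℂ] a) w))
      (by simp) ?_ ?_ Z hZ
    · rintro w w' ⟨h1, h2⟩ ⟨h1', h2'⟩
      simp only [map_add, h1, h2, h1', h2', smul_add]
      constructor <;> abel
    intro z hz c
    constructor
    · simp only [loopBr_tmul]
      rw [IsLieSuperalgebra.jacobi p q r x hx y hy z hz, TensorProduct.add_tmul, mul_assoc,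
        mul_left_comm b a c, TensorProduct.smul_tmul']
    · simp only [loopBr_tmul, cocycle_tmul]
      rw [cls_mul a b c, ← B.invariant x y z, ← B.invariant y x z,
        IsLieSuperalgebra.skew q p y hy x hx, mul_comm q p]
      simp only [map_neg, map_smul, LinearMap.neg_apply, LinearMap.smul_apply, smul_eq_mul,
        neg_smul, smul_neg, smul_smul]
      rw [← mul_assoc, sg_mul_self, one_mul, smul_sub, sub_eq_add_neg]

end Toroidal

/-! ## General linear superalgebras -/

/-- Square matrices whose rows and columns carry the parities `p`: the space underlying
`𝔤𝔩(M|N)`. -/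
def Gl {ι : Type} (_p : ι → ZMod 2) : Type := Matrix ι ι ℂ

namespace Gl

variable {ι : Type} [Fintype ι] [DecidableEq ι] (p : ι → ZMod 2)

instance : Ring (Gl p) := inferInstanceAs (Ring (Matrix ι ι ℂ))
instance : Algebra ℂ (Gl p) := inferInstanceAs (Algebra ℂ (Matrix ι ι ℂ))

/-- The component of parity `a` of a matrix. -/
def part (a : ZMod 2) : Gl p →ₗ[ℂ] Gl p where
  toFun A := Matrix.of fun i j => if p i + p j = a then A i j else 0
  map_add' A B := by
    refine Matrix.ext fun i j => ?_
    change (if _ then A i j + B i j else 0) = (if _ then A i j else 0) + (if _ then B i j else 0)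
    split_ifs <;> simp
  map_smul' c A := by
    refine Matrix.ext fun i j => ?_
    change (if _ then c * A i j else 0) = c * (if _ then A i j else 0)
    split_ifs <;> simp

/-- The parity involution of `𝔤𝔩(M|N)`. -/
def par : Gl p →ₗ[ℂ] Gl p where
  toFun A := Matrix.of fun i j => sg (p i + p j) * A i j
  map_add' A B := Matrix.ext fun i j => mul_add _ (A i j) (B i j)
  map_smul' c A := Matrix.ext fun i j => mul_left_comm _ c (A i j)

/-- The superbracket, that is `ab - (-1) ^ (p(a) p(b)) ba` extended bilinearly. -/
def br : Gl p →ₗ[ℂ] Gl p →ₗ[ℂ] Gl p :=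
  ∑ a : ZMod 2, ∑ b : ZMod 2, ((LinearMap.mul ℂ (Gl p)).compl₁₂ (part p a) (part p b) -
    sg (a * b) • (LinearMap.mul ℂ (Gl p)).flip.compl₁₂ (part p a) (part p b))

theorem br_apply (A B : Gl p) : br p A B = ∑ a : ZMod 2, ∑ b : ZMod 2,
    (part p a A * part p b B - sg (a * b) • (part p b B * part p a A)) := by
  simp [br]

theorem par_apply (A : Gl p) (i j : ι) : par p A i j = sg (p i + p j) * A i j := rfl

theorem part_apply (a : ZMod 2) (A : Gl p) (i j : ι) :
    part p a A i j = if p i + p j = a then A i j else 0 := rfl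

theorem par_mul (A B : Gl p) : par p (A * B) = par p A * par p B := by
  refine Matrix.ext fun i j => ?_
  change sg (p i + p j) * ∑ k, A i k * B k j =
    ∑ k, (sg (p i + p k) * A i k) * (sg (p k + p j) * B k j)
  rw [Finset.mul_sum]
  refine Finset.sum_congr rfl fun k _ => ?_
  rw [sg_add, sg_add, sg_add]
  linear_combination (-(sg (p i) * sg (p j) * A i k * B k j)) * sg_mul_self (p k)

theorem par_part (a : ZMod 2) (A : Gl p) : par p (part p a A) = part p a (par p A) := by
  refine Matrix.ext fun i j => ?_
  rw [par_apply, part_apply, part_apply, par_apply]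
  split_ifs <;> simp

instance : Superalgebra (Gl p) where
  parity := par p
  parity_parity A := Matrix.ext fun i j => by
    rw [par_apply, par_apply, ← mul_assoc, sg_mul_self, one_mul]
  sbr := br p
  parity_sbr A B := by
    simp only [br_apply, map_sum, map_sub, map_smul, par_mul, par_part]

theorem part_homog {a b : ZMod 2} {A : Gl p} (hA : A ∈ homog (Gl p) b) :
    part p a A = if b = a then A else 0 := by
  have h : ∀ i j, sg (p i + p j) * A i j = sg b * A i j := fun i j =>
    congrFun (congrFun hA i) j
  have h0 : ∀ i j, p i + p j ≠ b → A i j = 0 := by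
    intro i j hne
    have := h i j
    rcases zmod_two b with rfl | rfl <;> rcases zmod_two (p i + p j) with h' | h' <;>
      rw [h'] at this hne <;> simp at this hne
    · exact self_eq_neg.1 this.symm
    · exact self_eq_neg.1 this
  refine Matrix.ext fun i j => ?_
  rw [part_apply]
  by_cases hab : b = a
  · rw [if_pos hab]
    split_ifs with h1
    · rfl
    · exact (h0 i j (hab ▸ h1)).symm
  · rw [if_neg hab]
    split_ifs with h1
    · exact h0 i j (fun h2 => hab (h2.symm.trans h1))
    · rfl

theorem sbr_homog {a b : ZMod 2} {A B : Gl p} (hA : A ∈ homog (Gl p) a)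
    (hB : B ∈ homog (Gl p) b) : sbr A B = A * B - sg (a * b) • (B * A) := by
  change br p A B = _
  rw [br_apply, Finset.sum_eq_single a, Finset.sum_eq_single b]
  · rw [part_homog p hA, part_homog p hB, if_pos rfl, if_pos rfl]
  · intro c _ hc
    rw [part_homog p hB, if_neg hc.symm]; simp
  · simp
  · intro c _ hc
    rw [part_homog p hA, if_neg hc.symm]; simp
  · simp

theorem mul_homog {a b : ZMod 2} {A B : Gl p} (hA : A ∈ homog (Gl p) a)
    (hB : B ∈ homog (Gl p) b) : A * B ∈ homog (Gl p) (a + b) := by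
  rw [mem_homog]
  change par p (A * B) = _
  rw [par_mul]
  change parity A * parity B = _
  rw [mem_homog.1 hA, mem_homog.1 hB, sg_add, smul_mul_smul_comm]

instance : IsLieSuperalgebra (Gl p) where
  skew a b A hA B hB := by
    rw [sbr_homog p hA hB, sbr_homog p hB hA, mul_comm b a, smul_sub, smul_smul, sg_mul_self,
      one_smul, neg_sub]
  jacobi a b c A hA B hB C hC := by
    rw [sbr_homog p hA (sbr_mem_homog hB hC), sbr_homog p (sbr_mem_homog hA hB) hC,
      sbr_homog p hB (sbr_mem_homog hA hC), sbr_homog p hA hB, sbr_homog p hA hC,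
      sbr_homog p hB hC]
    have h2 : (1 + 1 : ZMod 2) = 0 := by decide
    rcases zmod_two a with rfl | rfl <;> rcases zmod_two b with rfl | rfl <;>
      rcases zmod_two c with rfl | rfl <;> simp [h2] <;> noncomm_ring

/-- The supertrace. -/
def str : Gl p →ₗ[ℂ] ℂ where
  toFun A := ∑ i, sg (p i) * A i i
  map_add' A B := by
    rw [← Finset.sum_add_distrib]
    exact Finset.sum_congr rfl fun i _ => mul_add _ (A i i) (B i i)
  map_smul' c A := by
    rw [RingHom.id_apply, smul_eq_mul, Finset.mul_sum]
    exact Finset.sum_congr rfl fun i _ => mul_left_comm _ c (A i i)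

theorem str_apply (A : Gl p) : str p A = ∑ i, sg (p i) * A i i := rfl

theorem str_par (A : Gl p) : str p (par p A) = str p A := by
  rw [str_apply, str_apply]
  refine Finset.sum_congr rfl fun i _ => ?_
  rw [par_apply, sg_add, sg_mul_self, one_mul]

theorem str_mul_comm {a b : ZMod 2} {A B : Gl p} (hA : A ∈ homog (Gl p) a)
    (hB : B ∈ homog (Gl p) b) : str p (A * B) = sg (a * b) * str p (B * A) := by
  have hA' : ∀ i j, sg (p i + p j) * A i j = sg a * A i j := fun i j =>
    congrFun (congrFun hA i) j
  have hB' : ∀ i j, sg (p i + p j) * B i j = sg b * B i j := fun i j =>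
    congrFun (congrFun hB i) j
  change ∑ i, sg (p i) * ∑ j, A i j * B j i = sg (a * b) * ∑ j, sg (p j) * ∑ i, B j i * A i j
  simp only [Finset.mul_sum]
  rw [Finset.sum_comm]
  refine Finset.sum_congr rfl fun j _ => Finset.sum_congr rfl fun i _ => ?_
  have h1 := hA' i j
  have h2 := hB' j i
  rcases zmod_two a with rfl | rfl <;> rcases zmod_two b with rfl | rfl <;>
    rcases zmod_two (p i) with hi | hi <;> rcases zmod_two (p j) with hj | hj <;>
    simp only [hi, hj, CharTwo.add_self_eq_zero, add_zero, zero_add, sg_zero, sg_one, one_mul,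
      mul_one, mul_zero] at h1 h2 ⊢ <;>
    first
    | ring1
    | (have h3 : A i j = 0 := by linear_combination (1 / 2 : ℂ) * h1
       rw [h3]; ring1)
    | (have h3 : A i j = 0 := by linear_combination (-1 / 2 : ℂ) * h1
       rw [h3]; ring1)
    | (have h3 : B j i = 0 := by linear_combination (-1 / 2 : ℂ) * h2
       rw [h3]; ring1)

theorem str_sbr (A B : Gl p) : str p (sbr A B) = 0 := by
  induction A using homog_induction with
  | hadd A A' h h' => rw [map_add, LinearMap.add_apply, map_add, h, h', add_zero]
  | h a A hA =>
    induction B using homog_induction with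
    | hadd B B' h h' => rw [map_add, map_add, h, h', add_zero]
    | h b B hB =>
      rw [sbr_homog p hA hB, map_sub, map_smul, str_mul_comm p hA hB, smul_eq_mul, sub_self]

theorem str_invariant (A B C : Gl p) : str p (sbr A B * C) = str p (A * sbr B C) := by
  induction A using homog_induction with
  | hadd A A' h h' =>
    rw [map_add, LinearMap.add_apply, add_mul, add_mul, map_add, map_add, h, h']
  | h a A hA =>
    induction B using homog_induction with
    | hadd B B' h h' =>
      simp only [map_add, LinearMap.add_apply, add_mul, mul_add, h, h']
    | h b B hB =>
      induction C using homog_induction with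
      | hadd C C' h h' => simp only [map_add, mul_add, h, h']
      | h c C hC =>
        rw [sbr_homog p hA hB, sbr_homog p hB hC, sub_mul, mul_sub, smul_mul_assoc,
          mul_smul_comm, map_sub, map_sub, map_smul, map_smul, mul_assoc, mul_assoc,
          ← mul_assoc A C B, str_mul_comm p (mul_homog p hA hC) hB, smul_eq_mul, smul_eq_mul,
          ← mul_assoc (sg (b * c))]
        congr 3
        rcases zmod_two a with rfl | rfl <;> rcases zmod_two b with rfl | rfl <;>
          rcases zmod_two c with rfl | rfl <;> simp [CharTwo.add_self_eq_zero]

/-- The special linear superalgebra `𝔰𝔩(M|N)`. -/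
def sl : Submodule ℂ (Gl p) := LinearMap.ker (str p)

theorem sl_isSubalgebra : IsSubalgebra (sl p) where
  parity_mem A hA := (str_par p A).trans hA
  sbr_mem A _ B _ := str_sbr p A B

/-- The action of a matrix on column vectors. -/
def act (A : Gl p) (x : ι → ℂ) : ι → ℂ := Matrix.mulVec A x

theorem act_zero (x : ι → ℂ) : act p 0 x = 0 := Matrix.zero_mulVec x
theorem act_add (A B : Gl p) (x : ι → ℂ) : act p (A + B) x = act p A x + act p B x :=
  Matrix.add_mulVec (A : Matrix ι ι ℂ) B x
theorem act_sub (A B : Gl p) (x : ι → ℂ) : act p (A - B) x = act p A x - act p B x :=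
  Matrix.sub_mulVec (A : Matrix ι ι ℂ) B x
theorem act_smul (c : ℂ) (A : Gl p) (x : ι → ℂ) : act p (c • A) x = c • act p A x :=
  Matrix.smul_mulVec c (A : Matrix ι ι ℂ) x
theorem act_mul (A B : Gl p) (x : ι → ℂ) : act p (A * B) x = act p A (act p B x) :=
  (Matrix.mulVec_mulVec x (A : Matrix ι ι ℂ) B).symm

/-- The bilinear form on `V = ℂ^ι` with Gram matrix `G`. -/
def vform (G : Matrix ι ι ℂ) : (ι → ℂ) →ₗ[ℂ] (ι → ℂ) →ₗ[ℂ] ℂ := Matrix.toLinearMap₂' ℂ G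

/-- `𝔬𝔰𝔭(M|N)_a`: the matrices of parity `a` with
`(Ax | y) + (-1) ^ (a p(x)) (x | Ay) = 0` for homogeneous `x`. -/
def ospPart (G : Matrix ι ι ℂ) (a : ZMod 2) : Submodule ℂ (Gl p) where
  carrier := {A | A ∈ homog (Gl p) a ∧ ∀ (b : ZMod 2) (x y : ι → ℂ), (∀ i, p i ≠ b → x i = 0) →
    vform G (act p A x) y + sg (a * b) * vform G x (act p A y) = 0}
  zero_mem' := ⟨zero_mem _, fun b x y _ => by simp [act_zero]⟩
  add_mem' := by
    rintro A B ⟨hA, hA'⟩ ⟨hB, hB'⟩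
    refine ⟨add_mem hA hB, fun b x y hx => ?_⟩
    have h1 := hA' b x y hx
    have h2 := hB' b x y hx
    simp only [act_add, map_add, LinearMap.add_apply]
    linear_combination h1 + h2
  smul_mem' := by
    rintro c A ⟨hA, hA'⟩
    refine ⟨Submodule.smul_mem _ c hA, fun b x y hx => ?_⟩
    have h1 := hA' b x y hx
    simp only [act_smul, map_smul, LinearMap.smul_apply, smul_eq_mul]
    linear_combination c * h1

/-- The orthosymplectic superalgebra of the form with Gram matrix `G`. -/
def osp (G : Matrix ι ι ℂ) : Submodule ℂ (Gl p) := ospPart p G 0 ⊔ ospPart p G 1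

theorem ospPart_le (G : Matrix ι ι ℂ) (a : ZMod 2) : ospPart p G a ≤ osp p G := by
  rcases zmod_two a with rfl | rfl
  · exact le_sup_left
  · exact le_sup_right

theorem act_homog {a b : ZMod 2} {A : Gl p} (hA : A ∈ homog (Gl p) a) {x : ι → ℂ}
    (hx : ∀ i, p i ≠ b → x i = 0) (i : ι) (hi : p i ≠ a + b) : act p A x i = 0 := by
  have hA' : A = part p a A := by rw [part_homog p hA, if_pos rfl]
  change ∑ j, A i j * x j = 0
  refine Finset.sum_eq_zero fun j _ => ?_
  by_cases hj : p j = b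
  · rw [hA', part_apply, if_neg, zero_mul]
    intro h
    apply hi
    rw [← h, hj, add_assoc, CharTwo.add_self_eq_zero, add_zero]
  · rw [hx j hj, mul_zero]

theorem sbr_mem_ospPart (G : Matrix ι ι ℂ) {a b : ZMod 2} {A B : Gl p}
    (hA : A ∈ ospPart p G a) (hB : B ∈ ospPart p G b) : sbr A B ∈ ospPart p G (a + b) := by
  refine ⟨sbr_mem_homog hA.1 hB.1, fun c x y hx => ?_⟩
  rw [sbr_homog p hA.1 hB.1]
  have h1 := hA.2 (b + c) (act p B x) y (fun i hi => act_homog p hB.1 hx i hi)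
  have h2 := hB.2 c x (act p A y) hx
  have h3 := hB.2 (a + c) (act p A x) y (fun i hi => act_homog p hA.1 hx i hi)
  have h4 := hA.2 c x (act p B y) hx
  simp only [act_sub, act_smul, act_mul, map_sub, map_smul, LinearMap.sub_apply,
    LinearMap.smul_apply, smul_eq_mul]
  rcases zmod_two a with rfl | rfl <;> rcases zmod_two b with rfl | rfl <;>
    rcases zmod_two c with rfl | rfl <;>
    simp only [CharTwo.add_self_eq_zero, add_zero, zero_add, sg_zero, sg_one, one_mul,
      mul_one, mul_zero] at h1 h2 h3 h4 ⊢ <;>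
    first
    | linear_combination h1 - h2 - h3 + h4
    | linear_combination h1 + h2 - h3 + h4
    | linear_combination h1 - h2 - h3 - h4
    | linear_combination h1 + h2 - h3 - h4
    | linear_combination h1 - h2 + h3 + h4
    | linear_combination h1 + h2 + h3 + h4
    | linear_combination h1 - h2 + h3 - h4

theorem osp_isSubalgebra (G : Matrix ι ι ℂ) : IsSubalgebra (osp p G) where
  parity_mem A hA := by
    obtain ⟨A₀, h0, A₁, h1, rfl⟩ := Submodule.mem_sup.1 hA
    rw [map_add, mem_homog.1 h0.1, mem_homog.1 h1.1]
    exact add_mem (Submodule.smul_mem _ _ (ospPart_le p G 0 h0))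
      (Submodule.smul_mem _ _ (ospPart_le p G 1 h1))
  sbr_mem A hA B hB := by
    obtain ⟨A₀, h0, A₁, h1, rfl⟩ := Submodule.mem_sup.1 hA
    obtain ⟨B₀, k0, B₁, k1, rfl⟩ := Submodule.mem_sup.1 hB
    rw [map_add, map_add, LinearMap.add_apply, LinearMap.add_apply]
    exact add_mem
      (add_mem (ospPart_le p G _ (sbr_mem_ospPart p G h0 k0))
        (ospPart_le p G _ (sbr_mem_ospPart p G h1 k0)))
      (add_mem (ospPart_le p G _ (sbr_mem_ospPart p G h0 k1))
        (ospPart_le p G _ (sbr_mem_ospPart p G h1 k1)))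

end Gl

/-! ## The classical types and their root data -/

/-- The series `A(m,n)`, `B(m,n)`, `C(n)`, `D(m,n)`. -/
inductive SuperType
  | A (m n : ℕ)
  | B (m n : ℕ)
  | C (n : ℕ)
  | D (m n : ℕ)

namespace SuperType

/-- The admissible parameters. -/
def Valid : SuperType → Prop
  | A m n => 1 ≤ m + n
  | B _ n => 1 ≤ n
  | C n => 1 ≤ n
  | D m n => 2 ≤ m ∧ 1 ≤ n

/-- The number `r` of simple roots of the finite-dimensional superalgebra. -/
def rank : SuperType → ℕ
  | A m n => m + n + 1
  | B m n => m + n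
  | C n => n + 1
  | D m n => m + n

/-- Integral weights, written in the coordinates `ε₁, ε₂, …` and `δ₁, δ₂, …`. -/
abbrev Weight : Type := ℕ ⊕ ℕ → ℤ

/-- The weight `ε_i`. -/
def ε (i : ℕ) : Weight := Pi.single (Sum.inl i) 1

/-- The weight `δ_i`. -/
def δ (i : ℕ) : Weight := Pi.single (Sum.inr i) 1

/-- The simple roots `α₀, …, α_r`.  The affine root `α₀` is represented by its finite part `-θ`;
its remaining part is isotropic and orthogonal to all roots. -/
def simpleRoot : SuperType → ℕ → Weight
  | A m n, i =>
      if i = 0 then δ (n + 1) - ε 1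
      else if i ≤ m then ε i - ε (i + 1)
      else if i = m + 1 then ε (m + 1) - δ 1
      else δ (i - (m + 1)) - δ (i - m)
  | B m n, i =>
      if i = 0 then -2 • ε 1
      else if i < n then ε i - ε (i + 1)
      else if i = n then (if m = 0 then ε n else ε n - δ 1)
      else if i < n + m then δ (i - n) - δ (i - n + 1)
      else δ m
  | C n, i =>
      if i = 0 then -ε 1 - δ 1
      else if i = 1 then ε 1 - δ 1
      else if i ≤ n then δ (i - 1) - δ i
      else 2 • δ n
  | D m n, i =>
      if i = 0 then -2 • ε 1
      else if i < n then ε i - ε (i + 1)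
      else if i = n then ε n - δ 1
      else if i < n + m then δ (i - n) - δ (i - n + 1)
      else δ (m - 1) + δ m

/-- The parities of the simple roots. -/
def rootParity : SuperType → ℕ → ZMod 2
  | A m _, i => if i = 0 ∨ i = m + 1 then 1 else 0
  | B _ n, i => if i = n then 1 else 0
  | C _, i => if i = 0 ∨ i = 1 then 1 else 0
  | D _ n, i => if i = n then 1 else 0

/-- The bilinear form with `(ε_i | ε_j) = δ_ij`, `(δ_i | δ_j) = -δ_ij`, `(ε_i | δ_j) = 0`, for
weights supported on coordinates with indices at most `N`. -/
def weightForm (N : ℕ) (x y : Weight) : ℤ :=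
  ∑ i ∈ Finset.range (N + 1), (x (Sum.inl i) * y (Sum.inl i) - x (Sum.inr i) * y (Sum.inr i))

/-- The number `(α_i | α_j)`. -/
def rootForm (X : SuperType) (i j : ℕ) : ℚ :=
  weightForm X.rank (X.simpleRoot i) (X.simpleRoot j)

/-- The numbers `d_i`. -/
def d : SuperType → ℕ → ℚ
  | A m _, i => if i ≤ m + 1 then 1 else -1
  | B m n, i =>
      if i = 0 then 2
      else if m = 0 then (if i < n then 1 else 1 / 2)
      else if i ≤ n then 1 else if i < n + m then -1 else -1 / 2
  | C n, i => if i ≤ 1 then 1 else if i ≤ n then -1 else -2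
  | D _ n, i => if i = 0 then 2 else if i ≤ n then 1 else -1

/-- The extended distinguished Cartan matrix, `(α_i | α_j) = d_i a_ij`. -/
def cartan (X : SuperType) (i j : ℕ) : ℚ := X.rootForm i j / X.d i

end SuperType

/-! ## The algebra `𝔗(X)` -/

/-- The generators of `𝔗(X)`: `K`, `α_i(k)`, and `x_i^±(k)` with the sign as an element of `ℤˣ`. -/
inductive Gen (X : SuperType)
  | K : Gen X
  | al (i : Fin (X.rank + 1)) (k : ℤ) : Gen X
  | x (s : ℤˣ) (i : Fin (X.rank + 1)) (k : ℤ) : Gen X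

/-- The parities of the generators. -/
def genParity (X : SuperType) : Gen X → ZMod 2
  | .K => 0
  | .al _ _ => 0
  | .x _ i _ => X.rootParity i

/-- The free superalgebra on the generators of `𝔗(X)`. -/
abbrev FreeT (X : SuperType) : Type := FreeSuper (genParity X)

namespace FreeT

variable {X : SuperType}

/-- The generator `K`. -/
def K : FreeT X := FreeSuper.of _ Gen.K
/-- The generator `α_i(k)`. -/
def al (i : Fin (X.rank + 1)) (k : ℤ) : FreeT X := FreeSuper.of _ (Gen.al i k)
/-- The generator `x_i^s(k)`, `s = ±1`. -/
def x (s : ℤˣ) (i : Fin (X.rank + 1)) (k : ℤ) : FreeT X := FreeSuper.of _ (Gen.x s i k)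

end FreeT

open FreeT in
/-- The defining relations of `𝔗(X)`.  The relation `[x_i^±(k), x_i^±(l)] = 0` is not imposed for
an odd non-isotropic root, which occurs only as `α_n` in type `B(0,n)`. -/
inductive TRel (X : SuperType) : FreeT X → FreeT X → Prop
  | K_al (i : Fin (X.rank + 1)) (k : ℤ) : TRel X (sbr K (al i k)) 0
  | K_x (s : ℤˣ) (i : Fin (X.rank + 1)) (k : ℤ) : TRel X (sbr K (x s i k)) 0
  | al_al (i j : Fin (X.rank + 1)) (k l : ℤ) :
      TRel X (sbr (al i k) (al j l)) (if k = -l then ((k : ℂ) * (X.rootForm i j : ℂ)) • K else 0)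
  | al_x (s : ℤˣ) (i j : Fin (X.rank + 1)) (k l : ℤ) :
      TRel X (sbr (al i k) (x s j l)) ((((s : ℤ) : ℂ) * (X.rootForm i j : ℂ)) • x s j (k + l))
  | x_x_ne (i j : Fin (X.rank + 1)) (k l : ℤ) (hij : i ≠ j) : TRel X (sbr (x 1 i k) (x (-1) j l)) 0
  | x_x_isotropic (i : Fin (X.rank + 1)) (k l : ℤ) (h : X.rootForm i i = 0) :
      TRel X (sbr (x 1 i k) (x (-1) i l)) (-(al i (k + l) + if k = -l then (k : ℂ) • K else 0))
  | x_x_nonisotropic (i : Fin (X.rank + 1)) (k l : ℤ) (h : X.rootForm i i ≠ 0) :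
      TRel X (sbr (x 1 i k) (x (-1) i l))
        (-((2 / (X.rootForm i i : ℂ)) • (al i (k + l) + if k = -l then (k : ℂ) • K else 0)))
  | x_self (s : ℤˣ) (i : Fin (X.rank + 1)) (k l : ℤ)
      (h : ¬ (X.rootParity i = 1 ∧ X.rootForm i i ≠ 0)) :
      TRel X (sbr (x s i k) (x s i l)) 0
  | x_orth (s : ℤˣ) (i j : Fin (X.rank + 1)) (k l : ℤ)
      (hij : i ≠ j) (hi : X.cartan i i = 0) (h : X.cartan i j = 0) :
      TRel X (sbr (x s i k) (x s j l)) 0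
  | serre_isotropic (s : ℤˣ) (i j : Fin (X.rank + 1)) (k l : ℤ)
      (hi : X.cartan i i = 0) (h : X.cartan i j ≠ 0) :
      TRel X (sbr (x s i k) (sbr (x s i k) (x s j l))) 0
  | serre (s : ℤˣ) (i j : Fin (X.rank + 1)) (k l : ℤ) (N : ℕ) (hij : i ≠ j) (hi : X.cartan i i ≠ 0)
      (hN : (N : ℚ) = 1 - X.cartan i j) :
      TRel X ((⇑(sbr (x s i k)))^[N] (x s j l)) 0

theorem tRel_homog (X : SuperType) : HomogRel (genParity X) (TRel X) := by
  have hK : (FreeT.K : FreeT X) ∈ homog (FreeT X) 0 := FreeSuper.of_mem_homog _ Gen.K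
  have hal : ∀ i k, (FreeT.al i k : FreeT X) ∈ homog (FreeT X) 0 := fun i k =>
    FreeSuper.of_mem_homog _ (Gen.al i k)
  have hx : ∀ (s : ℤˣ) (i : Fin (X.rank + 1)) (k : ℤ),
      (FreeT.x s i k : FreeT X) ∈ homog (FreeT X) (X.rootParity i) :=
    fun s i k => FreeSuper.of_mem_homog _ (Gen.x s i k)
  have hKif : ∀ (P : Prop) [Decidable P] (c : ℂ),
      (if P then c • FreeT.K else 0 : FreeT X) ∈ homog (FreeT X) 0 := by
    intro P _ c
    split_ifs
    · exact Submodule.smul_mem _ _ hK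
    · exact zero_mem _
  have hsum : ∀ (i k) (P : Prop) [Decidable P] (c : ℂ),
      (FreeT.al i k + if P then c • FreeT.K else 0 : FreeT X) ∈ homog (FreeT X) 0 :=
    fun i k P _ c => add_mem (hal i k) (hKif P c)
  have hxx : ∀ s s' i k l, sbr (FreeT.x s i k : FreeT X) (FreeT.x s' i l) ∈
      homog (FreeT X) 0 := by
    intro s s' i k l
    have := sbr_mem_homog (hx s i k) (hx s' i l)
    rwa [CharTwo.add_self_eq_zero] at this
  intro u v h
  cases h with
  | K_al i k => exact ⟨_, sbr_mem_homog hK (hal i k), zero_mem _⟩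
  | K_x s i k => exact ⟨_, sbr_mem_homog hK (hx s i k), zero_mem _⟩
  | al_al i j k l => exact ⟨0, by simpa using sbr_mem_homog (hal i k) (hal j l), hKif _ _⟩
  | al_x s i j k l =>
    exact ⟨X.rootParity j, by simpa using sbr_mem_homog (hal i k) (hx s j l),
      Submodule.smul_mem _ _ (hx s j _)⟩
  | x_x_ne i j k l hij => exact ⟨_, sbr_mem_homog (hx _ i k) (hx _ j l), zero_mem _⟩
  | x_x_isotropic i k l h => exact ⟨0, hxx _ _ i k l, neg_mem (hsum _ _ _ _)⟩
  | x_x_nonisotropic i k l h =>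
    exact ⟨0, hxx _ _ i k l, neg_mem (Submodule.smul_mem _ _ (hsum _ _ _ _))⟩
  | x_self s i k l h => exact ⟨_, sbr_mem_homog (hx _ i k) (hx _ i l), zero_mem _⟩
  | x_orth s i j k l hij hi h => exact ⟨_, sbr_mem_homog (hx _ i k) (hx _ j l), zero_mem _⟩
  | serre_isotropic s i j k l hi h =>
    exact ⟨_, sbr_mem_homog (hx _ i k) (sbr_mem_homog (hx _ i k) (hx _ j l)), zero_mem _⟩
  | serre s i j k l N hij hi hN =>
    have : ∀ n : ℕ, ∃ a, (⇑(sbr (FreeT.x s i k : FreeT X)))^[n] (FreeT.x s j l) ∈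
        homog (FreeT X) a := by
      intro n
      induction n with
      | zero => exact ⟨_, hx s j l⟩
      | succ n ih =>
        obtain ⟨a, ha⟩ := ih
        exact ⟨_, by rw [Function.iterate_succ_apply']; exact sbr_mem_homog (hx s i k) ha⟩
    obtain ⟨a, ha⟩ := this N
    exact ⟨a, ha, zero_mem _⟩

/-- The Lie superalgebra `𝔗(X)`. -/
def LoopT (X : SuperType) : Type := FreeT X ⧸ relIdeal (genParity X) (TRel X)

namespace LoopT

variable (X : SuperType)

instance : AddCommGroup (LoopT X) :=
  inferInstanceAs (AddCommGroup (FreeT X ⧸ relIdeal (genParity X) (TRel X)))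
instance : Module ℂ (LoopT X) :=
  inferInstanceAs (Module ℂ (FreeT X ⧸ relIdeal (genParity X) (TRel X)))
instance : Superalgebra (LoopT X) := quotSuperalgebra _ (relIdeal_isIdeal _ _ (tRel_homog X))
instance : IsLieSuperalgebra (LoopT X) := presented_isLie _ _ (tRel_homog X)

/-- The generators as elements of `𝔗(X)`. -/
def gen (a : Gen X) : LoopT X := (relIdeal (genParity X) (TRel X)).mkQ (FreeSuper.of _ a)

end LoopT

/-! ## The finite-dimensional Lie superalgebras of type `X` -/

/-- Labels of standard basis vectors.  Even ones: `u i`, `u' i`, `w`; odd ones: `v i`, `v' i`. -/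
inductive Lbl
  | u (i : ℕ)
  | u' (i : ℕ)
  | w
  | v (i : ℕ)
  | v' (i : ℕ)
  deriving DecidableEq

namespace Lbl

/-- The parity of a basis vector. -/
def par : Lbl → ZMod 2
  | u _ => 0
  | u' _ => 0
  | w => 0
  | v _ => 1
  | v' _ => 1

/-- The basis vector that is paired with a given one by the orthosymplectic form. -/
def dual : Lbl → Lbl
  | u i => u' i
  | u' i => u i
  | w => w
  | v i => v' i
  | v' i => v i

/-- The value of the orthosymplectic form on `(a, dual a)`. -/
def gamma : Lbl → ℂ
  | v' _ => -1
  | _ => 1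

end Lbl

open Lbl

namespace SuperType

/-- Basis vectors `u_1, u'_1, …, u_m, u'_m` and `v_1, v'_1, …, v_n, v'_n`. -/
def pairedBasis (m n : ℕ) : Finset Lbl :=
  (Finset.Icc 1 m).image u ∪ (Finset.Icc 1 m).image u' ∪
    (Finset.Icc 1 n).image v ∪ (Finset.Icc 1 n).image v'

/-- The basis of the defining representation `V = V₀ ⊕ V₁`, of dimension `(m+1 | n+1)`,
`(2m+1 | 2n)`, `(2 | 2n)`, `(2m | 2n)` respectively. -/
def basis : SuperType → Finset Lbl
  | A m n => (Finset.Icc 1 (m + 1)).image u ∪ (Finset.Icc 1 (n + 1)).image v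
  | B m n => insert w (pairedBasis m n)
  | C n => pairedBasis 1 n
  | D m n => pairedBasis m n

/-- The index set of matrices of type `X`. -/
abbrev Idx (X : SuperType) : Type := {a : Lbl // a ∈ X.basis}

/-- The parities of the basis vectors. -/
def idxPar (X : SuperType) (i : X.Idx) : ZMod 2 := i.1.par

/-- The general linear superalgebra of `V`. -/
abbrev glV (X : SuperType) : Type := Gl X.idxPar

/-- The Gram matrix of the orthosymplectic form: symmetric on `V₀`, skew on `V₁`. -/
def gram (X : SuperType) : Matrix X.Idx X.Idx ℂ :=
  Matrix.of fun i j => if j.1 = i.1.dual then i.1.gamma else 0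

/-- The matrix superalgebra: `𝔰𝔩(m+1|n+1)` in type `A`, and `𝔬𝔰𝔭(2m+1|2n)`, `𝔬𝔰𝔭(2|2n)`,
`𝔬𝔰𝔭(2m|2n)` in types `B`, `C`, `D`. -/
def matAlg : (X : SuperType) → Submodule ℂ X.glV
  | A m n => Gl.sl (A m n).idxPar
  | B m n => Gl.osp (B m n).idxPar (B m n).gram
  | C n => Gl.osp (C n).idxPar (C n).gram
  | D m n => Gl.osp (D m n).idxPar (D m n).gram

theorem matAlg_isSubalgebra : (X : SuperType) → IsSubalgebra X.matAlg
  | A _ _ => Gl.sl_isSubalgebra _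
  | B _ _ => Gl.osp_isSubalgebra _ _
  | C _ => Gl.osp_isSubalgebra _ _
  | D _ _ => Gl.osp_isSubalgebra _ _

instance (X : SuperType) : Superalgebra X.matAlg := subSuperalgebra _ X.matAlg_isSubalgebra
instance (X : SuperType) : IsLieSuperalgebra X.matAlg :=
  subSuperalgebra_isLie _ X.matAlg_isSubalgebra

/-- The ideal of scalar matrices of `𝔰𝔩(n+1|n+1)` in type `A(n,n)`, and zero otherwise. -/
def scalarIdeal : (X : SuperType) → Submodule ℂ X.matAlg
  | A m n => if m = n then (Submodule.span ℂ {(1 : (A m n).glV)}).comap (A m n).matAlg.subtype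
      else ⊥
  | B _ _ => ⊥
  | C _ => ⊥
  | D _ _ => ⊥

/-- The scalar by which the supertrace form has to be multiplied. -/
def formScale : SuperType → ℂ
  | A _ _ => 1
  | B _ _ => -1 / 2
  | C _ => 1 / 2
  | D _ _ => -1 / 2

end SuperType

theorem Gl.one_homog {ι : Type} [Fintype ι] [DecidableEq ι] (p : ι → ZMod 2) :
    (1 : Gl p) ∈ homog (Gl p) 0 := by
  rw [mem_homog, sg_zero, one_smul]
  refine Matrix.ext fun i j => ?_
  change sg (p i + p j) * (1 : Matrix ι ι ℂ) i j = (1 : Matrix ι ι ℂ) i j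
  by_cases h : i = j
  · subst h; simp [CharTwo.add_self_eq_zero]
  · simp [h]

theorem Gl.sbr_one {ι : Type} [Fintype ι] [DecidableEq ι] (p : ι → ZMod 2) (A : Gl p) :
    sbr A (1 : Gl p) = 0 := by
  induction A using homog_induction with
  | hadd A B hA hB => rw [map_add, LinearMap.add_apply, hA, hB, add_zero]
  | h a A hA => rw [Gl.sbr_homog p hA (Gl.one_homog p)]; simp

theorem Gl.one_sbr {ι : Type} [Fintype ι] [DecidableEq ι] (p : ι → ZMod 2) (A : Gl p) :
    sbr (1 : Gl p) A = 0 := by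
  induction A using homog_induction with
  | hadd A B hA hB => rw [map_add, hA, hB, add_zero]
  | h a A hA => rw [Gl.sbr_homog p (Gl.one_homog p) hA]; simp

namespace SuperType

variable (X : SuperType)

theorem exists_scalar_of_mem {X : SuperType} {x : X.matAlg} (hx : x ∈ X.scalarIdeal) :
    ∃ c : ℂ, x.1 = c • (1 : X.glV) := by
  have h0 : ∀ X : SuperType, ∀ x : X.matAlg, x ∈ (⊥ : Submodule ℂ X.matAlg) →
      ∃ c : ℂ, x.1 = c • (1 : X.glV) := by
    intro X x hx
    rw [Submodule.mem_bot] at hx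
    exact ⟨0, by rw [hx]; simp⟩
  cases X with
  | A m n =>
    rw [scalarIdeal] at hx
    split_ifs at hx with h
    · obtain ⟨c, hc⟩ := Submodule.mem_span_singleton.1 hx
      exact ⟨c, hc.symm⟩
    · exact h0 _ x hx
  | B m n => exact h0 _ x hx
  | C n => exact h0 _ x hx
  | D m n => exact h0 _ x hx

theorem scalarIdeal_isIdeal : IsIdeal X.scalarIdeal where
  parity_mem x hx := by
    obtain ⟨c, hc⟩ := exists_scalar_of_mem hx
    have h : parity x = x := by
      refine Subtype.ext ?_
      change parity x.1 = x.1
      rw [hc, map_smul, mem_homog.1 (Gl.one_homog X.idxPar), sg_zero, one_smul]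
    rwa [h]
  sbr_mem_left x y hy := by
    obtain ⟨c, hc⟩ := exists_scalar_of_mem hy
    have h : sbr x y = 0 := by
      refine Subtype.ext ?_
      change sbr x.1 y.1 = 0
      rw [hc, map_smul, Gl.sbr_one, smul_zero]
    rw [h]; exact zero_mem _
  sbr_mem_right x hx y := by
    obtain ⟨c, hc⟩ := exists_scalar_of_mem hx
    have h : sbr x y = 0 := by
      refine Subtype.ext ?_
      change sbr x.1 y.1 = 0
      rw [hc, map_smul, LinearMap.smul_apply, Gl.one_sbr, smul_zero]
    rw [h]; exact zero_mem _

/-- The basic classical Lie superalgebra `𝔤` of type `X`. -/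
def G : Type := X.matAlg ⧸ X.scalarIdeal

instance : AddCommGroup X.G := inferInstanceAs (AddCommGroup (X.matAlg ⧸ X.scalarIdeal))
instance : Module ℂ X.G := inferInstanceAs (Module ℂ (X.matAlg ⧸ X.scalarIdeal))
instance : Superalgebra X.G := quotSuperalgebra _ X.scalarIdeal_isIdeal
instance : IsLieSuperalgebra X.G := quotSuperalgebra_isLie _ X.scalarIdeal_isIdeal
  (fun p q x hx y hy => by
    rw [IsLieSuperalgebra.skew p q x hx y hy, neg_add_cancel]; exact zero_mem _)
  (fun p q r x hx y hy z hz => by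
    rw [IsLieSuperalgebra.jacobi p q r x hx y hy z hz, sub_self]; exact zero_mem _)

/-- The form `(x, y) ↦ c · str(xy)` on the matrix superalgebra. -/
def matForm : X.matAlg →ₗ[ℂ] X.matAlg →ₗ[ℂ] ℂ :=
  X.formScale • ((LinearMap.mul ℂ X.glV).compr₂ (Gl.str X.idxPar)).compl₁₂
    X.matAlg.subtype X.matAlg.subtype

theorem matForm_apply (x y : X.matAlg) :
    X.matForm x y = X.formScale * Gl.str X.idxPar (x.1 * y.1) := rfl

theorem matForm_scalar (x y : X.matAlg) (hx : x ∈ X.scalarIdeal) :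
    X.matForm x y = 0 ∧ X.matForm y x = 0 := by
  obtain ⟨c, hc⟩ := exists_scalar_of_mem hx
  rw [matForm_apply, matForm_apply, hc, smul_one_mul, mul_smul_one, map_smul]
  suffices h : x = 0 ∨ Gl.str X.idxPar y.1 = 0 by
    rcases h with h | h
    · have h1 : c • (1 : X.glV) = 0 := by rw [← hc, h]; rfl
      have h2 : c • y.1 = 0 := by rw [← smul_one_mul c y.1, h1, zero_mul]
      rw [← map_smul, h2]; simp
    · rw [h]; simp
  cases X with
  | A m n => exact Or.inr y.2
  | B m n => exact Or.inl ((Submodule.mem_bot ℂ).1 hx)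
  | C n => exact Or.inl ((Submodule.mem_bot ℂ).1 hx)
  | D m n => exact Or.inl ((Submodule.mem_bot ℂ).1 hx)

/-- The projection of the matrix superalgebra onto `𝔤`. -/
def toG : X.matAlg →ₗ[ℂ] X.G := X.scalarIdeal.mkQ

theorem toG_surjective : Function.Surjective X.toG := X.scalarIdeal.mkQ_surjective

theorem toG_parity (x : X.matAlg) : parity (X.toG x) = X.toG (parity x) := rfl

theorem toG_sbr (x y : X.matAlg) : sbr (X.toG x) (X.toG y) = X.toG (sbr x y) := rfl

theorem exists_homog_toG (p : ZMod 2) (x : X.G) (hx : x ∈ homog X.G p) :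
    ∃ x' ∈ homog X.matAlg p, X.toG x' = x :=
  exists_homog_rep _ X.scalarIdeal_isIdeal p x hx

/-- The form induced by `matForm` on `𝔤`. -/
def quotForm : X.G →ₗ[ℂ] X.G →ₗ[ℂ] ℂ :=
  X.scalarIdeal.liftQ
    { toFun := fun x => X.scalarIdeal.liftQ (X.matForm x)
        (fun y hy => (X.matForm_scalar y x hy).2)
      map_add' := fun x y => Submodule.linearMap_qext _ (LinearMap.ext fun z => by
        change X.matForm (x + y) z = X.matForm x z + X.matForm y z
        rw [map_add, LinearMap.add_apply])
      map_smul' := fun c x => Submodule.linearMap_qext _ (LinearMap.ext fun z => by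
        change X.matForm (c • x) z = c • X.matForm x z
        rw [map_smul, LinearMap.smul_apply]) }
    (fun x hx => Submodule.linearMap_qext _ (LinearMap.ext fun z =>
      (X.matForm_scalar x z hx).1))

theorem quotForm_toG (x y : X.matAlg) : X.quotForm (X.toG x) (X.toG y) =
    X.formScale * Gl.str X.idxPar (x.1 * y.1) := rfl

/-- The standard invariant form on `𝔤`, a multiple of the supertrace form: it induces
`(α_i | α_j) = d_i a_ij` on roots. -/
def stdForm : InvariantForm X.G where
  form := X.quotForm
  even x y := by
    obtain ⟨x, rfl⟩ := X.toG_surjective x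
    obtain ⟨y, rfl⟩ := X.toG_surjective y
    rw [toG_parity, toG_parity, quotForm_toG, quotForm_toG]
    exact congrArg (X.formScale * ·)
      ((congrArg _ (Gl.par_mul X.idxPar x.1 y.1).symm).trans (Gl.str_par _ _))
  symm p q x hx y hy := by
    obtain ⟨x, hx', rfl⟩ := X.exists_homog_toG p x hx
    obtain ⟨y, hy', rfl⟩ := X.exists_homog_toG q y hy
    rw [quotForm_toG, quotForm_toG, Gl.str_mul_comm X.idxPar (A := x.1) (B := y.1)
      (congrArg Subtype.val hx') (congrArg Subtype.val hy'), smul_eq_mul, mul_left_comm]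
  invariant x y z := by
    obtain ⟨x, rfl⟩ := X.toG_surjective x
    obtain ⟨y, rfl⟩ := X.toG_surjective y
    obtain ⟨z, rfl⟩ := X.toG_surjective z
    rw [toG_sbr, toG_sbr, quotForm_toG, quotForm_toG]
    exact congrArg (X.formScale * ·) (Gl.str_invariant X.idxPar x.1 y.1 z.1)

/-! ### Chevalley generators -/

/-- The matrix unit `E_{a,b}`, sending the basis vector `b` to `a` (zero if `a` or `b` is not
among the basis vectors). -/
def E (a b : Lbl) : X.glV := Matrix.of fun i j => if i.1 = a ∧ j.1 = b then 1 else 0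

/-- The element `E_{a,b} ± E_{b*,a*}` of the orthosymplectic superalgebra, where `*` is
`Lbl.dual`. -/
def F (a b : Lbl) : X.glV :=
  X.E a b - (sg ((a.par + b.par) * b.par) * a.gamma * b.gamma) • X.E b.dual a.dual

/-- The Chevalley generators `e_0, …, e_r` as matrices.  In type `C` the weights `ε_1`, `δ_j` are
those of `u 1`, `v j`; in types `B`, `D` the weights `ε_j`, `δ_i` are those of `v j`, `u i`; in
type `A` the weights `ε_i`, `δ_j` are those of `u i`, `v j`. -/
def eMat : (X : SuperType) → ℕ → X.glV
  | A m n, i =>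
      if i = 0 then (A m n).E (v (n + 1)) (u 1)
      else if i ≤ m then (A m n).E (u i) (u (i + 1))
      else if i = m + 1 then (A m n).E (u (m + 1)) (v 1)
      else (A m n).E (v (i - (m + 1))) (v (i - m))
  | B m n, i =>
      if i = 0 then (1 / 2 : ℂ) • (B m n).F (v' 1) (v 1)
      else if i < n then (B m n).F (v i) (v (i + 1))
      else if i = n then (if m = 0 then (B m n).F (v n) w else (B m n).F (v n) (u 1))
      else if i < n + m then (B m n).F (u (i - n)) (u (i - n + 1))
      else (B m n).F (u m) w
  | C n, i =>
      if i = 0 then (C n).F (u' 1) (v 1)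
      else if i = 1 then (C n).F (u 1) (v 1)
      else if i ≤ n then (C n).F (v (i - 1)) (v i)
      else (1 / 2 : ℂ) • (C n).F (v n) (v' n)
  | D m n, i =>
      if i = 0 then (1 / 2 : ℂ) • (D m n).F (v' 1) (v 1)
      else if i < n then (D m n).F (v i) (v (i + 1))
      else if i = n then (D m n).F (v n) (u 1)
      else if i < n + m then (D m n).F (u (i - n)) (u (i - n + 1))
      else (D m n).F (u (m - 1)) (u' m)

/-- The Chevalley generators `f_0, …, f_r` as matrices, normalized by `[h_i, e_i] = a_ii e_i` and
`(e_i | f_i) = 1 / d_i`, where `h_i = [e_i, f_i]`. -/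
def fMat : (X : SuperType) → ℕ → X.glV
  | A m n, i =>
      if i = 0 then -(A m n).E (u 1) (v (n + 1))
      else if i ≤ m then (A m n).E (u (i + 1)) (u i)
      else if i = m + 1 then (A m n).E (v 1) (u (m + 1))
      else (A m n).E (v (i - m)) (v (i - (m + 1)))
  | B m n, i =>
      if i = 0 then (1 / 2 : ℂ) • (B m n).F (v 1) (v' 1)
      else if i < n then (B m n).F (v (i + 1)) (v i)
      else if i = n then (if m = 0 then (2 : ℂ) • (B m n).F w (v n) else (B m n).F (u 1) (v n))
      else if i < n + m then (B m n).F (u (i - n + 1)) (u (i - n))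
      else (2 : ℂ) • (B m n).F w (u m)
  | C n, i =>
      if i = 0 then (C n).F (v 1) (u' 1)
      else if i = 1 then (C n).F (v 1) (u 1)
      else if i ≤ n then (C n).F (v i) (v (i - 1))
      else (1 / 2 : ℂ) • (C n).F (v' n) (v n)
  | D m n, i =>
      if i = 0 then (1 / 2 : ℂ) • (D m n).F (v 1) (v' 1)
      else if i < n then (D m n).F (v (i + 1)) (v i)
      else if i = n then (D m n).F (u 1) (v n)
      else if i < n + m then (D m n).F (u (i - n + 1)) (u (i - n))
      else (D m n).F (u' m) (u (m - 1))

theorem E_mem_homog (a b : Lbl) : X.E a b ∈ homog X.glV (a.par + b.par) := by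
  refine Matrix.ext fun i j => ?_
  change sg (i.1.par + j.1.par) * (if i.1 = a ∧ j.1 = b then 1 else 0) =
    sg (a.par + b.par) * (if i.1 = a ∧ j.1 = b then 1 else 0)
  split_ifs with h
  · rw [h.1, h.2]
  · rw [mul_zero, mul_zero]

theorem str_E {a b : Lbl} (h : a ≠ b) : Gl.str X.idxPar (X.E a b) = 0 := by
  rw [Gl.str_apply]
  refine Finset.sum_eq_zero fun i _ => ?_
  change _ * (if i.1 = a ∧ i.1 = b then (1 : ℂ) else 0) = 0
  rw [if_neg (fun h' => h (h'.1.symm.trans h'.2)), mul_zero]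

/-- The basis is closed under `Lbl.dual` outside type `A`. -/
def SelfDual : Prop := ∀ a, a ∈ X.basis → a.dual ∈ X.basis

theorem dual_dual (a : Lbl) : a.dual.dual = a := by cases a <;> rfl
theorem par_dual (a : Lbl) : a.dual.par = a.par := by cases a <;> rfl
theorem gamma_dual (a : Lbl) : a.dual.gamma = sg a.par * a.gamma := by
  cases a <;> simp [Lbl.dual, Lbl.gamma, Lbl.par]
theorem gamma_mul_self (a : Lbl) : a.gamma * a.gamma = 1 := by
  cases a <;> simp [Lbl.gamma]

theorem pairedBasis_dual (m n : ℕ) (a : Lbl) (h : a ∈ pairedBasis m n) :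
    a.dual ∈ pairedBasis m n := by
  cases a <;> simp_all [pairedBasis, Lbl.dual]

theorem selfDual_B (m n : ℕ) : (B m n).SelfDual := by
  intro a h
  rcases Finset.mem_insert.1 h with rfl | h
  · exact Finset.mem_insert_self _ _
  · exact Finset.mem_insert_of_mem (pairedBasis_dual m n a h)
theorem selfDual_C (n : ℕ) : (C n).SelfDual := pairedBasis_dual 1 n
theorem selfDual_D (m n : ℕ) : (D m n).SelfDual := pairedBasis_dual m n

/-- The coordinate of a vector at a label (zero if the label is not among the basis vectors). -/
def coord (x : X.Idx → ℂ) (a : Lbl) : ℂ := if h : a ∈ X.basis then x ⟨a, h⟩ else 0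

theorem act_E (a b : Lbl) (x : X.Idx → ℂ) (i : X.Idx) :
    Gl.act X.idxPar (X.E a b) x i = if i.1 = a then X.coord x b else 0 := by
  change ∑ j : X.Idx, (if i.1 = a ∧ j.1 = b then (1 : ℂ) else 0) * x j = _
  by_cases hi : i.1 = a
  · rw [if_pos hi, coord]
    split_ifs with hb
    · rw [Finset.sum_eq_single ⟨b, hb⟩]
      · rw [if_pos ⟨hi, rfl⟩, one_mul]
      · intro j _ hj
        rw [if_neg (fun h => hj (Subtype.ext h.2)), zero_mul]
      · intro h; exact absurd (Finset.mem_univ _) h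
    · refine Finset.sum_eq_zero fun j _ => ?_
      rw [if_neg (fun (h : i.1 = a ∧ j.1 = b) => hb (h.2 ▸ j.2)), zero_mul]
  · rw [if_neg hi]
    refine Finset.sum_eq_zero fun j _ => ?_
    rw [if_neg (fun h => hi h.1), zero_mul]

theorem vform_eq (hX : X.SelfDual) (x y : X.Idx → ℂ) :
    Gl.vform X.gram x y = ∑ i : X.Idx, x i * (i.1.gamma * X.coord y i.1.dual) := by
  rw [Gl.vform, Matrix.toLinearMap₂'_apply']
  refine Finset.sum_congr rfl fun i _ => ?_
  congr 1
  change ∑ j : X.Idx, (if j.1 = i.1.dual then i.1.gamma else 0) * y j = _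
  rw [Finset.sum_eq_single ⟨i.1.dual, hX _ i.2⟩]
  · rw [if_pos rfl, coord, dif_pos (hX _ i.2)]
  · intro j _ hj
    rw [if_neg (fun h => hj (Subtype.ext h)), zero_mul]
  · intro h; exact absurd (Finset.mem_univ _) h

theorem vform_E_left (hX : X.SelfDual) (a b : Lbl) (ha : a ∈ X.basis) (x y : X.Idx → ℂ) :
    Gl.vform X.gram (Gl.act X.idxPar (X.E a b) x) y =
      a.gamma * X.coord x b * X.coord y a.dual := by
  rw [vform_eq X hX, Finset.sum_eq_single ⟨a, ha⟩]
  · rw [act_E, if_pos rfl]; ring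
  · intro j _ hj
    rw [act_E, if_neg (fun h => hj (Subtype.ext h)), zero_mul]
  · intro h; exact absurd (Finset.mem_univ _) h

theorem vform_E_right (hX : X.SelfDual) (a b : Lbl) (ha : a ∈ X.basis) (x y : X.Idx → ℂ) :
    Gl.vform X.gram x (Gl.act X.idxPar (X.E a b) y) =
      a.dual.gamma * X.coord x a.dual * X.coord y b := by
  have hd := hX a ha
  rw [vform_eq X hX, Finset.sum_eq_single ⟨a.dual, hd⟩]
  · change x ⟨a.dual, hd⟩ * (a.dual.gamma * X.coord _ a.dual.dual) = _
    rw [dual_dual, coord, dif_pos ha, act_E, if_pos rfl, coord, coord, dif_pos hd]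
    ring
  · intro j _ hj
    rw [coord, dif_pos (hX _ j.2), act_E, if_neg, mul_zero, mul_zero]
    intro h
    apply hj
    refine Subtype.ext ?_
    change j.1 = a.dual
    rw [← h, dual_dual]
  · intro h; exact absurd (Finset.mem_univ _) h

theorem E_eq_zero (a b : Lbl) (h : a ∉ X.basis ∨ b ∉ X.basis) : X.E a b = 0 := by
  refine Matrix.ext fun i j => ?_
  change (if i.1 = a ∧ j.1 = b then (1 : ℂ) else 0) = 0
  refine if_neg fun h' => ?_
  rcases h with h | h
  · exact h (h'.1 ▸ i.2)
  · exact h (h'.2 ▸ j.2)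

theorem F_mem (hX : X.SelfDual) (a b : Lbl) : X.F a b ∈ Gl.osp X.idxPar X.gram := by
  refine Gl.ospPart_le X.idxPar X.gram (a.par + b.par) ?_
  have hmem : ∀ c, c.dual ∈ X.basis ↔ c ∈ X.basis := fun c =>
    ⟨fun h => dual_dual c ▸ hX _ h, hX c⟩
  by_cases hab : a ∈ X.basis ∧ b ∈ X.basis
  · obtain ⟨ha, hb⟩ := hab
    have hp : X.E b.dual a.dual ∈ homog X.glV (a.par + b.par) := by
      have := X.E_mem_homog b.dual a.dual
      rwa [par_dual, par_dual, add_comm] at this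
    refine ⟨sub_mem (X.E_mem_homog a b) (Submodule.smul_mem _ _ hp), fun c x y hx => ?_⟩
    have hc : ∀ l : Lbl, l.par ≠ c → X.coord x l = 0 := by
      intro l hl
      rw [coord]
      split_ifs with h
      · exact hx _ hl
      · rfl
    rw [F, Gl.act_sub, Gl.act_smul, Gl.act_sub, Gl.act_smul]
    simp only [map_sub, map_smul, LinearMap.sub_apply, LinearMap.smul_apply, smul_eq_mul]
    rw [vform_E_left X hX a b ha, vform_E_left X hX _ _ (hX _ hb), vform_E_right X hX a b ha,
      vform_E_right X hX _ _ (hX _ hb), dual_dual, gamma_dual a, gamma_dual b]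
    have ga := gamma_mul_self a
    have gb := gamma_mul_self b
    have h1 : X.coord x b = 0 ∨ b.par = c := by
      by_cases h : b.par = c
      · exact Or.inr h
      · exact Or.inl (hc b h)
    have h2 : X.coord x a.dual = 0 ∨ a.par = c := by
      by_cases h : a.par = c
      · exact Or.inr h
      · exact Or.inl (hc a.dual (by rwa [par_dual]))
    have e1 : a.gamma * X.coord x b * X.coord y a.dual -
        sg ((a.par + b.par) * c) * (sg ((a.par + b.par) * b.par) * a.gamma * b.gamma *
          (b.gamma * X.coord x b * X.coord y a.dual)) = 0 := by
      rcases h1 with h | h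
      · rw [h]; ring
      · rw [h]
        linear_combination (-(a.gamma * X.coord x b * X.coord y a.dual)) *
          (sg_mul_self ((a.par + c) * c) * (b.gamma * b.gamma) + gb)
    have e2 : sg ((a.par + b.par) * c) * (sg a.par * a.gamma * X.coord x a.dual * X.coord y b) -
        sg ((a.par + b.par) * b.par) * a.gamma * b.gamma *
          (sg b.par * b.gamma * X.coord x a.dual * X.coord y b) = 0 := by
      rcases h2 with h | h
      · rw [h]; ring
      · rw [h]
        have e3 : sg ((c + b.par) * c) * sg c = sg ((c + b.par) * b.par) * sg b.par := by
          rcases zmod_two c with h | h <;> rcases zmod_two b.par with h' | h' <;>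
            simp [h, h', CharTwo.add_self_eq_zero]
        linear_combination (a.gamma * X.coord x a.dual * X.coord y b) *
          (e3 - sg ((c + b.par) * b.par) * sg b.par * gb)
    linear_combination e1 + e2
  · have h1 : X.E a b = 0 := X.E_eq_zero a b (not_and_or.1 hab)
    have h2 : X.E b.dual a.dual = 0 := by
      refine X.E_eq_zero _ _ ?_
      rw [hmem, hmem]
      exact (not_and_or.1 hab).symm
    rw [F, h1, h2, smul_zero, sub_zero]
    exact zero_mem _

theorem eMat_mem (i : ℕ) : X.eMat i ∈ X.matAlg := by
  cases X with
  | A m n =>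
    change Gl.str _ (eMat (A m n) i) = 0
    rw [eMat]
    split_ifs <;> refine str_E _ ?_ <;> simp
    omega
  | B m n =>
    change eMat (B m n) i ∈ Gl.osp _ _
    rw [eMat]
    split_ifs <;>
      first
      | exact F_mem _ (selfDual_B m n) _ _
      | exact Submodule.smul_mem _ _ (F_mem _ (selfDual_B m n) _ _)
  | C n =>
    change eMat (C n) i ∈ Gl.osp _ _
    rw [eMat]
    split_ifs <;>
      first
      | exact F_mem _ (selfDual_C n) _ _
      | exact Submodule.smul_mem _ _ (F_mem _ (selfDual_C n) _ _)
  | D m n =>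
    change eMat (D m n) i ∈ Gl.osp _ _
    rw [eMat]
    split_ifs <;>
      first
      | exact F_mem _ (selfDual_D m n) _ _
      | exact Submodule.smul_mem _ _ (F_mem _ (selfDual_D m n) _ _)

theorem fMat_mem (i : ℕ) : X.fMat i ∈ X.matAlg := by
  cases X with
  | A m n =>
    change Gl.str _ (fMat (A m n) i) = 0
    rw [fMat]
    split_ifs
    · rw [map_neg, str_E _ (by simp), neg_zero]
    all_goals refine str_E _ ?_; simp
    omega
  | B m n =>
    change fMat (B m n) i ∈ Gl.osp _ _
    rw [fMat]
    split_ifs <;>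
      first
      | exact F_mem _ (selfDual_B m n) _ _
      | exact Submodule.smul_mem _ _ (F_mem _ (selfDual_B m n) _ _)
  | C n =>
    change fMat (C n) i ∈ Gl.osp _ _
    rw [fMat]
    split_ifs <;>
      first
      | exact F_mem _ (selfDual_C n) _ _
      | exact Submodule.smul_mem _ _ (F_mem _ (selfDual_C n) _ _)
  | D m n =>
    change fMat (D m n) i ∈ Gl.osp _ _
    rw [fMat]
    split_ifs <;>
      first
      | exact F_mem _ (selfDual_D m n) _ _
      | exact Submodule.smul_mem _ _ (F_mem _ (selfDual_D m n) _ _)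

/-- The Chevalley generator `e_i` of `𝔤`; `e_0` is a root vector for `-θ`. -/
def e (i : ℕ) : X.G := X.toG ⟨X.eMat i, X.eMat_mem i⟩

/-- The Chevalley generator `f_i` of `𝔤`; `f_0` is a root vector for `θ`. -/
def f (i : ℕ) : X.G := X.toG ⟨X.fMat i, X.fMat_mem i⟩

/-- The coroot `h_i = [e_i, f_i]`. -/
def h (i : ℕ) : X.G := sbr (X.e i) (X.f i)

/-! ## The toroidal superalgebra of type `X` and the images of the generators -/

/-- The toroidal superalgebra `T(𝔤)`. -/
abbrev T : Type := Toroidal X.stdForm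

open Toroidal in
/-- The images of the generators of `𝔗(X)` in `T(𝔤)`. -/
def genImage : Gen X → X.T
  | .K => cen _ (cls (mon 1 0) (mon (-1) 0))
  | .al i k => (X.d i : ℂ) • tens _ (X.h i) (mon k 0) -
      (if i = 0 then cen _ (cls (mon 0 1) (mon k (-1))) else 0)
  | .x s i k =>
      if s = 1 then tens _ (X.e i) (mon k (if i = 0 then -1 else 0))
      else -tens _ (X.f i) (mon k (if i = 0 then 1 else 0))

end SuperType

end ToroidalSuper

end

noncomputable section

namespace ToroidalSuper

open scoped TensorProduct
open Superalgebra Lbl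

namespace SuperType

variable (X : SuperType)

/-! ### Brackets of the matrices `F a b` -/

/-! A homomorphism out of `LoopT X` is the same as images of the generators, of the right parities,
that satisfy the relations. Uniqueness is immediate, since a homomorphism is determined by its
values on generators (`LoopT.hom_ext`). What remains is to check the relations in `T(𝔤)` and to
prove surjectivity.

Relations. A bracket in `T(𝔤)` is a bracket in `𝔤` plus a value of the form times a class of
differentials. Each relation therefore reduces to a Chevalley or Serre relation of the extended
diagram in `𝔤`, together with one value of the form. Opposite root vectors contribute the class of
`d(s^k t^p) · s^l t^(-p)`. Its `s`-part is exact unless `k = -l` and produces `K`; its `t`-part is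
nonzero only at node `0` and is exactly the correction in the image of `α_0(k)` (`cls_mon_opposite`,
`sbr_xImg`).

The four types are treated together. Up to scalars, every Chevalley generator is a matrix `F a b`
attached to two labels `lo i`, `hi i`, and the simple root is the difference of their weights. In
type A the duals of the labels lie outside the basis, so `F` is a plain matrix unit there. One
bracket formula (`bracketFormula`) and one trace computation then give all Chevalley relations from
finite combinatorics of labels. The Serre relations at non-isotropic nodes follow from lowest weight
theory for a triple `x, y, [x, y]` in finite dimension, with `x` even or odd (`serre_of_lowest`). At
isotropic nodes they follow from `[x, x] = 0`.

Surjectivity. Let `S` be the image. For fixed `l`, the `x` in `𝔤` such that every `x ⊗ s^k t^l` lies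
in `S` modulo the centre form a subspace, `layer S l`, and these subspaces multiply like a grading.
Layer `0` is everything, because the finite Chevalley generators generate `𝔤`
(`eq_top_of_generators`). Layers `1` and `-1` are then ideals containing `h 0`, and connectedness of
the extended diagram forces such an ideal to be `𝔤` (`eq_top_of_ideal`). Perfectness of `𝔤` gives
the other layers. Hence `S` plus the centre is everything, so `S` contains all brackets; these
include every `x ⊗ a` and, since the form is nonzero, every class of differentials
(`eq_top_of_layer`). -/

theorem E_mul_E {b : Lbl} (hb : b ∈ X.basis) (a c d : Lbl) :
    X.E a b * X.E c d = if b = c then X.E a d else 0 := by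
  refine Matrix.ext fun i j => ?_
  change ∑ k : X.Idx, (if i.1 = a ∧ k.1 = b then (1 : ℂ) else 0) *
    (if k.1 = c ∧ j.1 = d then (1 : ℂ) else 0) = _
  rw [Finset.sum_eq_single ⟨b, hb⟩]
  · split_ifs with h1 h2 h3 h4 h5 <;> simp_all [E]
    all_goals rfl
  · intro k _ hk
    rw [if_neg (fun h => hk (Subtype.ext h.2)), zero_mul]
  · intro h; exact absurd (Finset.mem_univ _) h

theorem dual_eq_iff {a b : Lbl} : a.dual = b ↔ a = b.dual :=
  ⟨fun h => by rw [← h, dual_dual], fun h => by rw [h, dual_dual]⟩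

theorem dual_injective : Function.Injective Lbl.dual := fun a b h => by
  rw [← dual_dual a, h, dual_dual]

/-- The coefficient of `E_{b*,a*}` in `F a b`. -/
def kap (a b : Lbl) : ℂ := sg ((a.par + b.par) * b.par) * a.gamma * b.gamma

theorem F_eq (a b : Lbl) : X.F a b = X.E a b - kap a b • X.E b.dual a.dual := rfl

theorem F_mem_homog (a b : Lbl) : X.F a b ∈ homog X.glV (a.par + b.par) := by
  refine sub_mem (X.E_mem_homog a b) (Submodule.smul_mem _ _ ?_)
  have := X.E_mem_homog b.dual a.dual
  rwa [par_dual, par_dual, add_comm] at this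

theorem kap_dual (a b : Lbl) : kap a b * kap b.dual a.dual = 1 := by
  have ha := gamma_mul_self a
  have hb := gamma_mul_self b
  simp only [kap, gamma_dual, par_dual]
  rcases zmod_two a.par with h | h <;> rcases zmod_two b.par with h' | h' <;>
    simp [h, h', CharTwo.add_self_eq_zero] <;>
    linear_combination hb * (a.gamma * a.gamma) + ha

/-- Duality exchanges the two matrix units in `F a b`, so both matrices span the same line. This is
what allows primed labels to be traded for unprimed ones later. -/
theorem F_dual (a b : Lbl) : X.F b.dual a.dual = -(kap b.dual a.dual • X.F a b) := by
  rw [F_eq, F_eq, dual_dual, dual_dual, smul_sub, smul_smul, mul_comm, kap_dual, one_smul]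
  abel

theorem kap_smul_F_dual (a b : Lbl) : kap a b • X.F b.dual a.dual = -X.F a b := by
  rw [F_dual, smul_neg, smul_smul, kap_dual, one_smul]

theorem F_self_dual {a : Lbl} (h : a.par = 0) : X.F a a.dual = 0 := by
  have h1 : kap a a.dual = 1 := by
    simp [kap, gamma_dual, par_dual, h, gamma_mul_self]
  rw [F_eq, dual_dual, h1, one_smul, sub_self]

/-- The sign of exchanging `F a b` with `F c d`. -/
def exSign (a b c d : Lbl) : ℂ := sg ((a.par + b.par) * (c.par + d.par))

/-- The bracket formula. -/
def BracketFormula (a b c d : Lbl) : Prop :=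
  sbr (X.F a b) (X.F c d) = (if b = c then X.F a d else 0) -
    exSign a b c d • (if a = d then X.F c b else 0) -
    kap c d • ((if b = d.dual then X.F a c.dual else 0) -
      exSign a b c d • (if a = c.dual then X.F d.dual b else 0))

/-- The superbracket expands into eight products of matrix units. Each of the four `F` on the right
accounts for two of them: one agrees at sight, and the coefficient of the other is a sign identity,
`e1` to `e4`. -/
theorem bracketFormula_of_dual_mem {a b : Lbl} (ha : a ∈ X.basis) (hb : b ∈ X.basis)
    (ha' : a.dual ∈ X.basis) (hb' : b.dual ∈ X.basis) {c d : Lbl} (hc : c ∈ X.basis)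
    (hd : d ∈ X.basis) (hc' : c.dual ∈ X.basis) (hd' : d.dual ∈ X.basis) :
    X.BracketFormula a b c d := by
  rw [BracketFormula, Gl.sbr_homog _ (X.F_mem_homog a b) (X.F_mem_homog c d)]
  simp only [F_eq, sub_mul, mul_sub, smul_mul_assoc, mul_smul_comm]
  rw [X.E_mul_E hb, X.E_mul_E hb, X.E_mul_E ha', X.E_mul_E ha', X.E_mul_E hd, X.E_mul_E hd,
    X.E_mul_E hc', X.E_mul_E hc']
  simp only [dual_eq_iff, dual_dual, dual_injective.eq_iff, eq_comm (a := d), eq_comm (a := c)]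
  have hite : ∀ (P : Prop) [Decidable P] (x : X.glV),
      (if P then x else 0) = (if P then (1 : ℂ) else 0) • x := by
    intro P _ x; split_ifs <;> simp
  simp only [hite (b = c), hite (a = d), hite (b = d.dual), hite (a = c.dual)]
  -- The sign identities are false in general. They are needed only where the accompanying Kronecker
  -- delta is nonzero, and there one label can be eliminated.
  have key : ∀ (P : Prop) [Decidable P] (x y : ℂ), (P → x = y) →
      (if P then (1 : ℂ) else 0) * x = (if P then (1 : ℂ) else 0) * y := by
    intro P _ x y h; split_ifs with hP
    · rw [h hP]
    · simp
  have ga := gamma_mul_self a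
  have gb := gamma_mul_self b
  have gc := gamma_mul_self c
  have gd := gamma_mul_self d
  have hs : sg ((a.par + b.par) * (c.par + d.par)) = exSign a b c d := rfl
  rw [hs]
  have e1 := key (b = c) (kap a d) (exSign a b c d * kap a b * kap c d) (by
    rintro rfl
    simp only [kap, exSign]
    rcases zmod_two a.par with h | h <;> rcases zmod_two b.par with h' | h' <;>
      rcases zmod_two d.par with h'' | h'' <;>
      simp [h, h', h'', CharTwo.add_self_eq_zero] <;>
      linear_combination (-gb) * (a.gamma * d.gamma))
  have e2 := key (a = d) (exSign a b c d * kap c b) (kap a b * kap c d) (by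
    rintro rfl
    simp only [kap, exSign]
    rcases zmod_two a.par with h | h <;> rcases zmod_two b.par with h' | h' <;>
      rcases zmod_two c.par with h'' | h'' <;>
      simp [h, h', h'', CharTwo.add_self_eq_zero] <;>
      linear_combination (-ga) * (b.gamma * c.gamma))
  have e3 := key (b = d.dual) (kap c d * kap a c.dual) (exSign a b c d * kap a b) (by
    rintro rfl
    simp only [kap, exSign, gamma_dual, par_dual]
    rcases zmod_two a.par with h | h <;> rcases zmod_two d.par with h' | h' <;>
      rcases zmod_two c.par with h'' | h'' <;>
      simp [h, h', h'', CharTwo.add_self_eq_zero] <;>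
      linear_combination gc * (a.gamma * d.gamma))
  have e4 := key (a = c.dual) (exSign a b c d * kap c d * kap d.dual b) (kap a b) (by
    rintro rfl
    simp only [kap, exSign, gamma_dual, par_dual]
    rcases zmod_two b.par with h | h <;> rcases zmod_two d.par with h' | h' <;>
      rcases zmod_two c.par with h'' | h'' <;>
      simp [h, h', h'', CharTwo.add_self_eq_zero] <;>
      linear_combination gd * (b.gamma * c.gamma))
  linear_combination (norm := module) e1 • X.E d.dual a.dual - e2 • X.E b.dual c.dual
    - e3 • X.E c a.dual + e4 • X.E b.dual d

end SuperType
-- Bracket formula and action of diagonal elements, uniformly in the types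
namespace SuperType

variable (X : SuperType)

/-- This makes `F` collapse to `E` in type A, so that a single family of matrices serves both `𝔰𝔩`
and `𝔬𝔰𝔭`. -/
theorem dual_notMem_A {m n : ℕ} {a : Lbl} (ha : a ∈ (A m n).basis) : a.dual ∉ (A m n).basis := by
  revert ha
  cases a <;> simp [basis, Lbl.dual]

theorem selfDual_or_A : X.SelfDual ∨ ∃ m n, X = A m n := by
  cases X with
  | A m n => exact Or.inr ⟨m, n, rfl⟩
  | B m n => exact Or.inl (selfDual_B m n)
  | C n => exact Or.inl (selfDual_C n)
  | D m n => exact Or.inl (selfDual_D m n)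

theorem F_A {m n : ℕ} {a : Lbl} (ha : a ∈ (A m n).basis) (b : Lbl) :
    (A m n).F a b = (A m n).E a b := by
  rw [F_eq, E_eq_zero _ _ _ (Or.inr (dual_notMem_A ha)), smul_zero, sub_zero]

variable {X}

theorem bracketFormula {a b c d : Lbl} (ha : a ∈ X.basis) (hb : b ∈ X.basis) (hc : c ∈ X.basis)
    (hd : d ∈ X.basis) : X.BracketFormula a b c d := by
  rcases X.selfDual_or_A with h | ⟨m, n, rfl⟩
  · exact X.bracketFormula_of_dual_mem ha hb (h a ha) (h b hb) hc hd (h c hc) (h d hd)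
  · have h1 : b ≠ d.dual := fun h => dual_notMem_A hd (h ▸ hb)
    have h2 : a ≠ c.dual := fun h => dual_notMem_A hc (h ▸ ha)
    rw [BracketFormula, Gl.sbr_homog _ (F_mem_homog _ a b) (F_mem_homog _ c d), if_neg h1,
      if_neg h2, F_A ha, F_A hc, F_A ha, F_A hc, E_mul_E _ hb, E_mul_E _ hd]
    simp only [eq_comm (a := d), exSign]
    module

/-- The pairing with `⟨a, a⟩ = 1`, `⟨a, a*⟩ = -1` for `a ≠ a*`. -/
def pair (a b : Lbl) : ℂ := (if a = b then 1 else 0) - (if a = b.dual then 1 else 0)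

/-- The terms of the bracket formula involving duals fold back onto `F c d` by `kap_smul_F_dual`,
with the opposite sign; this is the origin of the negative part of `pair`. For `a = w` both parts
cancel, in accordance with `F w w = 0`. -/
theorem sbr_F_diag {a c d : Lbl} (ha : a ∈ X.basis) (hc : c ∈ X.basis) (hd : d ∈ X.basis) :
    sbr (X.F a a) (X.F c d) = (pair a c - pair a d) • X.F c d := by
  have h := bracketFormula ha ha hc hd
  have e1 : (if a = c then X.F a d else 0) = (if a = c then (1 : ℂ) else 0) • X.F c d := by
    split_ifs with h <;> simp [h]
  have e2 : (if a = d then X.F c a else 0) = (if a = d then (1 : ℂ) else 0) • X.F c d := by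
    split_ifs with h <;> simp [h]
  have e3 : kap c d • (if a = d.dual then X.F a c.dual else 0) =
      -((if a = d.dual then (1 : ℂ) else 0) • X.F c d) := by
    split_ifs with h
    · rw [h, kap_smul_F_dual, one_smul]
    · simp
  have e4 : kap c d • (if a = c.dual then X.F d.dual a else 0) =
      -((if a = c.dual then (1 : ℂ) else 0) • X.F c d) := by
    split_ifs with h
    · rw [h, kap_smul_F_dual, one_smul]
    · simp
  have hs : exSign a a c d = 1 := by simp [exSign, CharTwo.add_self_eq_zero]
  rw [h, hs, one_smul, one_smul, smul_sub, e1, e2, e3, e4, pair, pair]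
  module

theorem F_w_w : X.F w w = 0 := F_self_dual X (a := w) rfl

theorem F_dual_self (a : Lbl) : X.F a.dual a.dual = -X.F a a := by
  rw [F_dual]
  have : kap a.dual a.dual = 1 := by
    simp [kap, gamma_mul_self, CharTwo.add_self_eq_zero]
  rw [this, one_smul]

/-- The multiplicity that distinguishes long roots. -/
def mult (a b : Lbl) : ℂ := if b = a.dual then 2 else 1

/-- For `b = a*` all four terms of the bracket formula survive, which doubles the result. The parity
hypothesis is needed because `F a a*` vanishes for even `a`, while the right-hand side need not. -/
theorem sbr_F_swap {a b : Lbl} (ha : a ∈ X.basis) (hb : b ∈ X.basis)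
    (hodd : b = a.dual → a.par = 1) :
    sbr (X.F a b) (X.F b a) = mult a b • (X.F a a - sg (a.par + b.par) • X.F b b) := by
  have h := bracketFormula ha hb hb ha
  have hs : exSign a b b a = sg (a.par + b.par) := by
    rw [exSign]
    rcases zmod_two a.par with h | h <;> rcases zmod_two b.par with h' | h' <;>
      simp [h, h', CharTwo.add_self_eq_zero]
  rw [h, hs, if_pos rfl, if_pos rfl, mult]
  by_cases h1 : b = a.dual
  · have h2 : a = b.dual := by rw [h1, dual_dual]
    have hp := hodd h1
    rw [if_pos h1, if_pos h2, if_pos h1, ← h2, ← h1]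
    have hk : kap b a = -1 := by
      rw [h1]
      simp [kap, gamma_dual, par_dual, hp, gamma_mul_self, CharTwo.add_self_eq_zero]
    rw [hk]
    module
  · have h2 : a ≠ b.dual := fun h => h1 (by rw [h, dual_dual])
    rw [if_neg h1, if_neg h2, if_neg h1]
    module

theorem sbr_F_swap_act {a b c d : Lbl} (ha : a ∈ X.basis) (hb : b ∈ X.basis)
    (hodd : b = a.dual → a.par = 1) (hc : c ∈ X.basis) (hd : d ∈ X.basis) :
    sbr (sbr (X.F a b) (X.F b a)) (X.F c d) =
      (mult a b * (pair a c - pair a d - sg (a.par + b.par) * (pair b c - pair b d))) •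
        X.F c d := by
  rw [sbr_F_swap ha hb hodd, map_smul, map_sub, map_smul, LinearMap.smul_apply,
    LinearMap.sub_apply, LinearMap.smul_apply, sbr_F_diag ha hc hd, sbr_F_diag hb hc hd]
  module

/-! ### The supertrace form -/

variable (X) in
theorem str_E_mul_E {b : Lbl} (hb : b ∈ X.basis) {a : Lbl} (ha : a ∈ X.basis) (c d : Lbl) :
    Gl.str X.idxPar (X.E a b * X.E c d) = if b = c ∧ a = d then sg a.par else 0 := by
  rw [E_mul_E X hb]
  by_cases h1 : b = c
  · rw [if_pos h1]
    by_cases h2 : a = d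
    · rw [if_pos ⟨h1, h2⟩, ← h2, Gl.str_apply, Finset.sum_eq_single ⟨a, ha⟩]
      · change sg a.par * (if a = a ∧ a = a then (1 : ℂ) else 0) = _
        simp
      · intro j _ hj
        change _ * (if j.1 = a ∧ j.1 = a then (1 : ℂ) else 0) = _
        rw [if_neg (fun h => hj (Subtype.ext h.1)), mul_zero]
      · intro h; exact absurd (Finset.mem_univ _) h
    · rw [if_neg (fun h => h2 h.2), str_E X h2]
  · rw [if_neg h1, if_neg (fun h => h1 h.1), map_zero]

/-- Two matrix units have a product of nonzero supertrace only if they are transposes of each other.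
The hypotheses exclude this for all units occurring in the two factors. -/
theorem str_F_mul_F_eq_zero {a b c d : Lbl} (ha : a ∈ X.basis) (hb : b ∈ X.basis)
    (hc : c ∈ X.basis) (hd : d ∈ X.basis)
    (h1 : ¬(b = c ∧ a = d)) (h2 : ¬ (b = d.dual ∧ a = c.dual)) :
    Gl.str X.idxPar (X.F a b * X.F c d) = 0 := by
  rcases X.selfDual_or_A with h | ⟨m, n, rfl⟩
  · simp only [F_eq, sub_mul, mul_sub, smul_mul_assoc, mul_smul_comm, map_sub, map_smul]
    rw [str_E_mul_E X hb ha, str_E_mul_E X hb ha, str_E_mul_E X (h a ha) (h b hb),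
      str_E_mul_E X (h a ha) (h b hb), if_neg h1, if_neg h2, if_neg, if_neg]
    · simp
    · rw [dual_injective.eq_iff, dual_injective.eq_iff]
      tauto
    · rw [dual_eq_iff, dual_eq_iff]
      tauto
  · rw [F_A ha, F_A hc, str_E_mul_E _ hb ha, if_neg h1]

/-- Both units of `F a b` meet their transposes, with equal contributions, and for a long root the
cross terms contribute as well. The factor `2`, absent in type A, is compensated by the factors
`±1/2` in `formScale`. -/
theorem str_F_mul_F_swap (hX : X.SelfDual) {a b : Lbl} (ha : a ∈ X.basis) (hb : b ∈ X.basis)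
    (hodd : b = a.dual → a.par = 1) :
    Gl.str X.idxPar (X.F a b * X.F b a) = 2 * mult a b * sg a.par := by
  simp only [F_eq, sub_mul, mul_sub, smul_mul_assoc, mul_smul_comm, map_sub, map_smul]
  rw [str_E_mul_E X hb ha, str_E_mul_E X hb ha, str_E_mul_E X (hX a ha) (hX b hb),
    str_E_mul_E X (hX a ha) (hX b hb), mult]
  have ga := gamma_mul_self a
  have gb := gamma_mul_self b
  by_cases h1 : b = a.dual
  · have hp := hodd h1
    rw [h1] at gb ⊢
    simp [kap, gamma_dual, par_dual, dual_dual, hp, CharTwo.add_self_eq_zero]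
    linear_combination (-2 - a.gamma * a.gamma - 1) * ga
  · have h2 : a ≠ b.dual := fun h => h1 (by rw [h, dual_dual])
    have h3 : a.dual ≠ b := fun h => h1 h.symm
    simp only [h1, h2, h3, false_and, if_false, and_self, if_true, kap, par_dual]
    rcases zmod_two a.par with h | h <;> rcases zmod_two b.par with h' | h' <;>
      simp [h, h', CharTwo.add_self_eq_zero]
    all_goals first
      | linear_combination ga * (b.gamma * b.gamma) + gb
      | linear_combination - ga * (b.gamma * b.gamma) - gb

end SuperType
namespace SuperType

/-! ### Root vectors by labels -/

/-- The basis vectors `c_1, c_2, …` such that the `i`-th simple root is the difference of the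
weights of `c_i` and `c_{i+1}` (apart from `i = 0` and the last node in types `C`, `D`). -/
def chain : SuperType → ℕ → Lbl
  | A m _, k => if k ≤ m + 1 then u k else v (k - (m + 1))
  | B m n, k => if k ≤ n then v k else if k ≤ n + m then u (k - n) else w
  | C _, k => if k ≤ 1 then u k else v (k - 1)
  | D _ n, k => if k ≤ n then v k else u (k - n)

/-- The row label of `e_i`. -/
def lo (X : SuperType) (i : ℕ) : Lbl :=
  match X with
  | A m n => if i = 0 then v (n + 1) else (A m n).chain i
  | B m n => if i = 0 then v' 1 else (B m n).chain i
  | C n => if i = 0 then u' 1 else (C n).chain i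
  -- The last node leaves the chain: `δ_{m-1} + δ_m` is the difference of the weights of `u (m-1)`
  -- and `u' m`.
  | D m n => if i = 0 then v' 1 else if i = n + m then u (m - 1) else (D m n).chain i

/-- The column label of `e_i`. -/
def hi (X : SuperType) (i : ℕ) : Lbl :=
  match X with
  | A m n => (A m n).chain (i + 1)
  | B m n => (B m n).chain (i + 1)
  | C n => if i = 0 then v 1 else if i = n + 1 then v' n else (C n).chain (i + 1)
  | D m n => if i = n + m then u' m else (D m n).chain (i + 1)

/-- The coefficient of `F` in `e_i`. -/
def eCoef : SuperType → ℕ → ℂ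
  | A _ _, _ => 1
  | B _ _, i => if i = 0 then 1 / 2 else 1
  | C n, i => if i = n + 1 then 1 / 2 else 1
  | D _ _, i => if i = 0 then 1 / 2 else 1

/-- The coefficient of `F` in `f_i`. -/
def fCoef : SuperType → ℕ → ℂ
  | A _ _, i => if i = 0 then -1 else 1
  | B m n, i => if i = 0 then 1 / 2 else if i = n + m then 2 else 1
  | C n, i => if i = n + 1 then 1 / 2 else 1
  | D _ _, i => if i = 0 then 1 / 2 else 1

variable {X : SuperType}

theorem u_mem_pairedBasis {m n i : ℕ} (h1 : 1 ≤ i) (h2 : i ≤ m) : u i ∈ pairedBasis m n := by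
  simp [pairedBasis, h1, h2]
theorem v_mem_pairedBasis {m n i : ℕ} (h1 : 1 ≤ i) (h2 : i ≤ n) : v i ∈ pairedBasis m n := by
  simp [pairedBasis, h1, h2]

theorem lo_mem (hX : X.Valid) {i : ℕ} (hi : i ≤ X.rank) : X.lo i ∈ X.basis := by
  cases X <;> simp only [Valid, rank] at hX hi <;> simp only [lo, chain] <;> split_ifs <;>
    simp [basis, pairedBasis] <;> omega

theorem hi_mem (hX : X.Valid) {i : ℕ} (hi : i ≤ X.rank) : X.hi i ∈ X.basis := by
  cases X <;> simp only [Valid, rank] at hX hi <;> simp only [SuperType.hi, chain] <;>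
    split_ifs <;> simp [basis, pairedBasis] <;> omega

theorem E_eq_F_A {m n : ℕ} (a : ℕ) (b : Lbl) :
    (A m n).E (u a) b = (A m n).F (u a) b ∧ (A m n).E (v a) b = (A m n).F (v a) b := by
  constructor <;> rw [F_eq, E_eq_zero (A m n) b.dual _ (Or.inr (by simp [basis, Lbl.dual])),
    smul_zero, sub_zero]

/-- From here on, the differences between the types are confined to labels, scalar coefficients and
the sign `eta`. -/
theorem eMat_eq (hX : X.Valid) {i : ℕ} (hi : i ≤ X.rank) :
    X.eMat i = X.eCoef i • X.F (X.lo i) (X.hi i) := by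
  cases X <;> simp only [Valid, rank] at hX hi <;>
    simp only [eMat, lo, SuperType.hi, chain, eCoef, (E_eq_F_A _ _).1, (E_eq_F_A _ _).2]
  all_goals split_ifs <;> (try omega) <;> simp_all
  all_goals (congr 2; omega)

theorem fMat_eq (hX : X.Valid) {i : ℕ} (hi : i ≤ X.rank) :
    X.fMat i = X.fCoef i • X.F (X.hi i) (X.lo i) := by
  cases X <;> simp only [Valid, rank] at hX hi <;>
    simp only [fMat, lo, SuperType.hi, chain, fCoef, (E_eq_F_A _ _).1, (E_eq_F_A _ _).2]
  all_goals split_ifs <;> (try omega) <;> simp_all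
  all_goals (congr 2; omega)

end SuperType
namespace SuperType

variable {X : SuperType}

/-! ### Weights -/

/-- The weights of the basis vectors, if `u i`, `v i` have weights `x i`, `y i`. -/
def lblWeight (x y : ℕ → Weight) : Lbl → Weight
  | u i => x i
  | u' i => -x i
  | w => 0
  | v i => y i
  | v' i => -y i

/-- The weight of a basis vector. -/
def wt : SuperType → Lbl → Weight
  | A _ _ => lblWeight ε δ
  | B _ _ => lblWeight δ ε
  | C _ => lblWeight ε δ
  | D _ _ => lblWeight δ ε

/-- The sign of the norm of the weight of a basis vector. -/
def eta : SuperType → Lbl → ℂ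
  | A _ _, a => sg a.par
  | B _ _, a => -sg a.par
  | C _, a => sg a.par
  | D _ _, a => -sg a.par

theorem simpleRoot_eq (hX : X.Valid) {i : ℕ} (hi : i ≤ X.rank) :
    X.simpleRoot i = X.wt (X.lo i) - X.wt (X.hi i) := by
  cases X <;> simp only [Valid, rank] at hX hi <;>
    simp only [simpleRoot, lo, SuperType.hi, chain, wt]
  all_goals split_ifs <;> (try omega) <;> simp_all [lblWeight]
  all_goals first | ring1 | (congr 1; omega)

theorem weightForm_sub_left (N : ℕ) (x y z : Weight) :
    weightForm N (x - y) z = weightForm N x z - weightForm N y z := by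
  simp only [weightForm, ← Finset.sum_sub_distrib, Pi.sub_apply]
  exact Finset.sum_congr rfl fun i _ => by ring

theorem weightForm_comm (N : ℕ) (x y : Weight) : weightForm N x y = weightForm N y x :=
  Finset.sum_congr rfl fun i _ => by ring

theorem weightForm_neg_left (N : ℕ) (x y : Weight) :
    weightForm N (-x) y = -weightForm N x y := by
  simp only [weightForm, ← Finset.sum_neg_distrib, Pi.neg_apply]
  exact Finset.sum_congr rfl fun i _ => by ring

theorem weightForm_neg_right (N : ℕ) (x y : Weight) :
    weightForm N x (-y) = -weightForm N x y := by
  rw [weightForm_comm, weightForm_neg_left, weightForm_comm]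

theorem weightForm_zero_left (N : ℕ) (x : Weight) : weightForm N 0 x = 0 := by
  simp [weightForm]

theorem weightForm_zero_right (N : ℕ) (x : Weight) : weightForm N x 0 = 0 := by
  simp [weightForm]

theorem weightForm_ε_ε {N i : ℕ} (hi : i ≤ N) (j : ℕ) :
    weightForm N (ε i) (ε j) = if i = j then 1 else 0 := by
  rw [weightForm, Finset.sum_eq_single i]
  · simp [ε, Pi.single_apply]
  · intro k _ hk; simp [ε, Pi.single_apply, hk]
  · intro h; simp at h; omega

theorem weightForm_δ_δ {N i : ℕ} (hi : i ≤ N) (j : ℕ) :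
    weightForm N (δ i) (δ j) = if i = j then -1 else 0 := by
  rw [weightForm, Finset.sum_eq_single i]
  · simp only [δ, Pi.single_apply]
    split_ifs <;> simp_all
  · intro k _ hk; simp [δ, Pi.single_apply, hk]
  · intro h; simp at h; omega

theorem weightForm_ε_δ (N i j : ℕ) : weightForm N (ε i) (δ j) = 0 := by
  simp [weightForm, ε, δ, Pi.single_apply]

theorem weightForm_δ_ε (N i j : ℕ) : weightForm N (δ i) (ε j) = 0 := by
  simp [weightForm, ε, δ, Pi.single_apply]

/-- Membership of `a` in the basis bounds its index by the rank, so the truncated sum defining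
`weightForm` sees it. The value of `eta` at `w` is irrelevant because `pair w b = 0`. -/
theorem weightForm_wt {a : Lbl} (ha : a ∈ X.basis) (b : Lbl) :
    ((weightForm X.rank (X.wt a) (X.wt b) : ℤ) : ℂ) = X.eta a * pair a b := by
  cases X <;> cases a <;> simp [basis, pairedBasis] at ha <;> cases b <;>
    simp only [wt, lblWeight, weightForm_neg_left, weightForm_neg_right, weightForm_ε_δ,
      weightForm_δ_ε, weightForm_zero_left, weightForm_zero_right, rank, eta, pair, Lbl.dual] <;>
    (try rw [weightForm_ε_ε (by omega)]) <;> (try rw [weightForm_δ_δ (by omega)]) <;>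
    simp [Lbl.par]

theorem rootForm_eq (hX : X.Valid) {i j : ℕ} (hi : i ≤ X.rank) (hj : j ≤ X.rank) :
    (X.rootForm i j : ℂ) =
      X.eta (X.lo i) * (pair (X.lo i) (X.lo j) - pair (X.lo i) (X.hi j)) -
      X.eta (X.hi i) * (pair (X.hi i) (X.lo j) - pair (X.hi i) (X.hi j)) := by
  have hl := lo_mem hX hi
  have hh := hi_mem hX hi
  rw [rootForm, simpleRoot_eq hX hi, simpleRoot_eq hX hj, weightForm_sub_left,
    weightForm_comm _ _ (_ - _), weightForm_comm _ _ (_ - _), weightForm_sub_left,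
    weightForm_sub_left]
  simp only [weightForm_comm _ _ (X.wt (X.lo i)), weightForm_comm _ _ (X.wt (X.hi i))]
  push_cast
  rw [weightForm_wt hl, weightForm_wt hl, weightForm_wt hh, weightForm_wt hh]
  ring

end SuperType
namespace SuperType

variable {X : SuperType}

/-! ### Combinatorics of the labels -/

theorem lo_ne_hi (hX : X.Valid) {i : ℕ} (hi : i ≤ X.rank) : X.lo i ≠ X.hi i := by
  cases X <;> simp only [Valid, rank] at hX hi <;> simp only [lo, SuperType.hi, chain] <;>
    split_ifs <;> simp <;> omega

theorem lo_ne_w (hX : X.Valid) {i : ℕ} (hi : i ≤ X.rank) : X.lo i ≠ w := by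
  cases X <;> simp only [Valid, rank] at hX hi <;> simp only [lo, chain] <;>
    split_ifs <;> simp <;> omega

theorem odd_of_hi_eq_dual (hX : X.Valid) {i : ℕ} (hi : i ≤ X.rank) (h : X.hi i = (X.lo i).dual) :
    (X.lo i).par = 1 := by
  revert h
  cases X <;> simp only [Valid, rank] at hX hi <;> simp only [lo, SuperType.hi, chain] <;>
    split_ifs <;> simp [Lbl.dual, Lbl.par] <;> omega

theorem rootParity_eq (hX : X.Valid) {i : ℕ} (hi : i ≤ X.rank) :
    X.rootParity i = (X.lo i).par + (X.hi i).par := by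
  cases X <;> simp only [Valid, rank] at hX hi <;>
    simp only [rootParity, lo, SuperType.hi, chain] <;>
    split_ifs <;> simp [Lbl.par, CharTwo.add_self_eq_zero] <;> omega

/-- The link between superbrackets and the indefinite form on weights: the sign in `[F a b, F b a]`
is the quotient of the norm signs of the two labels. -/
theorem sg_mul_eta (a b : Lbl) : sg (a.par + b.par) * X.eta b = X.eta a := by
  cases X <;> rcases zmod_two a.par with h | h <;> rcases zmod_two b.par with h' | h' <;>
    simp [eta, h, h', CharTwo.add_self_eq_zero]

theorem eta_ne_zero (a : Lbl) : X.eta a ≠ 0 := by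
  cases X <;> rcases zmod_two a.par with h | h <;> simp [eta, h]

/-- The one place where the chosen normalization of `e_i` and `f_i` is verified. It yields both the
Cartan matrix as eigenvalues of the coroots and `(e_i | f_i) = 1 / d_i`. -/
theorem coef_mul_eta (hX : X.Valid) {i : ℕ} (hi : i ≤ X.rank) :
    X.eCoef i * X.fCoef i * mult (X.lo i) (X.hi i) * X.eta (X.lo i) = 1 / (X.d i : ℂ) := by
  cases X <;> simp only [Valid, rank] at hX hi <;>
    simp only [eCoef, fCoef, mult, eta, d, lo, SuperType.hi, chain] <;>
    split_ifs <;> (try omega) <;> simp [Lbl.dual, Lbl.par] at * <;> norm_num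
  all_goals omega

/-- In terms of roots, `α_i + α_j ≠ 0`, whence `(e_i | e_j) = (f_i | f_j) = 0`. For the excluded
`A(0,0)` this fails with `i = 0`, `j = 1`. -/
theorem not_opposite (hX : X.Valid) {i j : ℕ} (hi : i ≤ X.rank) (hj : j ≤ X.rank) :
    ¬(X.hi i = X.lo j ∧ X.lo i = X.hi j) ∧
    ¬(X.hi i = (X.hi j).dual ∧ X.lo i = (X.lo j).dual) := by
  cases X <;> simp only [Valid, rank] at hX hi hj <;> simp only [lo, SuperType.hi, chain] <;>
    split_ifs <;> simp [Lbl.dual] <;> omega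

theorem not_same (hX : X.Valid) {i j : ℕ} (hi : i ≤ X.rank) (hj : j ≤ X.rank) (hij : i ≠ j) :
    ¬(X.hi i = X.hi j ∧ X.lo i = X.lo j) ∧
    ¬(X.hi i = (X.lo j).dual ∧ X.lo i = (X.hi j).dual) := by
  cases X <;> simp only [Valid, rank] at hX hi hj <;> simp only [lo, SuperType.hi, chain] <;>
    split_ifs <;> simp [Lbl.dual] <;> omega

/-- The reason for `[e_i, f_j] = 0`. Shared ends do occur, at the first two nodes of type C and the
last two of type D; there the remaining labels are dual and even, and the matrix `F` they define is
zero. -/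
theorem difference_not_root (hX : X.Valid) {i j : ℕ} (hi : i ≤ X.rank) (hj : j ≤ X.rank)
    (hij : i ≠ j) :
    (X.hi i = X.hi j → X.lo i = (X.lo j).dual ∧ (X.lo j).par = 0) ∧
    (X.lo i = X.lo j → X.hi i = (X.hi j).dual ∧ (X.hi j).par = 0) ∧
    X.hi i ≠ (X.lo j).dual ∧ X.lo i ≠ (X.hi j).dual := by
  cases X <;> simp only [Valid, rank] at hX hi hj <;> simp only [lo, SuperType.hi, chain] <;>
    split_ifs <;> simp [Lbl.dual, Lbl.par] <;> omega

end SuperType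
-- Norms of simple roots and connectedness of the Dynkin diagram
namespace SuperType

variable {X : SuperType}

theorem d_ne_zero (hX : X.Valid) {i : ℕ} (hi : i ≤ X.rank) : (X.d i : ℂ) ≠ 0 := by
  intro h
  rw [Rat.cast_eq_zero] at h
  revert h
  cases X <;> simp only [d] <;> split_ifs <;> norm_num

/-- The factors `1/2`, `2`, `1` belong to short roots (those ending at `w`), long roots and the
rest. The alternative `hi i = w` admits the odd non-isotropic root of `B(0,n)`. -/
theorem d_of_even (hX : X.Valid) {i : ℕ} (hi : i ≤ X.rank)
    (h : (X.lo i).par = (X.hi i).par ∨ X.hi i = w) :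
    (X.d i : ℂ) = X.eta (X.lo i) *
      (if X.hi i = w then 1 / 2 else if X.hi i = (X.lo i).dual then 2 else 1) := by
  revert h
  cases X <;> simp only [Valid, rank] at hX hi <;>
    simp only [eta, d, lo, SuperType.hi, chain] <;>
    split_ifs <;> (try omega) <;> simp [Lbl.dual, Lbl.par] at *
  all_goals first | omega | norm_num

theorem d_of_odd (hX : X.Valid) {i : ℕ} (hi : i ≤ X.rank) (h : (X.lo i).par ≠ (X.hi i).par)
    (hw : X.hi i ≠ w) : (X.d i : ℂ) = 1 := by
  revert h hw
  cases X <;> simp only [Valid, rank] at hX hi <;>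
    simp only [d, lo, SuperType.hi, chain] <;>
    split_ifs <;> (try omega) <;> simp [Lbl.par] at *

theorem pair_self {a : Lbl} (h : a ≠ w) : pair a a = 1 := by
  rw [pair, if_pos rfl, if_neg, sub_zero]
  cases a <;> simp_all [Lbl.dual]

theorem pair_w_right (a : Lbl) : pair a w = 0 := sub_self _

theorem pair_comm (a b : Lbl) : pair a b = pair b a := by
  have h : a = b.dual ↔ b = a.dual := by rw [← dual_eq_iff]; exact eq_comm
  simp only [pair, h, eq_comm (a := a) (b := b)]

theorem pair_of_par_ne {a b : Lbl} (h : a.par ≠ b.par) : pair a b = 0 := by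
  rw [pair, if_neg (fun e => h (by rw [e])), if_neg (fun e => h (by rw [e, par_dual])), sub_self]

theorem pair_eq_of_ne {a b : Lbl} (h : a ≠ b) : pair a b = if a = b.dual then -1 else 0 := by
  rw [pair, if_neg h, zero_sub]
  split_ifs <;> simp

theorem pair_eq_of_ne_dual {a b : Lbl} (h : a ≠ b.dual) : pair a b = if a = b then 1 else 0 := by
  rw [pair, if_neg h, sub_zero]

/-- For an odd root the norms of its two end labels cancel, unless one end is `w`, whose weight is
zero. In all other cases the norm is `2 d_i`. -/
theorem rootForm_self (hX : X.Valid) {i : ℕ} (hi : i ≤ X.rank) :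
    (X.rootForm i i : ℂ) =
      if (X.lo i).par ≠ (X.hi i).par ∧ X.hi i ≠ w then 0 else 2 * (X.d i : ℂ) := by
  have h0 := pair_self (lo_ne_w hX hi)
  rw [rootForm_eq hX hi hi, h0, pair_comm (X.hi i)]
  by_cases hw : X.hi i = w
  · rw [d_of_even hX hi (Or.inr hw)]
    simp [hw, pair_w_right]
    ring
  · rw [pair_self hw, ← sg_mul_eta (X.lo i) (X.hi i)]
    by_cases hp : (X.lo i).par = (X.hi i).par
    · rw [if_neg (fun h => h.1 hp), d_of_even hX hi (Or.inl hp), pair_eq_of_ne (lo_ne_hi hX hi), if_neg hw]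
      have : X.lo i = (X.hi i).dual ↔ X.hi i = (X.lo i).dual := by
        rw [← dual_eq_iff]; exact eq_comm
      simp only [this, hp, CharTwo.add_self_eq_zero, sg_zero]
      have he : X.eta (X.hi i) = X.eta (X.lo i) := by
        rw [← sg_mul_eta (X.lo i) (X.hi i), hp, CharTwo.add_self_eq_zero, sg_zero, one_mul]
      rw [one_mul, he]
      split_ifs <;> ring
    · rw [pair_of_par_ne hp, if_pos ⟨hp, hw⟩]
      have : (X.lo i).par + (X.hi i).par = 1 := by
        revert hp
        generalize (X.lo i).par = p
        generalize (X.hi i).par = q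
        revert p q
        decide
      rw [this, sg_one]
      ring

theorem odd_of_isotropic (hX : X.Valid) {i : ℕ} (hi : i ≤ X.rank) (h : X.rootForm i i = 0) :
    (X.lo i).par ≠ (X.hi i).par ∧ X.hi i ≠ w := by
  have := rootForm_self hX hi
  rw [h] at this
  by_contra hc
  rw [if_neg hc] at this
  exact d_ne_zero hX hi (by simpa using this.symm)

theorem d_of_isotropic (hX : X.Valid) {i : ℕ} (hi : i ≤ X.rank) (h : X.rootForm i i = 0) :
    (X.d i : ℂ) = 1 :=
  d_of_odd hX hi (odd_of_isotropic hX hi h).1 (odd_of_isotropic hX hi h).2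

theorem rootForm_self_of_ne (hX : X.Valid) {i : ℕ} (hi : i ≤ X.rank) (h : X.rootForm i i ≠ 0) :
    (X.rootForm i i : ℂ) = 2 * (X.d i : ℂ) := by
  rw [rootForm_self hX hi]
  refine if_neg fun hc => h ?_
  have := rootForm_self hX hi
  rw [if_pos hc] at this
  exact_mod_cast this

theorem rootForm_comm (i j : ℕ) : X.rootForm i j = X.rootForm j i := by
  rw [rootForm, weightForm_comm, rootForm]

/-- The sum of an isotropic simple root and an orthogonal one is not a root. -/
theorem sum_not_root (hX : X.Valid) {i j : ℕ} (hi : i ≤ X.rank) (hj : j ≤ X.rank)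
    (h : X.rootForm i i = 0) (h' : X.rootForm i j = 0) :
    X.hi i ≠ X.lo j ∧ X.lo i ≠ X.hi j ∧ X.hi i ≠ (X.hi j).dual ∧ X.lo i ≠ (X.lo j).dual := by
  obtain ⟨hp, hw⟩ := odd_of_isotropic hX hi h
  have hlw := lo_ne_w hX hi
  obtain ⟨o1, o2⟩ := not_opposite hX hi hj
  have hne := lo_ne_hi hX hj
  have hform := rootForm_eq hX hi hj
  have hodd := odd_of_hi_eq_dual hX hj
  have heta : X.eta (X.hi i) = -X.eta (X.lo i) := by
    have : (X.lo i).par + (X.hi i).par = 1 := by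
      revert hp
      generalize (X.lo i).par = p
      generalize (X.hi i).par = q
      revert p q
      decide
    rw [← sg_mul_eta (X.lo i) (X.hi i), this, sg_one]
    ring
  have hpair := pair_of_par_ne hp
  have hpair' := pair_of_par_ne (Ne.symm hp)
  -- Since the two ends of an isotropic root have opposite norm signs, orthogonality becomes this
  -- vanishing sum of four pairings. Under each forbidden coincidence one summand is `±1`, and all
  -- others are zero or have the same sign.
  have hz : pair (X.lo i) (X.lo j) - pair (X.lo i) (X.hi j) +
      (pair (X.hi i) (X.lo j) - pair (X.hi i) (X.hi j)) = 0 := by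
    rw [h', heta] at hform
    refine (mul_eq_zero.1 ?_).resolve_left (eta_ne_zero (X := X) (X.lo i))
    rw [Rat.cast_zero] at hform
    linear_combination -hform
  have hlo1 := pair_self hlw
  have hhi1 := pair_self hw
  refine ⟨fun e => ?_, fun e => ?_, fun e => ?_, fun e => ?_⟩
  · rw [← e] at hz hne
    rw [hpair, hhi1, pair_eq_of_ne hne, pair_eq_of_ne (fun e' => o1 ⟨e, e'⟩)] at hz
    split_ifs at hz <;> norm_num at hz
  · rw [← e] at hz hne
    rw [hpair', hlo1, pair_eq_of_ne (Ne.symm hne), pair_eq_of_ne (fun e' => o1 ⟨e', e⟩)] at hz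
    split_ifs at hz <;> norm_num at hz
  · have hd : pair (X.hi i) (X.hi j) = -1 := by
      rw [pair_eq_of_ne (fun e' => hw ?_), if_pos e]
      generalize X.hi i = x at e e'
      rw [← e'] at e
      cases x <;> simp [Lbl.dual] at e ⊢
    have h1 : pair (X.lo i) (X.hi j) = 0 := by
      rw [pair_of_par_ne]; rw [e, par_dual] at hp; exact hp
    rw [hd, h1, pair_eq_of_ne_dual (fun e' => o2 ⟨e, e'⟩),
      pair_eq_of_ne_dual (fun e' => hne (dual_injective (e' ▸ e).symm).symm)] at hz
    split_ifs at hz <;> norm_num at hz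
  · have hd : pair (X.lo i) (X.lo j) = -1 := by
      rw [pair_eq_of_ne (fun e' => hlw ?_), if_pos e]
      generalize X.lo i = x at e e'
      rw [← e'] at e
      cases x <;> simp [Lbl.dual] at e ⊢
    have h1 : pair (X.hi i) (X.lo j) = 0 := by
      rw [pair_of_par_ne]; rw [e, par_dual] at hp; exact hp.symm
    rw [hd, h1, pair_eq_of_ne_dual (fun e' => o2 ⟨e', e⟩),
      pair_eq_of_ne_dual (fun e' => hne (dual_injective (e' ▸ e)).symm)] at hz
    split_ifs at hz <;> norm_num at hz

/-- The shared label contributes its norm. The other pairings vanish or reinforce it, so nothing can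
cancel. -/
theorem rootForm_ne_zero_of_hi_eq_lo (hX : X.Valid) {i j : ℕ} (hi : i ≤ X.rank) (hj : j ≤ X.rank)
    (hij : i ≠ j) (h : X.hi i = X.lo j) : X.rootForm i j ≠ 0 := by
  intro h0
  have hform := rootForm_eq hX hi hj
  have hw : X.hi i ≠ w := h ▸ lo_ne_w hX hj
  have hne := lo_ne_hi hX hj
  rw [← h] at hne
  have hne' := lo_ne_hi hX hi
  have hs := sg_mul_eta (X := X) (X.lo i) (X.hi i)
  have hpar : (X.lo i).par ≠ (X.hi i).par → pair (X.lo i) (X.hi i) = 0 := pair_of_par_ne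
  rw [h0, ← h, pair_self hw, ← hs, Rat.cast_zero] at hform
  have hz : sg ((X.lo i).par + (X.hi i).par) * (pair (X.lo i) (X.hi i) - pair (X.lo i) (X.hi j)) -
      (1 - pair (X.hi i) (X.hi j)) = 0 := by
    refine (mul_eq_zero.1 ?_).resolve_left (eta_ne_zero (X := X) (X.hi i))
    linear_combination -hform
  rw [pair_eq_of_ne (fun e => (not_opposite hX hi hj).1 ⟨h, e⟩),
    if_neg (difference_not_root hX hi hj hij).2.2.2, pair_eq_of_ne hne] at hz
  by_cases hp : (X.lo i).par = (X.hi i).par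
  · rw [hp, CharTwo.add_self_eq_zero, sg_zero, pair_eq_of_ne hne'] at hz
    split_ifs at hz <;> norm_num at hz
  · rw [hpar hp] at hz
    split_ifs at hz <;> norm_num at hz

/-- The Dynkin diagram is connected. -/
theorem exists_adjacent (hX : X.Valid) {j : ℕ} (h1 : 1 ≤ j) (hj : j ≤ X.rank) :
    ∃ i < j, X.rootForm i j ≠ 0 := by
  -- In type C the roots `α_0` and `α_1` end at the same label instead of following each other;
  -- their product is `-2`.
  by_cases hC : ∃ n, X = C n ∧ j = 1
  · obtain ⟨n, rfl, rfl⟩ := hC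
    refine ⟨0, by omega, fun h => ?_⟩
    have h' := rootForm_eq hX (i := 0) (Nat.zero_le _) hj
    simp only [Valid] at hX
    have hn : n ≠ 0 := by omega
    rw [h] at h'
    simp [lo, SuperType.hi, chain, eta, pair, Lbl.dual, Lbl.par, hn] at h'
    norm_num at h'
  -- -
  · suffices h : ∃ i < j, X.hi i = X.lo j by
      obtain ⟨i, hi, h⟩ := h
      exact ⟨i, hi, rootForm_ne_zero_of_hi_eq_lo hX (by omega) hj (by omega) h⟩
    by_cases hD : ∃ m n, X = D m n ∧ j = n + m
    · obtain ⟨m, n, rfl, rfl⟩ := hD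
      simp only [Valid] at hX
      refine ⟨n + m - 2, by omega, ?_⟩
      simp only [lo, SuperType.hi, chain]
      split_ifs <;> (try simp) <;> omega
    · refine ⟨j - 1, by omega, ?_⟩
      cases X <;> simp only [Valid, rank] at hX hj <;> simp only [lo, SuperType.hi, chain] <;>
        split_ifs <;> (try simp at *) <;> omega

end SuperType
namespace SuperType

variable {X : SuperType}

/-! ### The Chevalley relations -/

/-- The coroot acts on a vector of weight `β` by `(α_i | β) / d_i`. The sign of the superbracket is
absorbed by `sg_mul_eta`, and the scalar is `coef_mul_eta`. -/
theorem sbr_coroot_F (hX : X.Valid) {i : ℕ} (hi : i ≤ X.rank) {c d : Lbl} (hc : c ∈ X.basis)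
    (hd : d ∈ X.basis) :
    sbr (sbr (X.eMat i) (X.fMat i)) (X.F c d) =
      ((X.eta (X.lo i) * (pair (X.lo i) c - pair (X.lo i) d) -
        X.eta (X.hi i) * (pair (X.hi i) c - pair (X.hi i) d)) / (X.d i : ℂ)) • X.F c d := by
  have h1 := coef_mul_eta hX hi
  have h2 := sg_mul_eta (X := X) (X.hi i) (X.lo i)
  rw [add_comm] at h2
  rw [eMat_eq hX hi, fMat_eq hX hi]
  simp only [map_smul, LinearMap.smul_apply]
  rw [sbr_F_swap_act (lo_mem hX hi) (hi_mem hX hi) (odd_of_hi_eq_dual hX hi) hc hd, ← h2,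
    div_eq_mul_one_div, ← h1, smul_smul, smul_smul]
  have h3 : X.eta (X.lo i) * X.eta (X.lo i) = 1 := by
    cases X <;> simp [eta, sg_mul_self]
  congr 1
  linear_combination (-(X.eCoef i * X.fCoef i * mult (X.lo i) (X.hi i) *
    (pair (X.lo i) c - pair (X.lo i) d - sg ((X.lo i).par + (X.hi i).par) *
      (pair (X.hi i) c - pair (X.hi i) d)))) * h3

theorem toG_sbr_mk {M N P : X.glV} (hM : M ∈ X.matAlg) (hN : N ∈ X.matAlg)
    (hP : P ∈ X.matAlg) (h : sbr M N = P) :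
    sbr (X.toG ⟨M, hM⟩) (X.toG ⟨N, hN⟩) = X.toG ⟨P, hP⟩ := by
  rw [toG_sbr]
  exact congrArg X.toG (Subtype.ext h)

theorem sbr_eq_zero_of_mat {M N : X.glV} (hM : M ∈ X.matAlg) (hN : N ∈ X.matAlg)
    (h : sbr M N = 0) : sbr (X.toG ⟨M, hM⟩) (X.toG ⟨N, hN⟩) = 0 :=
  (toG_sbr_mk hM hN (zero_mem _) h).trans (map_zero X.toG)

theorem sbr_h_e (hX : X.Valid) {i j : ℕ} (hi : i ≤ X.rank) (hj : j ≤ X.rank) :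
    sbr (X.h i) (X.e j) = (X.cartan i j : ℂ) • X.e j := by
  rw [h, e, f, toG_sbr, e, toG_sbr, ← map_smul]
  refine congrArg X.toG (Subtype.ext ?_)
  change sbr (sbr (X.eMat i) (X.fMat i)) (X.eMat j) = (X.cartan i j : ℂ) • X.eMat j
  rw [eMat_eq hX hj, map_smul, sbr_coroot_F hX hi (lo_mem hX hj) (hi_mem hX hj), cartan,
    Rat.cast_div, rootForm_eq hX hi hj, smul_comm]

theorem sbr_h_f (hX : X.Valid) {i j : ℕ} (hi : i ≤ X.rank) (hj : j ≤ X.rank) :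
    sbr (X.h i) (X.f j) = -(X.cartan i j : ℂ) • X.f j := by
  rw [h, e, f, toG_sbr, f, toG_sbr, ← map_smul]
  refine congrArg X.toG (Subtype.ext ?_)
  change sbr (sbr (X.eMat i) (X.fMat i)) (X.fMat j) = -(X.cartan i j : ℂ) • X.fMat j
  rw [fMat_eq hX hj, map_smul, sbr_coroot_F hX hi (hi_mem hX hj) (lo_mem hX hj), cartan,
    Rat.cast_div, rootForm_eq hX hi hj, smul_comm]
  congr 2
  ring

theorem sbr_F_F_eq_zero {a b c d : Lbl} (ha : a ∈ X.basis) (hb : b ∈ X.basis) (hc : c ∈ X.basis)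
    (hd : d ∈ X.basis) (h1 : b = c → X.F a d = 0) (h2 : a = d → X.F c b = 0) (h3 : b ≠ d.dual)
    (h4 : a ≠ c.dual) : sbr (X.F a b) (X.F c d) = 0 := by
  rw [bracketFormula ha hb hc hd, if_neg h3, if_neg h4]
  have e1 : (if b = c then X.F a d else 0) = 0 := by
    split_ifs with h
    exacts [h1 h, rfl]
  have e2 : (if a = d then X.F c b else 0) = 0 := by
    split_ifs with h
    exacts [h2 h, rfl]
  rw [e1, e2]
  simp

/-- Of the four terms of the bracket formula, two are excluded by the labels. The other two can
survive only where `difference_not_root` makes them `F a a*` with `a` even, which is zero. -/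
theorem sbr_e_f (hX : X.Valid) {i j : ℕ} (hi : i ≤ X.rank) (hj : j ≤ X.rank) (hij : i ≠ j) :
    sbr (X.e i) (X.f j) = 0 := by
  refine sbr_eq_zero_of_mat _ _ ?_
  obtain ⟨h1, h2, h3, h4⟩ := difference_not_root hX hi hj hij
  rw [eMat_eq hX hi, fMat_eq hX hj, map_smul, map_smul, LinearMap.smul_apply,
    sbr_F_F_eq_zero (lo_mem hX hi) (hi_mem hX hi) (hi_mem hX hj) (lo_mem hX hj) _ _ h3 h4,
    smul_zero, smul_zero]
  · intro h
    obtain ⟨h, hp⟩ := h1 h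
    have := F_self_dual X (a := (X.lo j).dual) (by rw [par_dual, hp])
    rwa [dual_dual, ← h] at this
  · intro h
    obtain ⟨h, hp⟩ := h2 h
    rw [h]
    exact F_self_dual X hp

theorem ne_dual_self {a : Lbl} (h : a ≠ w) : a ≠ a.dual := by
  cases a <;> simp [Lbl.dual] at h ⊢

theorem sbr_e_self (hX : X.Valid) {i : ℕ} (hi : i ≤ X.rank) (h : X.rootForm i i = 0) :
    sbr (X.e i) (X.e i) = 0 := by
  have hne := lo_ne_hi hX hi
  have hl := lo_mem hX hi
  have hh := hi_mem hX hi
  refine sbr_eq_zero_of_mat _ _ ?_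
  rw [eMat_eq hX hi, map_smul, map_smul, LinearMap.smul_apply,
    sbr_F_F_eq_zero hl hh hl hh (fun h => absurd h.symm hne) (fun h => absurd h hne)
      (ne_dual_self (odd_of_isotropic hX hi h).2) (ne_dual_self (lo_ne_w hX hi)),
    smul_zero, smul_zero]

theorem sbr_f_self (hX : X.Valid) {i : ℕ} (hi : i ≤ X.rank) (h : X.rootForm i i = 0) :
    sbr (X.f i) (X.f i) = 0 := by
  have hne := lo_ne_hi hX hi
  have hl := lo_mem hX hi
  have hh := hi_mem hX hi
  refine sbr_eq_zero_of_mat _ _ ?_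
  rw [fMat_eq hX hi, map_smul, map_smul, LinearMap.smul_apply,
    sbr_F_F_eq_zero hh hl hh hl (fun h => absurd h hne) (fun h => absurd h.symm hne)
      (ne_dual_self (lo_ne_w hX hi)) (ne_dual_self (odd_of_isotropic hX hi h).2),
    smul_zero, smul_zero]

theorem sbr_e_e_of_orth (hX : X.Valid) {i j : ℕ} (hi : i ≤ X.rank) (hj : j ≤ X.rank)
    (h : X.rootForm i i = 0) (h' : X.rootForm i j = 0) : sbr (X.e i) (X.e j) = 0 := by
  obtain ⟨h1, h2, h3, h4⟩ := sum_not_root hX hi hj h h'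
  refine sbr_eq_zero_of_mat _ _ ?_
  rw [eMat_eq hX hi, eMat_eq hX hj, map_smul, map_smul, LinearMap.smul_apply,
    sbr_F_F_eq_zero (lo_mem hX hi) (hi_mem hX hi) (lo_mem hX hj) (hi_mem hX hj)
      (fun h => absurd h h1) (fun h => absurd h h2) h3 h4, smul_zero, smul_zero]

theorem sbr_f_f_of_orth (hX : X.Valid) {i j : ℕ} (hi : i ≤ X.rank) (hj : j ≤ X.rank)
    (h : X.rootForm i i = 0) (h' : X.rootForm i j = 0) : sbr (X.f i) (X.f j) = 0 := by
  obtain ⟨h1, h2, h3, h4⟩ := sum_not_root hX hi hj h h'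
  refine sbr_eq_zero_of_mat _ _ ?_
  rw [fMat_eq hX hi, fMat_eq hX hj, map_smul, map_smul, LinearMap.smul_apply,
    sbr_F_F_eq_zero (hi_mem hX hi) (lo_mem hX hi) (hi_mem hX hj) (lo_mem hX hj)
      (fun h => absurd h h2) (fun h => absurd h h1) h4 h3, smul_zero, smul_zero]

theorem form_toG_mk {M N : X.glV} (hM : M ∈ X.matAlg) (hN : N ∈ X.matAlg) :
    X.stdForm.form (X.toG ⟨M, hM⟩) (X.toG ⟨N, hN⟩) = X.formScale * Gl.str X.idxPar (M * N) := rfl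

theorem form_e_f_of_ne (hX : X.Valid) {i j : ℕ} (hi : i ≤ X.rank) (hj : j ≤ X.rank)
    (hij : i ≠ j) : X.stdForm.form (X.e i) (X.f j) = 0 := by
  obtain ⟨h1, h2⟩ := not_same hX hi hj hij
  rw [e, f, form_toG_mk, eMat_eq hX hi, fMat_eq hX hj, smul_mul_smul_comm, map_smul,
    str_F_mul_F_eq_zero (lo_mem hX hi) (hi_mem hX hi) (hi_mem hX hj) (lo_mem hX hj) h1 h2,
    smul_zero, mul_zero]

theorem form_e_e (hX : X.Valid) {i j : ℕ} (hi : i ≤ X.rank) (hj : j ≤ X.rank) :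
    X.stdForm.form (X.e i) (X.e j) = 0 := by
  obtain ⟨h1, h2⟩ := not_opposite hX hi hj
  rw [e, e, form_toG_mk, eMat_eq hX hi, eMat_eq hX hj, smul_mul_smul_comm, map_smul,
    str_F_mul_F_eq_zero (lo_mem hX hi) (hi_mem hX hi) (lo_mem hX hj) (hi_mem hX hj) h1 h2,
    smul_zero, mul_zero]

theorem form_f_f (hX : X.Valid) {i j : ℕ} (hi : i ≤ X.rank) (hj : j ≤ X.rank) :
    X.stdForm.form (X.f i) (X.f j) = 0 := by
  obtain ⟨h1, h2⟩ := not_opposite hX hi hj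
  rw [f, f, form_toG_mk, fMat_eq hX hi, fMat_eq hX hj, smul_mul_smul_comm, map_smul,
    str_F_mul_F_eq_zero (hi_mem hX hi) (lo_mem hX hi) (hi_mem hX hj) (lo_mem hX hj)
      (fun h => h1 h.symm) (fun h => h2 h.symm),
    smul_zero, mul_zero]

theorem form_e_f (hX : X.Valid) {i : ℕ} (hi : i ≤ X.rank) :
    X.stdForm.form (X.e i) (X.f i) = 1 / (X.d i : ℂ) := by
  have hl := lo_mem hX hi
  have hh := hi_mem hX hi
  rw [e, f, form_toG_mk, eMat_eq hX hi, fMat_eq hX hi, smul_mul_smul_comm, map_smul,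
    ← coef_mul_eta hX hi, smul_eq_mul]
  suffices h : X.formScale * Gl.str X.idxPar (X.F (X.lo i) (X.hi i) * X.F (X.hi i) (X.lo i)) =
      mult (X.lo i) (X.hi i) * X.eta (X.lo i) by
    linear_combination (X.eCoef i * X.fCoef i) * h
  have hodd := odd_of_hi_eq_dual hX hi
  cases X with
  | A m n =>
    rw [F_A hl, F_A hh, str_E_mul_E _ hh hl, if_pos ⟨rfl, rfl⟩, mult,
      if_neg (fun h : (A m n).hi i = ((A m n).lo i).dual => dual_notMem_A hl (h ▸ hh))]
    rfl
  | B m n =>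
    rw [str_F_mul_F_swap (selfDual_B m n) hl hh hodd]
    simp only [formScale, eta]
    ring
  | C n =>
    rw [str_F_mul_F_swap (selfDual_C n) hl hh hodd]
    simp only [formScale, eta]
    ring
  | D m n =>
    rw [str_F_mul_F_swap (selfDual_D m n) hl hh hodd]
    simp only [formScale, eta]
    ring

theorem e_mem_homog (hX : X.Valid) {i : ℕ} (hi : i ≤ X.rank) :
    X.e i ∈ homog X.G (X.rootParity i) := by
  have : X.eMat i ∈ homog X.glV (X.rootParity i) := by
    rw [eMat_eq hX hi, rootParity_eq hX hi]
    exact Submodule.smul_mem _ _ (F_mem_homog X _ _)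
  rw [mem_homog, e, toG_parity, ← map_smul]
  exact congrArg X.toG (Subtype.ext (mem_homog.1 this))

theorem f_mem_homog (hX : X.Valid) {i : ℕ} (hi : i ≤ X.rank) :
    X.f i ∈ homog X.G (X.rootParity i) := by
  have : X.fMat i ∈ homog X.glV (X.rootParity i) := by
    rw [fMat_eq hX hi, rootParity_eq hX hi, add_comm]
    exact Submodule.smul_mem _ _ (F_mem_homog X _ _)
  rw [mem_homog, f, toG_parity, ← map_smul]
  exact congrArg X.toG (Subtype.ext (mem_homog.1 this))

end SuperType
namespace SuperType

variable {X : SuperType}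

/-! ### Generation by the Chevalley generators -/

/-- The labels `u i`, `v i`. -/
def Pos (a : Lbl) : Prop := (∃ i, a = u i) ∨ ∃ i, a = v i

theorem Pos.ne_dual {a b : Lbl} (ha : Pos a) (hb : Pos b) : a ≠ b.dual := by
  rcases ha with ⟨i, rfl⟩ | ⟨i, rfl⟩ <;> rcases hb with ⟨j, rfl⟩ | ⟨j, rfl⟩ <;> simp [Lbl.dual]

theorem pos_or (a : Lbl) : Pos a ∨ Pos a.dual ∨ a = w := by
  cases a <;> simp [Pos, Lbl.dual]

theorem sum_E (M : X.glV) : ∑ a : X.Idx, ∑ b : X.Idx, (M a b) • X.E a.1 b.1 = M := by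
  refine Matrix.ext fun i j => ?_
  have h : ∀ (s : Finset X.Idx) (g : X.Idx → X.glV) (i j : X.Idx),
      (∑ a ∈ s, g a) i j = ∑ a ∈ s, g a i j := fun s g i j => Matrix.sum_apply i j s g
  rw [h, Finset.sum_eq_single i, h, Finset.sum_eq_single j]
  · change M i j * (if i.1 = i.1 ∧ j.1 = j.1 then 1 else 0) = M i j
    simp
  · intro b _ hb
    change M i b * (if i.1 = i.1 ∧ j.1 = b.1 then 1 else 0) = 0
    rw [if_neg (fun h => hb (Subtype.ext h.2).symm), mul_zero]
  · intro h; exact absurd (Finset.mem_univ _) h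
  · intro a _ ha
    rw [h]
    refine Finset.sum_eq_zero fun b _ => ?_
    change M a b * (if i.1 = a.1 ∧ j.1 = b.1 then 1 else 0) = 0
    rw [if_neg (fun h => ha (Subtype.ext h.1).symm), mul_zero]
  · intro h; exact absurd (Finset.mem_univ _) h

theorem act_single (M : X.glV) (i k : X.Idx) :
    Gl.act X.idxPar M (Pi.single i 1) k = M k i := by
  exact congrFun (Matrix.mulVec_single_one (M : Matrix X.Idx X.Idx ℂ) i) k

theorem vform_single_right (hX : X.SelfDual) (x : X.Idx → ℂ) (j : X.Idx) :
    Gl.vform X.gram x (Pi.single j 1) = x ⟨j.1.dual, hX _ j.2⟩ * j.1.dual.gamma := by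
  rw [vform_eq X hX, Finset.sum_eq_single ⟨j.1.dual, hX _ j.2⟩]
  · simp only [dual_dual, coord, j.2, dif_pos]
    simp
  · intro k _ hk
    rw [coord, dif_pos (hX _ k.2), Pi.single_eq_of_ne, mul_zero, mul_zero]
    intro h
    apply hk
    refine Subtype.ext ?_
    change k.1 = j.1.dual
    rw [← h, dual_dual]
  · intro h; exact absurd (Finset.mem_univ _) h

theorem vform_single_left (hX : X.SelfDual) (y : X.Idx → ℂ) (i : X.Idx) :
    Gl.vform X.gram (Pi.single i 1) y = i.1.gamma * y ⟨i.1.dual, hX _ i.2⟩ := by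
  rw [vform_eq X hX, Finset.sum_eq_single i]
  · rw [Pi.single_eq_same, one_mul, coord, dif_pos]
  · intro k _ hk
    rw [Pi.single_eq_of_ne hk, zero_mul]
  · intro h; exact absurd (Finset.mem_univ _) h

/-- The defining condition of `𝔬𝔰𝔭`, evaluated on the basis vectors indexed by `j` and `i*`,
involves just one matrix entry on each side. -/
theorem ospPart_apply (hX : X.SelfDual) {p : ZMod 2} {M : X.glV}
    (hM : M ∈ Gl.ospPart X.idxPar X.gram p) (i j : X.Idx) :
    M i j = -(kap j.1.dual i.1.dual * M ⟨j.1.dual, hX _ j.2⟩ ⟨i.1.dual, hX _ i.2⟩) := by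
  have h := hM.2 j.1.par (Pi.single j 1) (Pi.single ⟨i.1.dual, hX _ i.2⟩ 1) (by
    intro k hk
    rw [Pi.single_eq_of_ne]
    rintro rfl
    exact hk rfl)
  rw [vform_single_right hX, vform_single_left hX, act_single, act_single] at h
  simp only [dual_dual] at h
  have hz : ∀ a b : X.Idx, a.1.par + b.1.par ≠ p → M a b = 0 := by
    intro a b hab
    have h1 : M = Gl.part X.idxPar p M := by rw [Gl.part_homog X.idxPar hM.1, if_pos rfl]
    rw [h1, Gl.part_apply]
    exact if_neg hab
  have gi := gamma_mul_self i.1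
  by_cases hp : i.1.par + j.1.par = p
  · have hk : kap j.1.dual i.1.dual = i.1.gamma * sg (p * j.1.par) * j.1.gamma := by
      rw [kap, gamma_dual, gamma_dual, par_dual, par_dual, ← hp]
      rcases zmod_two i.1.par with h | h <;> rcases zmod_two j.1.par with h' | h' <;>
        simp [h, h', CharTwo.add_self_eq_zero, mul_comm]
    rw [hk]
    linear_combination i.1.gamma * h - M i j * gi
  · rw [hz i j hp, hz, mul_zero, neg_zero]
    rw [par_dual, par_dual, add_comm]
    exact hp

/-- By `ospPart_apply`, an orthosymplectic matrix is the average of itself and its signed transpose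
along duality, and `F` is this symmetrization of a matrix unit up to the factor `1/2`. -/
theorem osp_eq_sum (hX : X.SelfDual) {M : X.glV} (hM : M ∈ Gl.osp X.idxPar X.gram) :
    M = ∑ a : X.Idx, ∑ b : X.Idx, (1 / 2 * M a b) • X.F a.1 b.1 := by
  suffices h : ∀ p, ∀ M ∈ Gl.ospPart X.idxPar X.gram p,
      M = ∑ a : X.Idx, ∑ b : X.Idx, (1 / 2 * M a b) • X.F a.1 b.1 by
    obtain ⟨M₀, h0, M₁, h1, rfl⟩ := Submodule.mem_sup.1 hM
    conv_lhs => rw [h 0 M₀ h0, h 1 M₁ h1]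
    rw [← Finset.sum_add_distrib]
    refine Finset.sum_congr rfl fun a _ => ?_
    rw [← Finset.sum_add_distrib]
    refine Finset.sum_congr rfl fun b _ => ?_
    rw [← add_smul, ← mul_add]
    rfl
  intro p M hM
  let dl : X.Idx ≃ X.Idx := ⟨fun a => ⟨a.1.dual, hX _ a.2⟩, fun a => ⟨a.1.dual, hX _ a.2⟩,
    fun a => Subtype.ext (dual_dual _), fun a => Subtype.ext (dual_dual _)⟩
  have h1 : ∑ a : X.Idx, ∑ b : X.Idx, (M a b * kap a.1 b.1) • X.E b.1.dual a.1.dual = -M := by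
    rw [← sum_E (-M), Finset.sum_comm, ← Equiv.sum_comp dl]
    refine Finset.sum_congr rfl fun a _ => ?_
    rw [← Equiv.sum_comp dl]
    refine Finset.sum_congr rfl fun b _ => ?_
    change (M (dl b) (dl a) * kap b.1.dual a.1.dual) • X.E a.1.dual.dual b.1.dual.dual =
      (-(M a b)) • X.E a.1 b.1
    rw [dual_dual, dual_dual, ospPart_apply hX hM a b, neg_neg, mul_comm]
    rfl
  have h2 := sum_E M
  have h3 : ∑ a : X.Idx, ∑ b : X.Idx, (1 / 2 * M a b) • X.F a.1 b.1 =
      (1 / 2 : ℂ) • (∑ a : X.Idx, ∑ b : X.Idx, (M a b) • X.E a.1 b.1 -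
        ∑ a : X.Idx, ∑ b : X.Idx, (M a b * kap a.1 b.1) • X.E b.1.dual a.1.dual) := by
    rw [← Finset.sum_sub_distrib, Finset.smul_sum]
    refine Finset.sum_congr rfl fun a _ => ?_
    rw [← Finset.sum_sub_distrib, Finset.smul_sum]
    refine Finset.sum_congr rfl fun b _ => ?_
    rw [F_eq]
    module
  rw [h3, h1, h2]
  module

end SuperType
-- Spreading membership in a bracket-closed subspace along the chain of labels
namespace SuperType

variable {X : SuperType}

/-- The length of the chain of labels. -/
def chainLen : SuperType → ℕ
  | A m n => m + n + 2
  | B m n => m + n + 1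
  | C n => n + 1
  | D m n => m + n

theorem chain_mem {k : ℕ} (h1 : 1 ≤ k) (hk : k ≤ X.chainLen) : X.chain k ∈ X.basis := by
  cases X <;> simp only [chainLen] at hk <;> simp only [chain] <;>
    split_ifs <;> simp [basis, pairedBasis] <;> omega

theorem chain_ne {j k : ℕ} (hjk : j < k) (hk : k ≤ X.chainLen) :
    X.chain j ≠ X.chain k ∧ X.chain j ≠ (X.chain k).dual := by
  cases X <;> simp only [chainLen] at hk <;> simp only [chain] <;>
    split_ifs <;> simp [Lbl.dual] <;> omega

/-- `chainLen` is chosen so that this covers every finite node except the last one in types C and D,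
which leaves the chain. -/
theorem lo_hi_eq_chain (hX : X.Valid) {k : ℕ} (h1 : 1 ≤ k) (hk : k + 1 ≤ X.chainLen) :
    k ≤ X.rank ∧ X.lo k = X.chain k ∧ X.hi k = X.chain (k + 1) := by
  cases X <;> simp only [chainLen] at hk <;> simp only [Valid] at hX <;>
    simp only [chain, rank, lo, SuperType.hi] <;> refine ⟨by omega, ?_, ?_⟩ <;>
    (try split_ifs) <;> first | omega | rfl | trivial

theorem exists_chain {a : Lbl} (ha : a ∈ X.basis) (h : Pos a ∨ a = w) :
    ∃ k, 1 ≤ k ∧ k ≤ X.chainLen ∧ a = X.chain k := by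
  cases X with
  | A m n =>
    rcases h with (⟨i, rfl⟩ | ⟨i, rfl⟩) | rfl <;> simp [basis] at ha
    · exact ⟨i, ha.1, by simp only [chainLen]; omega, by simp only [chain]; rw [if_pos ha.2]⟩
    · refine ⟨i + (m + 1), by omega, by simp only [chainLen]; omega, ?_⟩
      simp only [chain]
      rw [if_neg (by omega), Nat.add_sub_cancel]
  | B m n =>
    rcases h with (⟨i, rfl⟩ | ⟨i, rfl⟩) | rfl <;> simp [basis, pairedBasis] at ha
    · refine ⟨i + n, by omega, by simp only [chainLen]; omega, ?_⟩
      simp only [chain]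
      rw [if_neg (by omega), if_pos (by omega), Nat.add_sub_cancel]
    · exact ⟨i, ha.1, by simp only [chainLen]; omega, by simp only [chain]; rw [if_pos ha.2]⟩
    · refine ⟨n + m + 1, by omega, by simp only [chainLen]; omega, ?_⟩
      simp only [chain]
      rw [if_neg (by omega), if_neg (by omega)]
  | C n =>
    rcases h with (⟨i, rfl⟩ | ⟨i, rfl⟩) | rfl <;> simp [basis, pairedBasis] at ha
    · exact ⟨i, by omega, by simp only [chainLen]; omega, by simp only [chain]; rw [if_pos ha.le]⟩
    · refine ⟨i + 1, by omega, by simp only [chainLen]; omega, ?_⟩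
      simp only [chain]
      rw [if_neg (by omega), Nat.add_sub_cancel]
  | D m n =>
    rcases h with (⟨i, rfl⟩ | ⟨i, rfl⟩) | rfl <;> simp [basis, pairedBasis] at ha
    · refine ⟨i + n, by omega, by simp only [chainLen]; omega, ?_⟩
      simp only [chain]
      rw [if_neg (by omega), Nat.add_sub_cancel]
    · exact ⟨i, ha.1, by simp only [chainLen]; omega, by simp only [chain]; rw [if_pos ha.2]⟩

/-- Subspaces of matrices that are closed under the bracket. -/
def BrClosed (S : Submodule ℂ X.glV) : Prop := ∀ x ∈ S, ∀ y ∈ S, sbr x y ∈ S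

variable {S : Submodule ℂ X.glV}

theorem F_dual_mem {a b : Lbl} (h : X.F a b ∈ S) : X.F b.dual a.dual ∈ S := by
  rw [F_dual]
  exact neg_mem (S.smul_mem _ h)

/-- The three inequalities kill all terms of the bracket formula but one, leaving `[F a b, F b d] =
F a d`. -/
theorem BrClosed.trans (hS : BrClosed S) {a b d : Lbl} (ha : a ∈ X.basis) (hb : b ∈ X.basis)
    (hd : d ∈ X.basis) (h1 : a ≠ d) (h2 : b ≠ d.dual) (h3 : a ≠ b.dual) (hab : X.F a b ∈ S)
    (hbd : X.F b d ∈ S) : X.F a d ∈ S := by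
  have h := hS _ hab _ hbd
  rw [bracketFormula ha hb hb hd, if_pos rfl, if_neg h1, if_neg h2, if_neg h3] at h
  simpa using h

theorem BrClosed.chain (hS : BrClosed S)
    (hc : ∀ k, 1 ≤ k → k + 1 ≤ X.chainLen →
      X.F (X.chain k) (X.chain (k + 1)) ∈ S ∧ X.F (X.chain (k + 1)) (X.chain k) ∈ S)
    {j k : ℕ} (hj : 1 ≤ j) (hjk : j < k) (hk : k ≤ X.chainLen) :
    X.F (X.chain j) (X.chain k) ∈ S ∧ X.F (X.chain k) (X.chain j) ∈ S := by
  induction k, hjk using Nat.le_induction with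
  | base => exact hc j hj hk
  | succ k hjk ih =>
    obtain ⟨h1, h2⟩ := ih (by omega)
    obtain ⟨h3, h4⟩ := hc k (by omega) hk
    have n1 := chain_ne (X := X) (j := j) (k := k) (by omega) (by omega)
    have n2 := chain_ne (X := X) (j := j) (k := k + 1) (by omega) (by omega)
    have n3 := chain_ne (X := X) (j := k) (k := k + 1) (by omega) (by omega)
    have mj := chain_mem (X := X) hj (by omega)
    have mk := chain_mem (X := X) (k := k) (by omega) (by omega)
    have mk' := chain_mem (X := X) (k := k + 1) (by omega) hk
    refine ⟨hS.trans mj mk mk' n2.1 n3.2 n1.2 h1 h3, hS.trans mk' mk mj n2.1.symm ?_ ?_ h4 h2⟩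
    · exact fun h => n1.2 (by rw [h, dual_dual])
    · exact fun h => n3.2 (by rw [h, dual_dual])

/-- Off-diagonal `F a b` for labels without primes. -/
theorem BrClosed.pos (hS : BrClosed S)
    (hc : ∀ k, 1 ≤ k → k + 1 ≤ X.chainLen →
      X.F (X.chain k) (X.chain (k + 1)) ∈ S ∧ X.F (X.chain (k + 1)) (X.chain k) ∈ S)
    {a b : Lbl} (ha : a ∈ X.basis) (hb : b ∈ X.basis) (pa : Pos a ∨ a = w) (pb : Pos b ∨ b = w)
    (hab : a ≠ b) : X.F a b ∈ S := by
  obtain ⟨j, j1, j2, rfl⟩ := exists_chain ha pa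
  obtain ⟨k, k1, k2, rfl⟩ := exists_chain hb pb
  rcases lt_trichotomy j k with h | h | h
  · exact (hS.chain hc j1 h k2).1
  · exact absurd (by rw [h]) hab
  · exact (hS.chain hc k1 h j2).2

/-- A family of labels, with `F a b` in `S` for distinct members, and one `F x y*` in `S`. -/
theorem BrClosed.upper (hS : BrClosed S) (hX : X.SelfDual) {Q : Lbl → Prop}
    (hQb : ∀ a, Q a → a ∈ X.basis) (hQd : ∀ a b, Q a → Q b → a ≠ b.dual)
    (hQ : ∀ a b, Q a → Q b → a ≠ b → X.F a b ∈ S) {x y : Lbl} (hx : Q x) (hy : Q y)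
    (hodd : x = y → x.par = 1) (hxy : X.F x y.dual ∈ S) {a b : Lbl} (ha : Q a) (hb : Q b) :
    X.F a b.dual ∈ S := by
  have hyd := hX _ (hQb _ hy)
  have h1 : ∀ a, Q a → X.F a y.dual ∈ S := by
    intro a ha
    by_cases hax : a = x
    · rwa [hax]
    by_cases e : x = y
    -- For a long root a second term of the bracket formula survives, with coefficient `kap x x* =
    -- -1`. The bracket is `2 F a x*` and has to be halved.
    · subst e
      have h := hS _ (hQ a x ha hx hax) _ hxy
      rw [bracketFormula (hQb _ ha) (hQb _ hx) (hQb _ hx) hyd, if_pos rfl,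
        if_neg (hQd _ _ ha hx), dual_dual, if_pos rfl, if_neg (hQd _ _ ha hx)] at h
      have hk : kap x x.dual = -1 := by
        simp [kap, gamma_dual, par_dual, hodd rfl, gamma_mul_self, CharTwo.add_self_eq_zero]
      rw [hk] at h
      have h' := S.smul_mem (1 / 2 : ℂ) h
      convert h' using 1
      module
    · refine hS.trans (hQb _ ha) (hQb _ hx) hyd (hQd _ _ ha hy) ?_ (hQd _ _ ha hx)
        (hQ a x ha hx hax) hxy
      rwa [dual_dual]
  by_cases hby : b = y
  · rw [hby]; exact h1 a ha
  have h2 : X.F y b.dual ∈ S := by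
    have := F_dual_mem (h1 b hb)
    rwa [dual_dual] at this
  by_cases hay : a = y
  · rwa [hay]
  refine hS.trans (hQb _ ha) (hQb _ hy) (hX _ (hQb _ hb)) (hQd _ _ ha hb) ?_ (hQd _ _ ha hy)
    (hQ a y ha hy hay) h2
  rw [dual_dual]
  exact Ne.symm hby

end SuperType
-- From neighbouring root vectors to all of `𝔰𝔩` and `𝔬𝔰𝔭`
namespace SuperType

variable {X : SuperType} {S : Submodule ℂ X.glV}

theorem Pos.ne_w {a : Lbl} (h : Pos a) : a ≠ w := by
  rcases h with ⟨i, rfl⟩ | ⟨i, rfl⟩ <;> simp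

/-- Every label is unprimed, dual to an unprimed one, or `w`. Since `F a b` and `F b* a*` are
proportional, the listed combinations cover all pairs. -/
theorem F_mem_of_pos (hX : X.SelfDual)
    (h1 : ∀ a b, a ∈ X.basis → b ∈ X.basis → Pos a ∨ a = w → Pos b ∨ b = w → a ≠ b → X.F a b ∈ S)
    (h2 : ∀ a b, a ∈ X.basis → b ∈ X.basis → Pos a → Pos b →
      X.F a b.dual ∈ S ∧ X.F a.dual b ∈ S)
    (h3 : ∀ a, a ∈ X.basis → Pos a → X.F a a ∈ S) {a b : Lbl} (ha : a ∈ X.basis)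
    (hb : b ∈ X.basis) : X.F a b ∈ S := by
  have h1' : ∀ a b, a ∈ X.basis → b ∈ X.basis → Pos a ∨ a = w → Pos b ∨ b = w → X.F a b ∈ S := by
    intro a b ha hb pa pb
    by_cases hab : a = b
    · subst hab
      rcases pa with pa | rfl
      · exact h3 a ha pa
      · rw [F_w_w]; exact zero_mem _
    · exact h1 a b ha hb pa pb hab
  have hd : ∀ a b, X.F b.dual a.dual ∈ S → X.F a b ∈ S := fun a b h => by
    have := F_dual_mem h
    rwa [dual_dual, dual_dual] at this
  have ha' := hX a ha
  have hb' := hX b hb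
  rcases pos_or a with pa | pa | rfl <;> rcases pos_or b with pb | pb | rfl
  · exact h1' _ _ ha hb (.inl pa) (.inl pb)
  · have := (h2 _ _ ha hb' pa pb).1
    rwa [dual_dual] at this
  · exact h1' _ _ ha hb (.inl pa) (.inr rfl)
  · have := (h2 _ _ ha' hb pa pb).2
    rwa [dual_dual] at this
  · exact hd _ _ (h1' _ _ hb' ha' (.inl pb) (.inl pa))
  · exact hd _ _ (h1' _ _ hb' ha' (.inr rfl) (.inl pa))
  · exact h1' _ _ ha hb (.inr rfl) (.inl pb)
  · exact hd _ _ (h1' _ _ hb' ha' (.inl pb) (.inr rfl))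
  · exact h1' _ _ ha hb (.inr rfl) (.inr rfl)

theorem osp_le (hX : X.SelfDual) (h : ∀ a b, a ∈ X.basis → b ∈ X.basis → X.F a b ∈ S) :
    Gl.osp X.idxPar X.gram ≤ S := by
  intro M hM
  rw [osp_eq_sum hX hM]
  exact sum_mem fun a _ => sum_mem fun b _ => S.smul_mem _ (h _ _ a.2 b.2)

/-- `𝔰𝔩` is spanned by off-diagonal units and the differences `E_aa - (-1)^p(a) E_oo` for a fixed
even label `o`. Each such difference with `a ≠ o` is a bracket of two opposite units. -/
theorem sl_le {m n : ℕ} {S : Submodule ℂ (A m n).glV} (hS : BrClosed S)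
    (h1 : ∀ a b, a ∈ (A m n).basis → b ∈ (A m n).basis → a ≠ b → (A m n).F a b ∈ S) :
    (A m n).matAlg ≤ S := by
  intro M hM
  have hstr : Gl.str (A m n).idxPar M = 0 := hM
  let o : (A m n).Idx := ⟨u 1, by simp [basis]⟩
  have h2 : ∀ a : (A m n).Idx, (A m n).E a.1 a.1 - sg a.1.par • (A m n).E o.1 o.1 ∈ S := by
    intro a
    by_cases hao : a = o
    · rw [hao]
      change _ - (1 : ℂ) • _ ∈ S
      rw [one_smul, sub_self]
      exact zero_mem _
    · have hne : a.1 ≠ o.1 := fun h => hao (Subtype.ext h)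
      have hd : o.1 ≠ a.1.dual := fun h => dual_notMem_A a.2 (h ▸ o.2)
      have h := hS _ (h1 _ _ a.2 o.2 hne) _ (h1 _ _ o.2 a.2 hne.symm)
      rw [sbr_F_swap a.2 o.2 (fun h => absurd h hd), mult, if_neg hd, one_smul, F_A a.2,
        F_A o.2] at h
      have : a.1.par + o.1.par = a.1.par := add_zero _
      rwa [this] at h
  -- What is subtracted is the supertrace of `M`, which is zero, times `E_oo`. It is distributed
  -- over the diagonal entries.
  have h3 : M = ∑ a : (A m n).Idx, ∑ b : (A m n).Idx, (M a b • (A m n).E a.1 b.1 -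
      (if a = b then sg a.1.par * M a a else 0) • (A m n).E o.1 o.1) := by
    simp only [Finset.sum_sub_distrib, sum_E]
    have : ∑ a : (A m n).Idx, ∑ b : (A m n).Idx,
        (if a = b then sg a.1.par * M a a else 0) • (A m n).E o.1 o.1 = 0 := by
      simp only [← Finset.sum_smul, Finset.sum_ite_eq, Finset.mem_univ, if_true]
      rw [show ∑ a : (A m n).Idx, sg a.1.par * M a a = 0 from hstr, zero_smul]
    rw [this, sub_zero]
  rw [h3]
  refine sum_mem fun a _ => sum_mem fun b _ => ?_
  by_cases hab : a = b
  · subst hab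
    rw [if_pos rfl, mul_comm, mul_smul, ← smul_sub]
    exact S.smul_mem _ (h2 a)
  · rw [if_neg hab, zero_smul, sub_zero]
    have := h1 _ _ a.2 b.2 (fun h => hab (Subtype.ext h))
    rw [F_A a.2] at this
    exact S.smul_mem _ this

/-- The case of type B. The self-dual label `w` connects `a` with `b*`: the bracket of `F a w` and
`F w b*` is `F a b*`. Also `[F a w, F w a] = F a a`, since `F w w = 0`. -/
theorem F_mem_of_w (hX : X.SelfDual) (hw : w ∈ X.basis) (hS : BrClosed S)
    (h1 : ∀ a b, a ∈ X.basis → b ∈ X.basis → Pos a ∨ a = w → Pos b ∨ b = w → a ≠ b → X.F a b ∈ S)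
    {a b : Lbl} (ha : a ∈ X.basis) (hb : b ∈ X.basis) : X.F a b ∈ S := by
  have hwl : ∀ a, a ∈ X.basis → Pos a → X.F w a ∈ S := fun a ha pa =>
    h1 _ _ hw ha (.inr rfl) (.inl pa) pa.ne_w.symm
  have hwr : ∀ a, a ∈ X.basis → Pos a → X.F a w ∈ S := fun a ha pa =>
    h1 _ _ ha hw (.inl pa) (.inr rfl) pa.ne_w
  have hwd : ∀ a, Pos a → w ≠ a.dual := fun a pa h => pa.ne_w (dual_eq_iff.1 h.symm)
  refine F_mem_of_pos hX h1 (fun a b ha hb pa pb => ⟨?_, ?_⟩) (fun a ha pa => ?_) ha hb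
  · refine hS.trans ha hw (hX b hb) (pa.ne_dual pb) ?_ pa.ne_w (hwr a ha pa)
      (F_dual_mem (hwr b hb pb))
    rw [dual_dual]
    exact pb.ne_w.symm
  · exact hS.trans (hX a ha) hw hb (pb.ne_dual pa).symm (hwd b pb) (hwd a pa).symm
      (F_dual_mem (hwl a ha pa)) (hwl b hb pb)
  · have h := hS _ (hwr a ha pa) _ (hwl a ha pa)
    rwa [sbr_F_swap ha hw (fun h => absurd h (hwd a pa)), mult, if_neg (hwd a pa), one_smul,
      F_w_w, smul_zero, sub_zero] at h

/-- The case of types C and D. There is no `w`, and the last node supplies the one vector `F x y*`,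
and its opposite, that leads from unprimed to primed labels. -/
theorem F_mem_of_long (hX : X.SelfDual) (hS : BrClosed S)
    (h1 : ∀ a b, a ∈ X.basis → b ∈ X.basis → Pos a ∨ a = w → Pos b ∨ b = w → a ≠ b → X.F a b ∈ S)
    {x y : Lbl} (hx : x ∈ X.basis) (hy : y ∈ X.basis) (px : Pos x) (py : Pos y)
    (hodd : x = y → x.par = 1) (hxy : X.F x y.dual ∈ S) (hyx : X.F y.dual x ∈ S)
    (hother : ∀ a, ∃ b ∈ X.basis, Pos b ∧ a ≠ b)
    {a b : Lbl} (ha : a ∈ X.basis) (hb : b ∈ X.basis) : X.F a b ∈ S := by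
  have hup : ∀ a b, a ∈ X.basis → b ∈ X.basis → Pos a → Pos b → X.F a b.dual ∈ S := by
    intro a b ha hb pa pb
    exact hS.upper hX (Q := fun a => a ∈ X.basis ∧ Pos a) (fun a h => h.1)
      (fun a b h h' => h.2.ne_dual h'.2)
      (fun a b h h' hab => h1 a b h.1 h'.1 (.inl h.2) (.inl h'.2) hab)
      ⟨hx, px⟩ ⟨hy, py⟩ hodd hxy ⟨ha, pa⟩ ⟨hb, pb⟩
  have hdown : ∀ a b, a ∈ X.basis → b ∈ X.basis → Pos a → Pos b → X.F a.dual b ∈ S := by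
    intro a b ha hb pa pb
    -- The same spreading argument for the family of primed labels, started from `F y* x`.
    have := hS.upper hX (Q := fun a => a ∈ X.basis ∧ Pos a.dual) (fun a h => h.1)
      (fun a b h h' e => h.2.ne_dual h'.2 (congrArg Lbl.dual e))
      (fun a b h h' hab => by
        have := F_dual_mem (h1 _ _ (hX _ h'.1) (hX _ h.1) (.inl h'.2) (.inl h.2)
          (fun e => hab (dual_injective e).symm))
        rwa [dual_dual, dual_dual] at this)
      (x := y.dual) (y := x.dual) ⟨hX _ hy, by rwa [dual_dual]⟩ ⟨hX _ hx, by rwa [dual_dual]⟩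
      (fun e => by
        have e' := (dual_injective e).symm
        rw [par_dual, ← e']
        exact hodd e')
      (by rwa [dual_dual]) (a := a.dual) (b := b.dual) ⟨hX _ ha, by rwa [dual_dual]⟩
      ⟨hX _ hb, by rwa [dual_dual]⟩
    rwa [dual_dual] at this
  refine F_mem_of_pos hX h1 (fun a b ha hb pa pb => ⟨hup a b ha hb pa pb, hdown a b ha hb pa pb⟩)
    (fun a ha pa => ?_) ha hb
  obtain ⟨b, hb, pb, hab⟩ := hother a
  have hd : b ≠ a.dual := pb.ne_dual pa
  have hd' : b.dual ≠ a.dual := fun h => hab (dual_injective h).symm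
  have e1 := hS _ (h1 a b ha hb (.inl pa) (.inl pb) hab) _
    (h1 b a hb ha (.inl pb) (.inl pa) hab.symm)
  have e2 := hS _ (hup a b ha hb pa pb) _ (hdown b a hb ha pb pa)
  rw [sbr_F_swap ha hb (fun h => absurd h hd), mult, if_neg hd] at e1
  rw [sbr_F_swap ha (hX _ hb) (fun h => absurd h hd'), mult, if_neg hd', par_dual,
    F_dual_self] at e2
  -- As `F b* b* = -F b b`, the contributions of `b` and of `b*` cancel in the sum, leaving `2 F a
  -- a`.
  have := S.smul_mem (1 / 2 : ℂ) (add_mem e1 e2)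
  convert this using 1
  module

theorem matAlg_le (hX : X.Valid) (hS : BrClosed S)
    (h : ∀ i, 1 ≤ i → i ≤ X.rank → X.F (X.lo i) (X.hi i) ∈ S ∧ X.F (X.hi i) (X.lo i) ∈ S) :
    X.matAlg ≤ S := by
  have h1 : ∀ a b, a ∈ X.basis → b ∈ X.basis → Pos a ∨ a = w → Pos b ∨ b = w → a ≠ b →
      X.F a b ∈ S := fun a b ha hb pa pb hab => by
    refine hS.pos (fun k k1 k2 => ?_) ha hb pa pb hab
    obtain ⟨k3, e1, e2⟩ := lo_hi_eq_chain hX k1 k2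
    rw [← e1, ← e2]
    exact h k k1 k3
  cases X with
  | A m n =>
    refine sl_le hS fun a b ha hb hab => h1 a b ha hb (.inl ?_) (.inl ?_) hab
    · cases a <;> simp [basis, Pos] at ha ⊢
    · cases b <;> simp [basis, Pos] at hb ⊢
  | B m n =>
    exact osp_le (selfDual_B m n) fun a b ha hb =>
      F_mem_of_w (selfDual_B m n) (Finset.mem_insert_self _ _) hS h1 ha hb
  | C n =>
    simp only [Valid] at hX
    refine osp_le (selfDual_C n) fun a b ha hb =>
      F_mem_of_long (selfDual_C n) hS h1 (x := v n) (y := v n) ?_ ?_ (.inr ⟨_, rfl⟩)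
        (.inr ⟨_, rfl⟩) (fun _ => rfl) ?_ ?_ ?_ ha hb
    · exact v_mem_pairedBasis hX le_rfl
    · exact v_mem_pairedBasis hX le_rfl
    · have := (h (n + 1) (by omega) le_rfl).1
      simp only [lo, SuperType.hi, chain] at this
      simpa [show ¬ n = 0 by omega, Lbl.dual] using this
    · have := (h (n + 1) (by omega) le_rfl).2
      simp only [lo, SuperType.hi, chain] at this
      simpa [show ¬ n = 0 by omega, Lbl.dual] using this
    · intro a
      by_cases e : a = u 1
      · exact ⟨v n, v_mem_pairedBasis hX le_rfl, .inr ⟨_, rfl⟩, by simp [e]⟩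
      · exact ⟨u 1, u_mem_pairedBasis le_rfl le_rfl, .inl ⟨_, rfl⟩, e⟩
  | D m n =>
    simp only [Valid] at hX
    refine osp_le (selfDual_D m n) fun a b ha hb =>
      F_mem_of_long (selfDual_D m n) hS h1 (x := u (m - 1)) (y := u m) ?_ ?_ (.inl ⟨_, rfl⟩)
        (.inl ⟨_, rfl⟩) (fun e => ?_) ?_ ?_ ?_ ha hb
    · exact u_mem_pairedBasis (by omega) (by omega)
    · exact u_mem_pairedBasis (by omega) le_rfl
    · simp at e
      omega
    · have := (h (n + m) (by omega) (by simp only [rank]; omega)).1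
      simp only [lo, SuperType.hi, chain] at this
      simpa [show ¬ (n = 0 ∧ m = 0) by omega, Lbl.dual] using this
    · have := (h (n + m) (by omega) (by simp only [rank]; omega)).2
      simp only [lo, SuperType.hi, chain] at this
      simpa [show ¬ (n = 0 ∧ m = 0) by omega, Lbl.dual] using this
    · intro a
      by_cases e : a = u m
      · exact ⟨v n, v_mem_pairedBasis hX.2 le_rfl, .inr ⟨_, rfl⟩, by simp [e]⟩
      · exact ⟨u m, u_mem_pairedBasis (by omega) le_rfl, .inl ⟨_, rfl⟩, e⟩

theorem coef_ne_zero (i : ℕ) : X.eCoef i ≠ 0 ∧ X.fCoef i ≠ 0 := by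
  cases X <;> simp only [eCoef, fCoef] <;> constructor <;> (try split_ifs) <;> norm_num

/-- The Chevalley generators `e_i`, `f_i`, `i ≠ 0`, generate `𝔤`. -/
theorem eq_top_of_generators (hX : X.Valid) {S : Submodule ℂ X.G}
    (hS : ∀ x ∈ S, ∀ y ∈ S, sbr x y ∈ S)
    (h : ∀ i, 1 ≤ i → i ≤ X.rank → X.e i ∈ S ∧ X.f i ∈ S) : S = ⊤ := by
  -- The matrices of `matAlg` whose class lies in `S`. Generation is thereby reduced to matrices,
  -- also for `A(n,n)`, where `𝔤` is a proper quotient.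
  let S' : Submodule ℂ X.glV := (S.comap X.toG).map X.matAlg.subtype
  have hmem : ∀ {M : X.glV} (hM : M ∈ X.matAlg), X.toG ⟨M, hM⟩ ∈ S → M ∈ S' :=
    fun hM h => ⟨⟨_, hM⟩, h, rfl⟩
  have hle : X.matAlg ≤ S' := by
    refine matAlg_le hX ?_ fun i i1 i2 => ?_
    · rintro _ ⟨x, hx, rfl⟩ _ ⟨y, hy, rfl⟩
      exact ⟨sbr x y, hS _ hx _ hy, rfl⟩
    · obtain ⟨c1, c2⟩ := coef_ne_zero (X := X) i
      have h1 := hmem _ (h i i1 i2).1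
      have h2 := hmem _ (h i i1 i2).2
      rw [eMat_eq hX i2] at h1
      rw [fMat_eq hX i2] at h2
      exact ⟨(S'.smul_mem_iff c1).1 h1, (S'.smul_mem_iff c2).1 h2⟩
  rw [eq_top_iff]
  intro x _
  obtain ⟨x, rfl⟩ := X.toG_surjective x
  obtain ⟨y, hy, hyx⟩ := hle x.2
  have : y = x := Subtype.ext hyx
  exact this ▸ hy

end SuperType
/-! ### Differentials of Laurent monomials -/

theorem mon_mul (k l k' l' : ℤ) : mon k l * mon k' l' = mon (k + k') (l + l') := by
  simp [mon, AddMonoidAlgebra.single_mul_single]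

theorem mon_zero : mon 0 0 = 1 := rfl

/-- The logarithmic derivative of a monomial. -/
def dlog : ℤ × ℤ →+ Ω[R2⁄ℂ] where
  toFun x := mon (-x.1) (-x.2) • KaehlerDifferential.D ℂ R2 (mon x.1 x.2)
  map_zero' := by
    change mon (-0) (-0) • KaehlerDifferential.D ℂ R2 (mon 0 0) = 0
    rw [mon_zero, Derivation.map_one_eq_zero, smul_zero]
  map_add' x y := by
    have h : mon (x + y).1 (x + y).2 = mon x.1 x.2 * mon y.1 y.2 := by
      rw [mon_mul]; rfl
    rw [h, Derivation.leibniz, smul_add, smul_smul, smul_smul, mon_mul, mon_mul, add_comm]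
    congr 3 <;> simp

theorem dlog_eq (k l : ℤ) : dlog (k, l) = (k : ℂ) • dlog (1, 0) + (l : ℂ) • dlog (0, 1) := by
  have : ((k, l) : ℤ × ℤ) = k • (1, 0) + l • (0, 1) := by simp
  rw [this, map_add, map_zsmul, map_zsmul, Int.cast_smul_eq_zsmul, Int.cast_smul_eq_zsmul]

theorem D_mon (k l : ℤ) : KaehlerDifferential.D ℂ R2 (mon k l) = mon k l • dlog (k, l) := by
  change _ = mon k l • mon (-k) (-l) • KaehlerDifferential.D ℂ R2 (mon k l)
  rw [smul_smul, mon_mul, add_neg_cancel, add_neg_cancel, mon_zero, one_smul]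

/-- The classes of `s^k t^l ds / s` and `s^k t^l dt / t`. -/
def clsS (k l : ℤ) : FormsModExact := exactForms.mkQ (mon k l • dlog (1, 0))
/-- The class of `s^k t^l dt / t`. -/
def clsT (k l : ℤ) : FormsModExact := exactForms.mkQ (mon k l • dlog (0, 1))

theorem cls_mon (k l k' l' : ℤ) : cls (mon k l) (mon k' l') =
    (k : ℂ) • clsS (k + k') (l + l') + (l : ℂ) • clsT (k + k') (l + l') := by
  rw [cls, D_mon, smul_smul, mon_mul, dlog_eq, smul_add, map_add,
    smul_comm (mon _ _) (k : ℂ), exactForms.mkQ.map_smul (k : ℂ),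
    smul_comm (mon _ _) (l : ℂ), exactForms.mkQ.map_smul (l : ℂ), add_comm k', add_comm l']
  rfl

/-- For `k ≠ 0` the form `s^k ds/s` is `d(s^k) / k`, hence exact. -/
theorem clsS_eq_zero {k : ℤ} (hk : k ≠ 0) : clsS k 0 = 0 := by
  have h : cls (mon k 0) (mon 0 0) = 0 := by
    rw [cls, mon_zero, one_smul]
    exact (Submodule.Quotient.mk_eq_zero _).2 ⟨_, rfl⟩
  rw [cls_mon, Int.cast_zero, zero_smul, add_zero, add_zero, add_zero] at h
  exact (smul_eq_zero.1 h).resolve_left (by exact_mod_cast hk)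

theorem cls_s_s : cls (mon 1 0) (mon (-1) 0) = clsS 0 0 := by
  rw [cls_mon]; simp

theorem cls_t (k : ℤ) : cls (mon 0 1) (mon k (-1)) = clsT k 0 := by
  rw [cls_mon]; simp

/-- The cocycle for opposite powers of `t`, the situation of `x_i^+(k)` and `x_i^-(l)`. The first
summand gives rise to `K`, the second to the extra term in the image of `α_0`. -/
theorem cls_mon_opposite (k l p : ℤ) : cls (mon k p) (mon l (-p)) =
    (if k = -l then (k : ℂ) • clsS 0 0 else 0) + (p : ℂ) • clsT (k + l) 0 := by
  rw [cls_mon, add_neg_cancel]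
  split_ifs with h
  · rw [h, neg_add_cancel]
  · rw [clsS_eq_zero (by omega), smul_zero]

theorem span_cls {Q : Submodule ℂ FormsModExact} (h : ∀ a b, cls a b ∈ Q) : Q = ⊤ := by
  have key : ∀ ω ∈ Submodule.span R2 (Set.range (KaehlerDifferential.D ℂ R2)),
      ∀ r : R2, exactForms.mkQ (r • ω) ∈ Q := by
    intro ω hω
    induction hω using Submodule.span_induction with
    | mem x hx =>
      obtain ⟨a, rfl⟩ := hx
      exact fun r => h a r
    | zero => intro r; rw [smul_zero, map_zero]; exact zero_mem _
    | add x y _ _ hx hy => intro r; rw [smul_add, map_add]; exact add_mem (hx r) (hy r)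
    | smul a x _ hx => intro r; rw [smul_smul]; exact hx _
  rw [eq_top_iff]
  intro x _
  obtain ⟨ω, rfl⟩ := exactForms.mkQ_surjective x
  simpa using key ω (by rw [KaehlerDifferential.span_range_derivation]; trivial) 1

/-! ### Homomorphisms from superalgebras given by generators and relations -/

section Lift

variable {G : Type} {p : G → ZMod 2} {L : Type} [AddCommGroup L] [Module ℂ L] [Superalgebra L]

/-- A superalgebra as a non-associative ring. -/
def AsRing (L : Type) : Type := L

instance : AddCommGroup (AsRing L) := inferInstanceAs (AddCommGroup L)
instance : Module ℂ (AsRing L) := inferInstanceAs (Module ℂ L)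
instance : NonUnitalNonAssocRing (AsRing L) :=
  { (inferInstance : AddCommGroup (AsRing L)) with
    mul := fun x y => sbr (L := L) x y
    left_distrib := fun x y z => map_add (sbr (L := L) x) y z
    right_distrib := fun x y z => LinearMap.map_add₂ (sbr (L := L)) x y z
    zero_mul := fun x => LinearMap.map_zero₂ (sbr (L := L)) x
    mul_zero := fun x => map_zero (sbr (L := L) x) }
instance : IsScalarTower ℂ (AsRing L) (AsRing L) :=
  ⟨fun c x y => LinearMap.map_smul₂ (sbr (L := L)) c x y⟩
instance : SMulCommClass ℂ (AsRing L) (AsRing L) :=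
  ⟨fun c x y => (map_smul (sbr (L := L) x) c y).symm⟩

/-- The homomorphism from the free superalgebra with given values on the generators. -/
def freeLift (g : G → L) : FreeSuper p →ₗ[ℂ] L :=
  ((FreeNonUnitalNonAssocAlgebra.lift ℂ (A := AsRing L) g :
    FreeNonUnitalNonAssocAlgebra ℂ G →ₙₐ[ℂ] AsRing L) :
    FreeNonUnitalNonAssocAlgebra ℂ G →ₗ[ℂ] AsRing L)

theorem freeLift_of (g : G → L) (a : G) : freeLift (p := p) g (FreeSuper.of p a) = g a :=
  FreeNonUnitalNonAssocAlgebra.lift_of_apply ℂ (A := AsRing L) g a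

theorem freeLift_sbr (g : G → L) (x y : FreeSuper p) :
    freeLift g (sbr x y) = sbr (freeLift g x) (freeLift g y) :=
  map_mul (FreeNonUnitalNonAssocAlgebra.lift ℂ (A := AsRing L) g) x y

/-- Linear maps out of a free superalgebra that respect products are determined by the values
on the generators. -/
theorem free_hom_ext {f f' : FreeSuper p →ₗ[ℂ] L} (hf : ∀ x y, f (sbr x y) = sbr (f x) (f y))
    (hf' : ∀ x y, f' (sbr x y) = sbr (f' x) (f' y))
    (h : ∀ a, f (FreeSuper.of p a) = f' (FreeSuper.of p a)) : f = f' := by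
  let F : FreeNonUnitalNonAssocAlgebra ℂ G →ₙₐ[ℂ] AsRing L :=
    { toFun := f, map_smul' := map_smul f, map_zero' := map_zero f, map_add' := map_add f,
      map_mul' := hf }
  let F' : FreeNonUnitalNonAssocAlgebra ℂ G →ₙₐ[ℂ] AsRing L :=
    { toFun := f', map_smul' := map_smul f', map_zero' := map_zero f', map_add' := map_add f',
      map_mul' := hf' }
  have hF : F = F' := FreeNonUnitalNonAssocAlgebra.hom_ext ℂ h
  exact LinearMap.ext fun x => congrArg (fun F => F x) hF

/-- Conjugating the lift by the parity involutions gives another multiplicative map with the same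
values on generators, hence the same map. -/
theorem freeLift_parity {g : G → L} (hg : ∀ a, g a ∈ homog L (p a)) (x : FreeSuper p) :
    freeLift g (parity x) = parity (freeLift g x) := by
  have h : parity ∘ₗ freeLift g ∘ₗ parity = freeLift (p := p) g := by
    refine free_hom_ext (fun x y => ?_) (freeLift_sbr g) fun a => ?_
    · simp only [LinearMap.comp_apply, parity_sbr, freeLift_sbr]
    · simp only [LinearMap.comp_apply]
      rw [mem_homog.1 (FreeSuper.of_mem_homog p a), map_smul, map_smul, freeLift_of,
        mem_homog.1 (hg a), smul_smul, sg_mul_self, one_smul]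
  have h' := congrArg (fun f => f (parity x)) h
  simp only [LinearMap.comp_apply, parity_parity] at h'
  exact h'.symm

/-- The skew and Jacobi relators are formed from homogeneous elements only. They die in `L` because
the lift preserves parity, so that the axioms of `L` apply. -/
theorem relIdeal_le_ker [IsLieSuperalgebra L] {R : FreeSuper p → FreeSuper p → Prop} {g : G → L}
    (hg : ∀ a, g a ∈ homog L (p a)) (hR : ∀ u v, R u v → freeLift g u = freeLift g v) :
    relIdeal p R ≤ LinearMap.ker (freeLift (p := p) g) := by
  have hh : ∀ {a x}, x ∈ homog (FreeSuper p) a → freeLift g x ∈ homog L a := fun hx => by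
    rw [mem_homog, ← freeLift_parity hg, mem_homog.1 hx, map_smul]
  refine sInf_le ⟨fun x hx => ?_, fun x y hy => ?_⟩
  · rw [LinearMap.mem_ker]
    cases hx with
    | skew a b x y hx hy =>
      rw [map_add, map_smul, freeLift_sbr, freeLift_sbr,
        IsLieSuperalgebra.skew a b _ (hh hx) _ (hh hy), neg_add_cancel]
    | jacobi a b c x y z hx hy hz =>
      simp only [map_sub, map_add, map_smul, freeLift_sbr]
      rw [IsLieSuperalgebra.jacobi a b c _ (hh hx) _ (hh hy) _ (hh hz), sub_self]
    | rel u v h => rw [map_sub, hR u v h, sub_self]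
  · rw [LinearMap.mem_ker] at hy
    rw [LinearMap.mem_ker, LinearMap.mem_ker, freeLift_sbr, freeLift_sbr, hy]
    simp

end Lift

/-! ### Serre relations -/

section Serre

variable {g : Type} [AddCommGroup g] [Module ℂ g] [Superalgebra g] [IsLieSuperalgebra g]

theorem sbr_sbr_of_mem {p q : ZMod 2} {x y : g} (hx : x ∈ homog g p) (hy : y ∈ homog g q) (z : g) :
    sbr x (sbr y z) = sbr (sbr x y) z + sg (p * q) • sbr y (sbr x z) := by
  induction z using homog_induction with
  | hadd z z' h h' => simp only [map_add, h, h', smul_add]; abel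
  | h r z hz => exact IsLieSuperalgebra.jacobi p q r x hx y hy z hz

/-- The eigenvalue of `ad y ∘ ad x` on the vectors `(ad x) ^ k v`, for a lowest weight vector `v`
of weight `1 - N` (up to the shift by one of the exponent). -/
def lowCoef (s N : ℂ) : ℕ → ℂ
  | 0 => 0
  | k + 1 => s * (lowCoef s N k - (1 - N + 2 * k))

theorem lowCoef_one (N : ℂ) (k : ℕ) : lowCoef 1 N k = -(k * (k - N)) := by
  induction k with
  | zero => simp [lowCoef]
  | succ k ih => rw [lowCoef, ih]; push_cast; ring

theorem lowCoef_neg_one (N : ℂ) (k : ℕ) : lowCoef (-1) N k = if Even k then (k : ℂ) else k - N := by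
  induction k with
  | zero => simp [lowCoef]
  | succ k ih =>
    rw [lowCoef, ih]
    by_cases h : Even k
    · rw [if_pos h, if_neg (by simpa [Nat.even_add_one] using h)]; push_cast; ring
    · rw [if_neg h, if_pos (by simpa [Nat.even_add_one] using h)]; push_cast; ring

/-- For even `x` the coefficient is `-k(k - N)`; for odd `x` it is `k` or `k - N` according to the
parity of `k`. None of these vanishes beyond `N`. -/
theorem lowCoef_ne_zero (p : ZMod 2) {N k : ℕ} (h : N < k) : lowCoef (sg p) N k ≠ 0 := by
  have h1 : (k : ℂ) ≠ 0 := by exact_mod_cast (show k ≠ 0 by omega)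
  have h2 : (k : ℂ) - N ≠ 0 := by
    rw [sub_ne_zero]; exact_mod_cast (show k ≠ N by omega)
  rcases zmod_two p with rfl | rfl
  · rw [sg_zero, lowCoef_one]
    exact neg_ne_zero.2 (mul_ne_zero h1 h2)
  · rw [sg_one, lowCoef_neg_one]
    split_ifs
    exacts [h1, h2]

variable {p : ZMod 2} {x y h v : g}

theorem sbr_coroot_iterate (hx : x ∈ homog g p) (hh : h ∈ homog g 0)
    (hhx : sbr h x = (2 : ℂ) • x) {a : ℂ} (hhv : sbr h v = a • v) (k : ℕ) :
    sbr h ((⇑(sbr x))^[k] v) = (a + 2 * k) • (⇑(sbr x))^[k] v := by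
  induction k with
  | zero => simpa using hhv
  | succ k ih =>
    rw [Function.iterate_succ_apply', sbr_sbr_of_mem hh hx, hhx, ih]
    simp only [map_smul, LinearMap.smul_apply, zero_mul, sg_zero]
    push_cast
    module

/-- The classical argument for `𝔰𝔩₂`, carried out for `x` of either parity so that it also covers
the odd non-isotropic root of `B(0,n)`. Applying `y` to the first vanishing power of `ad x` on `v`
contradicts minimality if that power exceeds `N`. -/
theorem serre_of_lowest [FiniteDimensional ℂ g] (hx : x ∈ homog g p) (hy : y ∈ homog g p)
    (hhx : sbr (sbr x y) x = (2 : ℂ) • x) {N : ℕ}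
    (hhv : sbr (sbr x y) v = (1 - N : ℂ) • v) (hyv : sbr y v = 0) :
    (⇑(sbr x))^[N] v = 0 := by
  have hh : sbr x y ∈ homog g 0 := by
    have := sbr_mem_homog hx hy
    rwa [CharTwo.add_self_eq_zero] at this
  have hwt := sbr_coroot_iterate hx hh hhx hhv
  have hs : sg (p * p) = sg p := by rcases zmod_two p with rfl | rfl <;> simp
  have hlow : ∀ k, sbr y ((⇑(sbr x))^[k] v) = lowCoef (sg p) N k • (⇑(sbr x))^[k - 1] v := by
    intro k
    induction k with
    | zero => simpa [lowCoef] using hyv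
    | succ k ih =>
      have h1 := sbr_sbr_of_mem hx hy ((⇑(sbr x))^[k] v)
      rw [ih, hwt, hs, map_smul] at h1
      have h2 : lowCoef (sg p) N k • sbr x ((⇑(sbr x))^[k - 1] v) =
          lowCoef (sg p) N k • (⇑(sbr x))^[k] v := by
        cases k with
        | zero => simp [lowCoef]
        | succ k => rw [← Function.iterate_succ_apply' (⇑(sbr x))]; rfl
      rw [h2] at h1
      have h3 := congrArg (sg p • ·) h1
      simp only [smul_add, smul_smul, sg_mul_self, one_smul] at h3
      rw [Function.iterate_succ_apply', lowCoef, Nat.add_sub_cancel, mul_sub, sub_smul, h3]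
      module
  -- Nonzero vectors `(ad x)^k v` would be eigenvectors with distinct eigenvalues, hence infinitely
  -- many independent vectors in finite dimension.
  have hex : ∃ k, (⇑(sbr x))^[k] v = 0 := by
    by_contra hne
    push Not at hne
    have hli := Module.End.eigenvectors_linearIndependent' (sbr (sbr x y))
      (fun k : ℕ => (1 - N + 2 * k : ℂ)) (fun k l hkl => by
        have : (2 : ℂ) * k = 2 * l := by simpa using hkl
        exact_mod_cast mul_left_cancel₀ two_ne_zero this)
      (fun k => (⇑(sbr x))^[k] v)
      (fun k => ⟨Module.End.mem_eigenspace_iff.2 (hwt k), hne k⟩)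
    exact not_finite_iff_infinite.2 (inferInstance : Infinite ℕ) hli.finite
  classical
  have hz := Nat.find_spec hex
  by_cases hle : Nat.find hex ≤ N
  · obtain ⟨m, hm⟩ := Nat.exists_eq_add_of_le hle
    rw [hm, add_comm, Function.iterate_add_apply, hz]
    exact Function.iterate_fixed (map_zero (sbr x)) m
  · push Not at hle
    have h1 := hlow (Nat.find hex)
    rw [hz, map_zero, eq_comm, smul_eq_zero] at h1
    exact absurd (h1.resolve_left (lowCoef_ne_zero p hle)) (Nat.find_min hex (by omega))

theorem form_sbr_eq_neg (B : InvariantForm g) (hh : h ∈ homog g 0) (x z : g) :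
    B.form (sbr h x) z = -B.form x (sbr h z) := by
  have : sbr h x = -sbr x h := by
    induction x using homog_induction with
    | hadd x x' h1 h2 => rw [map_add, h1, h2, map_add, LinearMap.add_apply, neg_add]
    | h q x hx =>
      rw [IsLieSuperalgebra.skew 0 q h hh x hx, zero_mul, sg_zero, one_smul]
  rw [this, map_neg, LinearMap.neg_apply, B.invariant]

theorem form_eq_zero_of_weight (B : InvariantForm g) (hh : h ∈ homog g 0) {x z : g} {a b : ℂ}
    (hx : sbr h x = a • x) (hz : sbr h z = b • z) (hab : a + b ≠ 0) : B.form x z = 0 := by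
  have h1 := form_sbr_eq_neg B hh x z
  rw [hx, hz, map_smul, map_smul, LinearMap.smul_apply, smul_eq_mul, smul_eq_mul] at h1
  exact (mul_eq_zero.1 (show (a + b) * B.form x z = 0 by linear_combination h1)).resolve_left hab

end Serre

/-! ### Computing in the toroidal superalgebra -/

namespace Toroidal

variable {g : Type} [AddCommGroup g] [Module ℂ g] [Superalgebra g] (B : InvariantForm g)

theorem sbr_tens (x y : g) (a b : R2) : sbr (tens B x a) (tens B y b) =
    tens B (sbr x y) (a * b) + cen B (B.form x y • cls a b) := by
  have h : sbr (tens B x a) (tens B y b) =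
      ((loopBr (x ⊗ₜ[ℂ] a) (y ⊗ₜ[ℂ] b), cocycle B (x ⊗ₜ[ℂ] a) (y ⊗ₜ[ℂ] b)) : Toroidal B) := rfl
  rw [h, loopBr_tmul, cocycle_tmul]
  exact Prod.ext (add_zero _).symm (zero_add _).symm

theorem cen_sbr (ω : FormsModExact) (X : Toroidal B) : sbr (cen B ω) X = 0 :=
  Prod.ext (LinearMap.map_zero₂ _ _) (LinearMap.map_zero₂ _ _)

theorem sbr_cen (X : Toroidal B) (ω : FormsModExact) : sbr X (cen B ω) = 0 :=
  Prod.ext (map_zero _) (map_zero _)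

theorem tens_smul (c : ℂ) (x : g) (a : R2) : tens B (c • x) a = c • tens B x a :=
  Prod.ext (TensorProduct.smul_tmul' c x a).symm (smul_zero c).symm

theorem tens_neg (x : g) (a : R2) : tens B (-x) a = -tens B x a :=
  Prod.ext (TensorProduct.neg_tmul x a) neg_zero.symm

theorem tens_zero (a : R2) : tens B 0 a = 0 := Prod.ext (TensorProduct.zero_tmul _ a) rfl

/-- `tens` as a linear map. -/
def tensHom (a : R2) : g →ₗ[ℂ] Toroidal B :=
  LinearMap.inl ℂ _ _ ∘ₗ (TensorProduct.mk ℂ g R2).flip a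

theorem tensHom_apply (a : R2) (x : g) : tensHom B a x = tens B x a := rfl

/-- `cen` as a linear map. -/
def cenHom : FormsModExact →ₗ[ℂ] Toroidal B := LinearMap.inr ℂ _ _

theorem cenHom_apply (ω : FormsModExact) : cenHom B ω = cen B ω := rfl

theorem cen_zero : cen B 0 = 0 := rfl
theorem cen_smul (c : ℂ) (ω : FormsModExact) : cen B (c • ω) = c • cen B ω :=
  map_smul (cenHom B) c ω
theorem cen_add (ω ω' : FormsModExact) : cen B (ω + ω') = cen B ω + cen B ω' :=
  map_add (cenHom B) ω ω'

theorem cen_neg (ω : FormsModExact) : cen B (-ω) = -cen B ω := map_neg (cenHom B) ω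

theorem tens_mem_homog {p : ZMod 2} {x : g} (hx : x ∈ homog g p) (a : R2) :
    tens B x a ∈ homog (Toroidal B) p := by
  refine Prod.ext ?_ (smul_zero _).symm
  change TensorProduct.map parity LinearMap.id (x ⊗ₜ[ℂ] a) = sg p • (x ⊗ₜ[ℂ] a)
  rw [TensorProduct.map_tmul, mem_homog.1 hx]
  rfl

theorem cen_mem_homog (ω : FormsModExact) : cen B ω ∈ homog (Toroidal B) 0 := by
  rw [mem_homog, sg_zero, one_smul]
  exact Prod.ext (map_zero (TensorProduct.map (parity : g →ₗ[ℂ] g) LinearMap.id)) rfl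

/-- Central terms produced by the inner brackets are killed by the next one, so only the outermost
bracket contributes a differential. -/
theorem sbr_tens_iterate (x y : g) (a b : R2) (n : ℕ) :
    (⇑(sbr (tens B x a)))^[n + 1] (tens B y b) = tens B ((⇑(sbr x))^[n + 1] y) (a ^ (n + 1) * b) +
      cen B (B.form x ((⇑(sbr x))^[n] y) • cls a (a ^ n * b)) := by
  induction n with
  | zero => simp [sbr_tens]
  | succ n ih =>
    rw [Function.iterate_succ_apply', ih, map_add, sbr_cen, add_zero, sbr_tens,
      ← Function.iterate_succ_apply' (⇑(sbr x)), ← mul_assoc, ← pow_succ']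

end Toroidal

namespace SuperType

variable {X : SuperType}

/-! ### Consequences of the Chevalley relations -/

instance : FiniteDimensional ℂ X.G := by
  have : FiniteDimensional ℂ X.glV :=
    inferInstanceAs (FiniteDimensional ℂ (Matrix X.Idx X.Idx ℂ))
  exact inferInstanceAs (FiniteDimensional ℂ (X.matAlg ⧸ X.scalarIdeal))

theorem h_mem_homog (hX : X.Valid) {i : ℕ} (hi : i ≤ X.rank) : X.h i ∈ homog X.G 0 := by
  have := sbr_mem_homog (e_mem_homog hX hi) (f_mem_homog hX hi)
  rwa [CharTwo.add_self_eq_zero] at this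

theorem sbr_f_e (hX : X.Valid) {i : ℕ} (hi : i ≤ X.rank) :
    sbr (X.f i) (X.e i) = -(sg (X.rootParity i) • X.h i) := by
  have hs : sg (X.rootParity i * X.rootParity i) = sg (X.rootParity i) := by
    rcases zmod_two (X.rootParity i) with h | h <;> simp [h]
  rw [IsLieSuperalgebra.skew _ _ _ (f_mem_homog hX hi) _ (e_mem_homog hX hi), hs, h]

theorem sbr_f_e_of_ne (hX : X.Valid) {i j : ℕ} (hi : i ≤ X.rank) (hj : j ≤ X.rank) (hij : i ≠ j) :
    sbr (X.f i) (X.e j) = 0 := by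
  rw [IsLieSuperalgebra.skew _ _ _ (f_mem_homog hX hi) _ (e_mem_homog hX hj),
    sbr_e_f hX hj hi hij.symm, smul_zero, neg_zero]

theorem sbr_h_h (hX : X.Valid) {i j : ℕ} (hi : i ≤ X.rank) (hj : j ≤ X.rank) :
    sbr (X.h i) (X.h j) = 0 := by
  change sbr (X.h i) (sbr (X.e j) (X.f j)) = 0
  rw [sbr_sbr_of_mem (h_mem_homog hX hi) (e_mem_homog hX hj), sbr_h_e hX hi hj, sbr_h_f hX hi hj]
  simp

/-- Every simple root is non-orthogonal to another one. -/
theorem exists_cartan_ne_zero (hX : X.Valid) {j : ℕ} (hj : j ≤ X.rank) :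
    ∃ i ≤ X.rank, i ≠ j ∧ (X.cartan i j : ℂ) ≠ 0 := by
  have hne : ∀ i j, i ≤ X.rank → X.rootForm i j ≠ 0 → (X.cartan i j : ℂ) ≠ 0 := by
    intro i j hi h
    rw [cartan, Rat.cast_div]
    exact div_ne_zero (by exact_mod_cast h) (d_ne_zero hX hi)
  have h1 : 1 ≤ X.rank := by
    cases X <;> simp only [Valid, rank] at * <;> omega
  rcases Nat.eq_zero_or_pos j with rfl | h0
  · obtain ⟨i, hi, h⟩ := exists_adjacent hX le_rfl h1
    have : i = 0 := by omega
    subst this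
    rw [rootForm_comm] at h
    exact ⟨1, h1, one_ne_zero, hne _ _ h1 h⟩
  · obtain ⟨i, hi, h⟩ := exists_adjacent hX h0 hj
    exact ⟨i, by omega, by omega, hne _ _ (by omega) h⟩

theorem form_h_of_weight (hX : X.Valid) {i j : ℕ} (hi : i ≤ X.rank) (hj : j ≤ X.rank) {c : ℂ}
    (hc : c ≠ 0) {z : X.G} (hz : sbr (X.h j) z = c • z) : X.stdForm.form (X.h i) z = 0 := by
  refine form_eq_zero_of_weight X.stdForm (h_mem_homog hX hj) (a := 0) ?_ hz (by rwa [zero_add])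
  rw [sbr_h_h hX hj hi, zero_smul]

/-- By invariance, `(h_i | [e_j, f_j]) = ([h_i, e_j] | f_j) = a_ij (e_j | f_j)`. -/
theorem form_h_h (hX : X.Valid) {i j : ℕ} (hi : i ≤ X.rank) (hj : j ≤ X.rank) :
    X.stdForm.form (X.h i) (X.h j) = (X.rootForm i j : ℂ) / ((X.d i : ℂ) * (X.d j : ℂ)) := by
  change X.stdForm.form (X.h i) (sbr (X.e j) (X.f j)) = _
  rw [← X.stdForm.invariant, sbr_h_e hX hi hj, map_smul, LinearMap.smul_apply, form_e_f hX hj,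
    cartan, Rat.cast_div, smul_eq_mul]
  field_simp [d_ne_zero hX hi, d_ne_zero hX hj]

theorem cartan_self_eq_two (hX : X.Valid) {i : ℕ} (hi : i ≤ X.rank) (h : X.rootForm i i ≠ 0) :
    (X.cartan i i : ℂ) = 2 := by
  rw [cartan, Rat.cast_div, rootForm_self_of_ne hX hi h, mul_div_cancel_right₀ _ (d_ne_zero hX hi)]

theorem serre_e (hX : X.Valid) {i j N : ℕ} (hi : i ≤ X.rank) (hj : j ≤ X.rank) (hij : i ≠ j)
    (h : X.rootForm i i ≠ 0) (hN : (X.cartan i j : ℂ) = 1 - N) :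
    (⇑(sbr (X.e i)))^[N] (X.e j) = 0 := by
  refine serre_of_lowest (e_mem_homog hX hi) (f_mem_homog hX hi) ?_ ?_ (sbr_f_e_of_ne hX hi hj hij)
  · exact (sbr_h_e hX hi hi).trans (by rw [cartan_self_eq_two hX hi h])
  · exact (sbr_h_e hX hi hj).trans (by rw [hN])

theorem serre_f (hX : X.Valid) {i j N : ℕ} (hi : i ≤ X.rank) (hj : j ≤ X.rank) (hij : i ≠ j)
    (h : X.rootForm i i ≠ 0) (hN : (X.cartan i j : ℂ) = 1 - N) :
    (⇑(sbr (X.f i)))^[N] (X.f j) = 0 := by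
  -- Rescaling `e_i` by the parity sign turns `f_i, ±e_i, -h_i` into a triple of the shape required
  -- by `serre_of_lowest`, whatever the parity.
  have hh : sbr (X.f i) (sg (X.rootParity i) • X.e i) = -X.h i := by
    rw [map_smul, sbr_f_e hX hi, smul_neg, smul_smul, sg_mul_self, one_smul]
  refine serre_of_lowest (f_mem_homog hX hi)
    (Submodule.smul_mem _ (sg (X.rootParity i)) (e_mem_homog hX hi)) ?_ ?_ ?_
  · rw [hh, map_neg, LinearMap.neg_apply, sbr_h_f hX hi hi, cartan_self_eq_two hX hi h]
    module
  · rw [hh, map_neg, LinearMap.neg_apply, sbr_h_f hX hi hj, hN]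
    module
  · rw [map_smul, LinearMap.smul_apply, sbr_e_f hX hi hj hij, smul_zero]

/-- The root vectors `e_i` and `-f_i`. -/
def rv (X : SuperType) (s : ℤˣ) (i : ℕ) : X.G := if s = 1 then X.e i else -X.f i

theorem rv_one (i : ℕ) : X.rv 1 i = X.e i := if_pos rfl
theorem rv_neg_one (i : ℕ) : X.rv (-1) i = -X.f i := if_neg (by decide)

theorem rv_mem_homog (hX : X.Valid) (s : ℤˣ) {i : ℕ} (hi : i ≤ X.rank) :
    X.rv s i ∈ homog X.G (X.rootParity i) := by
  rcases Int.units_eq_one_or s with rfl | rfl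
  · rw [rv_one]; exact e_mem_homog hX hi
  · rw [rv_neg_one]; exact neg_mem (f_mem_homog hX hi)

theorem sbr_h_rv (hX : X.Valid) (s : ℤˣ) {i j : ℕ} (hi : i ≤ X.rank) (hj : j ≤ X.rank) :
    sbr (X.h i) (X.rv s j) = (((s : ℤ) : ℂ) * (X.cartan i j : ℂ)) • X.rv s j := by
  rcases Int.units_eq_one_or s with rfl | rfl
  · rw [rv_one, sbr_h_e hX hi hj]; simp
  · rw [rv_neg_one, map_neg, sbr_h_f hX hi hj]; simp

theorem sbr_rv_self (hX : X.Valid) (s : ℤˣ) {i : ℕ} (hi : i ≤ X.rank)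
    (h : ¬(X.rootParity i = 1 ∧ X.rootForm i i ≠ 0)) : sbr (X.rv s i) (X.rv s i) = 0 := by
  by_cases h0 : X.rootForm i i = 0
  · rcases Int.units_eq_one_or s with rfl | rfl
    · rw [rv_one, sbr_e_self hX hi h0]
    · rw [rv_neg_one, map_neg, map_neg, LinearMap.neg_apply, sbr_f_self hX hi h0]; simp
  · have hp : X.rootParity i = 0 := (zmod_two _).resolve_right fun h1 => h ⟨h1, h0⟩
    have h1 := rv_mem_homog hX s hi
    have h2 := IsLieSuperalgebra.skew _ _ _ h1 _ h1
    rw [hp, mul_zero, sg_zero, one_smul] at h2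
    have h3 : (2 : ℂ) • sbr (X.rv s i) (X.rv s i) = 0 := by
      rw [two_smul]
      exact eq_neg_iff_add_eq_zero.1 h2
    exact (smul_eq_zero.1 h3).resolve_left two_ne_zero

theorem sbr_rv_of_orth (hX : X.Valid) (s : ℤˣ) {i j : ℕ} (hi : i ≤ X.rank) (hj : j ≤ X.rank)
    (h : X.rootForm i i = 0) (h' : X.rootForm i j = 0) : sbr (X.rv s i) (X.rv s j) = 0 := by
  rcases Int.units_eq_one_or s with rfl | rfl
  · rw [rv_one, rv_one, sbr_e_e_of_orth hX hi hj h h']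
  · rw [rv_neg_one, rv_neg_one, map_neg, map_neg, LinearMap.neg_apply,
      sbr_f_f_of_orth hX hi hj h h']
    simp

theorem form_rv (hX : X.Valid) (s : ℤˣ) {i j : ℕ} (hi : i ≤ X.rank) (hj : j ≤ X.rank) :
    X.stdForm.form (X.rv s i) (X.rv s j) = 0 := by
  rcases Int.units_eq_one_or s with rfl | rfl
  · rw [rv_one, rv_one, form_e_e hX hi hj]
  · rw [rv_neg_one, rv_neg_one, map_neg, map_neg, LinearMap.neg_apply, form_f_f hX hi hj]
    simp

theorem form_h_rv (hX : X.Valid) (s : ℤˣ) {i j : ℕ} (hi : i ≤ X.rank) (hj : j ≤ X.rank) :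
    X.stdForm.form (X.h i) (X.rv s j) = 0 := by
  -- The coroot `h_j` itself may act by zero, when `α_j` is isotropic. A neighbouring coroot detects
  -- that the weight is nonzero.
  obtain ⟨k, hk, -, hne⟩ := exists_cartan_ne_zero hX hj
  refine form_h_of_weight hX hi hk (mul_ne_zero ?_ hne) (sbr_h_rv hX s hk hj)
  rcases Int.units_eq_one_or s with rfl | rfl <;> simp

theorem serre_rv (hX : X.Valid) (s : ℤˣ) {i j N : ℕ} (hi : i ≤ X.rank) (hj : j ≤ X.rank)
    (hij : i ≠ j) (h : X.rootForm i i ≠ 0) (hN : (X.cartan i j : ℂ) = 1 - N) :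
    (⇑(sbr (X.rv s i)))^[N] (X.rv s j) = 0 := by
  rcases Int.units_eq_one_or s with rfl | rfl
  · rw [rv_one, rv_one, serre_e hX hi hj hij h hN]
  · have key : ∀ n, ∃ c : ℂ, (⇑(sbr (X.rv (-1) i)))^[n] (X.rv (-1) j) =
        c • (⇑(sbr (X.f i)))^[n] (X.f j) := by
      intro n
      induction n with
      | zero => exact ⟨-1, by simp [rv_neg_one]⟩
      | succ n ih =>
        obtain ⟨c, hc⟩ := ih
        refine ⟨-c, ?_⟩
        rw [Function.iterate_succ_apply', hc, Function.iterate_succ_apply', rv_neg_one]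
        simp
    obtain ⟨c, hc⟩ := key N
    rw [hc, serre_f hX hi hj hij h hN, smul_zero]

/-- The total weight of the two arguments under `s h_i` is `2 + a_ij + 2n = n + 2`, which is
nonzero. Hence the Serre relations acquire no central term. -/
theorem form_serre (hX : X.Valid) (s : ℤˣ) {i j n : ℕ} (hi : i ≤ X.rank) (hj : j ≤ X.rank)
    (h : X.rootForm i i ≠ 0) (hN : (X.cartan i j : ℂ) = 1 - (n + 1 : ℕ)) :
    X.stdForm.form (X.rv s i) ((⇑(sbr (X.rv s i)))^[n] (X.rv s j)) = 0 := by
  have hs : (((s : ℤ) : ℂ)) * ((s : ℤ) : ℂ) = 1 := by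
    rcases Int.units_eq_one_or s with rfl | rfl <;> simp
  have hh : ((s : ℤ) : ℂ) • X.h i ∈ homog X.G 0 := Submodule.smul_mem _ _ (h_mem_homog hX hi)
  have e1 : sbr (((s : ℤ) : ℂ) • X.h i) (X.rv s i) = (2 : ℂ) • X.rv s i := by
    rw [map_smul, LinearMap.smul_apply, sbr_h_rv hX s hi hi, smul_smul, ← mul_assoc, hs, one_mul,
      cartan_self_eq_two hX hi h]
  have e2 : sbr (((s : ℤ) : ℂ) • X.h i) (X.rv s j) = (X.cartan i j : ℂ) • X.rv s j := by
    rw [map_smul, LinearMap.smul_apply, sbr_h_rv hX s hi hj, smul_smul, ← mul_assoc, hs, one_mul]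
  refine form_eq_zero_of_weight X.stdForm hh e1
    (sbr_coroot_iterate (rv_mem_homog hX s hi) hh e1 e2 n) ?_
  rw [hN]
  push_cast
  have : ((n : ℂ) + 2) ≠ 0 := by exact_mod_cast (by omega : n + 2 ≠ 0)
  intro h0
  apply this
  linear_combination h0

end SuperType
namespace SuperType

variable {X : SuperType}

/-! ### The relations of `𝔗(X)` in `T(𝔤)` -/

open Toroidal

/-- The exponent of `t` in the image of `x_i^s(k)`. -/
def tExp (s : ℤˣ) (i : ℕ) : ℤ := if i = 0 then -s else 0

/-- The image of `x_i^s(k)`. -/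
def xImg (X : SuperType) (s : ℤˣ) (i : ℕ) (k : ℤ) : X.T :=
  tens X.stdForm (X.rv s i) (mon k (tExp s i))

/-- The image of `α_i(k)`. -/
def alImg (X : SuperType) (i : ℕ) (k : ℤ) : X.T :=
  (X.d i : ℂ) • tens X.stdForm (X.h i) (mon k 0) -
    cen X.stdForm (if i = 0 then clsT k 0 else 0)

/-- The image of `K`. -/
def kImg (X : SuperType) : X.T := cen X.stdForm (clsS 0 0)

theorem genImage_K : X.genImage Gen.K = X.kImg := by rw [genImage, cls_s_s]; rfl

theorem genImage_al (i : Fin (X.rank + 1)) (k : ℤ) : X.genImage (.al i k) = X.alImg i k := by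
  have h : i = 0 ↔ (i : ℕ) = 0 := by rw [Fin.ext_iff]; rfl
  simp only [genImage, alImg, cls_t, h]
  split_ifs <;> rfl

theorem genImage_x (s : ℤˣ) (i : Fin (X.rank + 1)) (k : ℤ) :
    X.genImage (.x s i k) = X.xImg s i k := by
  have h : i = 0 ↔ (i : ℕ) = 0 := by rw [Fin.ext_iff]; rfl
  rcases Int.units_eq_one_or s with rfl | rfl
  · simp only [genImage, xImg, rv_one, tExp, h]
    rfl
  · simp only [genImage, xImg, rv_neg_one, tExp, h, tens_neg]
    rw [if_neg (by decide)]
    rfl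

theorem genImage_mem_homog (hX : X.Valid) (a : Gen X) :
    X.genImage a ∈ homog X.T (genParity X a) := by
  cases a with
  | K => rw [genImage_K]; exact cen_mem_homog _ _
  | al i k =>
    rw [genImage_al]
    exact sub_mem (Submodule.smul_mem _ _
      (tens_mem_homog _ (h_mem_homog hX (by omega)) _)) (cen_mem_homog _ _)
  | x s i k =>
    rw [genImage_x]
    exact tens_mem_homog _ (rv_mem_homog hX s (by omega)) _

theorem sbr_alImg (i : ℕ) (k : ℤ) (Y : X.T) :
    sbr (X.alImg i k) Y = (X.d i : ℂ) • sbr (tens X.stdForm (X.h i) (mon k 0)) Y := by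
  rw [alImg, map_sub, LinearMap.sub_apply, cen_sbr, sub_zero, map_smul, LinearMap.smul_apply]

theorem sbr_alImg_alImg (hX : X.Valid) {i j : ℕ} (hi : i ≤ X.rank) (hj : j ≤ X.rank) (k l : ℤ) :
    sbr (X.alImg i k) (X.alImg j l) =
      if k = -l then ((k : ℂ) * (X.rootForm i j : ℂ)) • X.kImg else 0 := by
  rw [sbr_alImg, alImg, map_sub, sbr_cen, sub_zero, map_smul, sbr_tens, sbr_h_h hX hi hj,
    tens_zero, zero_add, form_h_h hX hi hj, smul_smul, ← cen_smul, smul_smul,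
    mul_div_cancel₀ _ (mul_ne_zero (d_ne_zero hX hi) (d_ne_zero hX hj))]
  have := cls_mon_opposite k l 0
  rw [neg_zero, Int.cast_zero, zero_smul, add_zero] at this
  rw [this]
  split_ifs
  · rw [smul_smul, mul_comm]; exact cen_smul _ _ _
  · rw [smul_zero]; rfl

theorem sbr_alImg_xImg (hX : X.Valid) (s : ℤˣ) {i j : ℕ} (hi : i ≤ X.rank) (hj : j ≤ X.rank)
    (k l : ℤ) : sbr (X.alImg i k) (X.xImg s j l) =
      (((s : ℤ) : ℂ) * (X.rootForm i j : ℂ)) • X.xImg s j (k + l) := by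
  rw [sbr_alImg, xImg, sbr_tens, form_h_rv hX s hi hj, zero_smul, cen_zero, add_zero,
    sbr_h_rv hX s hi hj, tens_smul, smul_smul, mon_mul, zero_add, xImg, cartan, Rat.cast_div]
  congr 1
  have := d_ne_zero hX hi
  field_simp

theorem sbr_xImg_of_ne (hX : X.Valid) {i j : ℕ} (hi : i ≤ X.rank) (hj : j ≤ X.rank) (hij : i ≠ j)
    (k l : ℤ) : sbr (X.xImg 1 i k) (X.xImg (-1) j l) = 0 := by
  rw [xImg, xImg, sbr_tens, rv_one, rv_neg_one, map_neg, map_neg, sbr_e_f hX hi hj hij,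
    form_e_f_of_ne hX hi hj hij, neg_zero, neg_zero, zero_smul, tens_zero, cen_zero, add_zero]

/-- At node `0` the exponents of `t` are `-1` and `1`, so the cocycle adds a multiple of `s^(k+l)
dt/t`. The correction in `alImg` absorbs precisely this term; for the other nodes both are absent.
-/
theorem sbr_xImg (hX : X.Valid) {i : ℕ} (hi : i ≤ X.rank) (k l : ℤ) :
    sbr (X.xImg 1 i k) (X.xImg (-1) i l) =
      -((1 / (X.d i : ℂ)) • (X.alImg i (k + l) + if k = -l then (k : ℂ) • X.kImg else 0)) := by
  have hE : tExp (-1) i = -tExp 1 i := by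
    rw [tExp, tExp]; split_ifs <;> simp
  have h1 : cen X.stdForm (cls (mon k (tExp 1 i)) (mon l (-tExp 1 i))) =
      (if k = -l then (k : ℂ) • X.kImg else 0) -
        cen X.stdForm (if i = 0 then clsT (k + l) 0 else 0) := by
    rw [cls_mon_opposite, cen_add, sub_eq_add_neg]
    congr 1
    · split_ifs
      · exact cen_smul _ _ _
      · rfl
    · rw [tExp]
      split_ifs
      · simp only [Units.val_one, Int.cast_neg, Int.cast_one, neg_smul, one_smul]
        exact cen_neg X.stdForm _
      · rw [Int.cast_zero, zero_smul, cen_zero, neg_zero]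
  rw [xImg, xImg, sbr_tens, hE, rv_one, rv_neg_one, map_neg, map_neg, form_e_f hX hi, mon_mul,
    add_neg_cancel, cen_smul, h1, alImg, tens_neg]
  change -tens X.stdForm (X.h i) _ + _ = _
  have h2 : tens X.stdForm (X.h i) (mon (k + l) 0) =
      (1 / (X.d i : ℂ)) • (X.d i : ℂ) • tens X.stdForm (X.h i) (mon (k + l) 0) := by
    rw [smul_smul, one_div_mul_cancel (d_ne_zero hX hi), one_smul]
  conv_lhs => rw [h2]
  module

theorem sbr_xImg_eq_zero (hX : X.Valid) (s : ℤˣ) {i j : ℕ} (hi : i ≤ X.rank) (hj : j ≤ X.rank)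
    (h : sbr (X.rv s i) (X.rv s j) = 0) (k l : ℤ) : sbr (X.xImg s i k) (X.xImg s j l) = 0 := by
  rw [xImg, xImg, sbr_tens, h, form_rv hX s hi hj, zero_smul, tens_zero, cen_zero, add_zero]

/-- For odd `x` with `[x, x] = 0`, the Jacobi identity gives `2 [x, [x, y]] = 0`. The central term
vanishes because `(x | [x, y]) = ([x, x] | y) = 0`. -/
theorem sbr_sbr_xImg (hX : X.Valid) (s : ℤˣ) {i j : ℕ} (hi : i ≤ X.rank)
    (h : X.rootForm i i = 0) (k l : ℤ) :
    sbr (X.xImg s i k) (sbr (X.xImg s i k) (X.xImg s j l)) = 0 := by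
  have h0 := sbr_rv_self hX s hi (fun hc => hc.2 h)
  have hpar : X.rootParity i = 1 := by
    rw [rootParity_eq hX hi]
    have := (odd_of_isotropic hX hi h).1
    revert this
    generalize (X.lo i).par = p
    generalize (X.hi i).par = q
    revert p q
    decide
  have h1 := rv_mem_homog hX s hi
  rw [hpar] at h1
  have h2 := sbr_sbr_of_mem h1 h1 (X.rv s j)
  rw [h0, map_zero, LinearMap.zero_apply, zero_add, mul_one, sg_one, neg_smul, one_smul,
    eq_neg_iff_add_eq_zero, ← two_smul ℂ, smul_eq_zero] at h2
  have h3 := h2.resolve_left two_ne_zero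
  have := sbr_tens_iterate X.stdForm (X.rv s i) (X.rv s j) (mon k (tExp s i)) (mon l (tExp s j)) 1
  simp only [Function.iterate_succ, Function.iterate_zero, Function.comp_apply, id_eq, h3,
    ← X.stdForm.invariant, h0, map_zero, LinearMap.zero_apply, zero_smul, tens_zero, cen_zero,
    add_zero] at this
  exact this

theorem serre_xImg (hX : X.Valid) (s : ℤˣ) {i j N : ℕ} (hi : i ≤ X.rank) (hj : j ≤ X.rank)
    (hij : i ≠ j) (h : X.rootForm i i ≠ 0) (hN : (X.cartan i j : ℂ) = 1 - N) (k l : ℤ) :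
    (⇑(sbr (X.xImg s i k)))^[N] (X.xImg s j l) = 0 := by
  have h1 := serre_rv hX s hi hj hij h hN
  cases N with
  | zero =>
    change X.xImg s j l = 0
    rw [xImg, show X.rv s j = 0 from h1, tens_zero]
  | succ n =>
    rw [xImg, xImg, sbr_tens_iterate, h1, form_serre hX s hi hj h hN, zero_smul, tens_zero,
      cen_zero, add_zero]

theorem rootForm_eq_zero_of_cartan (hX : X.Valid) {i j : ℕ} (hi : i ≤ X.rank)
    (h : X.cartan i j = 0) : X.rootForm i j = 0 := by
  rw [cartan, div_eq_zero_iff] at h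
  exact h.resolve_right fun h0 => d_ne_zero hX hi (by rw [h0, Rat.cast_zero])

/-- The relations of `𝔗(X)` hold in `T(𝔤)`. -/
theorem freeLift_rel (hX : X.Valid) (u v : FreeT X) (h : TRel X u v) :
    freeLift X.genImage u = freeLift X.genImage v := by
  have eK : freeLift (p := genParity X) X.genImage FreeT.K = X.kImg :=
    (freeLift_of _ _).trans genImage_K
  have eal : ∀ i k, freeLift (p := genParity X) X.genImage (FreeT.al i k) = X.alImg i k :=
    fun i k => (freeLift_of _ _).trans (genImage_al i k)
  have ex : ∀ s i k, freeLift (p := genParity X) X.genImage (FreeT.x s i k) = X.xImg s i k :=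
    fun s i k => (freeLift_of _ _).trans (genImage_x s i k)
  have hle : ∀ i : Fin (X.rank + 1), (i : ℕ) ≤ X.rank := fun i => by omega
  cases h with
  | K_al i k => rw [freeLift_sbr, eK, map_zero]; exact cen_sbr _ _ _
  | K_x s i k => rw [freeLift_sbr, eK, map_zero]; exact cen_sbr _ _ _
  | al_al i j k l =>
    rw [freeLift_sbr, eal, eal, sbr_alImg_alImg hX (hle i) (hle j)]
    split_ifs
    · rw [map_smul, eK]
    · rw [map_zero]
  | al_x s i j k l => rw [freeLift_sbr, eal, ex, map_smul, ex, sbr_alImg_xImg hX s (hle i) (hle j)]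
  | x_x_ne i j k l hij =>
    rw [freeLift_sbr, ex, ex, map_zero,
      sbr_xImg_of_ne hX (hle i) (hle j) (fun h => hij (Fin.ext h))]
  | x_x_isotropic i k l h =>
    -- The factor `1 / d_i` disappears as `d_i = 1` for isotropic roots; in the next case it equals
    -- `2 / (α_i | α_i)`.
    rw [freeLift_sbr, ex, ex, sbr_xImg hX (hle i), d_of_isotropic hX (hle i) h, div_one, one_smul,
      map_neg, map_add, eal]
    split_ifs
    · rw [map_smul, eK]
    · rw [map_zero]
  | x_x_nonisotropic i k l h =>
    rw [freeLift_sbr, ex, ex, sbr_xImg hX (hle i), rootForm_self_of_ne hX (hle i) h,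
      map_neg, map_smul, map_add, eal, div_mul_eq_div_div, div_self two_ne_zero]
    split_ifs
    · rw [map_smul, eK]
    · rw [map_zero]
  | x_self s i k l h =>
    rw [freeLift_sbr, ex, ex, map_zero]
    exact sbr_xImg_eq_zero hX s (hle i) (hle i) (sbr_rv_self hX s (hle i) h) k l
  | x_orth s i j k l hij hi h =>
    rw [freeLift_sbr, ex, ex, map_zero]
    exact sbr_xImg_eq_zero hX s (hle i) (hle j) (sbr_rv_of_orth hX s (hle i) (hle j)
      (rootForm_eq_zero_of_cartan hX (hle i) hi) (rootForm_eq_zero_of_cartan hX (hle i) h)) k l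
  | serre_isotropic s i j k l hi h =>
    rw [freeLift_sbr, freeLift_sbr, ex, ex, map_zero]
    exact sbr_sbr_xImg hX s (hle i) (rootForm_eq_zero_of_cartan hX (hle i) hi) k l
  | serre s i j k l N hij hi hN =>
    have hit : ∀ (x y : FreeT X) n, freeLift X.genImage ((⇑(sbr x))^[n] y) =
        (⇑(sbr (freeLift X.genImage x)))^[n] (freeLift X.genImage y) := by
      intro x y n
      induction n with
      | zero => rfl
      | succ n ih => rw [Function.iterate_succ_apply', freeLift_sbr, ih,
          Function.iterate_succ_apply']
    rw [hit, ex, ex, map_zero]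
    refine serre_xImg hX s (hle i) (hle j) (fun h => hij (Fin.ext h)) (fun h => hi ?_) ?_ k l
    · rw [cartan, h, zero_div]
    · have : X.cartan i j = 1 - N := by linarith
      rw [this]
      push_cast
      rfl

end SuperType

/-! ### Surjectivity -/

namespace Toroidal

variable {g : Type} [AddCommGroup g] [Module ℂ g] [Superalgebra g] (B : InvariantForm g)

theorem eq_top_of_tens_of_cen {S : Submodule ℂ (Toroidal B)} (h : ∀ x k l, tens B x (mon k l) ∈ S)
    (h' : ∀ ω, cen B ω ∈ S) : S = ⊤ := by
  rw [eq_top_iff]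
  rintro ⟨u, ω⟩ -
  have hmon : ∀ x a, tens B x a ∈ S := by
    intro x a
    have hT : ∀ a b, tens B x (a + b) = tens B x a + tens B x b := fun a b =>
      Prod.ext (TensorProduct.tmul_add x a b) (add_zero 0).symm
    induction a using AddMonoidAlgebra.induction_linear with
    | zero =>
      have : tens B x 0 = 0 := Prod.ext (TensorProduct.tmul_zero _ x) rfl
      rw [this]; exact zero_mem S
    | add a b ha hb => rw [hT]; exact add_mem ha hb
    | single m c =>
      have : tens B x (AddMonoidAlgebra.single m c) = c • tens B x (mon m.1 m.2) := by
        refine Prod.ext ?_ (smul_zero c).symm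
        change x ⊗ₜ[ℂ] AddMonoidAlgebra.single m c = c • x ⊗ₜ[ℂ] mon m.1 m.2
        rw [← TensorProduct.tmul_smul, mon, AddMonoidAlgebra.smul_single, smul_eq_mul, mul_one]
      rw [this]
      exact S.smul_mem _ (h _ _ _)
  have hu : (LinearMap.inl ℂ (g ⊗[ℂ] R2) FormsModExact u : Toroidal B) ∈ S := by
    induction u using TensorProduct.induction_on with
    | zero => exact zero_mem S
    | tmul x a => exact hmon x a
    | add u v hu hv => rw [map_add]; exact add_mem hu hv
  have huω : ((u, ω) : g ⊗[ℂ] R2 × FormsModExact) =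
      LinearMap.inl ℂ (g ⊗[ℂ] R2) FormsModExact u + LinearMap.inr ℂ (g ⊗[ℂ] R2) FormsModExact ω :=
    Prod.ext (add_zero u).symm (zero_add ω).symm
  rw [huω]
  exact S.add_mem hu (h' ω)

variable {B}

/-- Central summands drop out of a bracket, so working modulo the centre loses nothing: the bracket
lies in `S` itself. -/
theorem sbr_mem_of_mem_sup {S : Submodule ℂ (Toroidal B)} (hS : ∀ x ∈ S, ∀ y ∈ S, sbr x y ∈ S)
    {x y : Toroidal B} (hx : x ∈ S ⊔ LinearMap.range (cenHom B))
    (hy : y ∈ S ⊔ LinearMap.range (cenHom B)) : sbr x y ∈ S := by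
  obtain ⟨s, hs, _, ⟨ω, rfl⟩, rfl⟩ := Submodule.mem_sup.1 hx
  obtain ⟨s', hs', _, ⟨ω', rfl⟩, rfl⟩ := Submodule.mem_sup.1 hy
  rw [map_add (sbr _), cenHom_apply, cenHom_apply, sbr_cen, map_add sbr, LinearMap.add_apply,
    cen_sbr, add_zero, add_zero]
  exact hS s hs s' hs'

/-- The elements `x` of `g` all of whose loops `x ⊗ s ^ k t ^ l` lie in `S`, up to the centre. -/
def layer (S : Submodule ℂ (Toroidal B)) (l : ℤ) : Submodule ℂ g :=
  ⨅ k, (S ⊔ LinearMap.range (cenHom B)).comap (tensHom B (mon k l))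

theorem mem_layer {S : Submodule ℂ (Toroidal B)} {l : ℤ} {x : g} :
    x ∈ layer S l ↔ ∀ k, tens B x (mon k l) ∈ S ⊔ LinearMap.range (cenHom B) := by
  simp [layer, tensHom_apply]

theorem sbr_mem_layer {S : Submodule ℂ (Toroidal B)} (hS : ∀ x ∈ S, ∀ y ∈ S, sbr x y ∈ S)
    {l l' : ℤ} {x y : g} (hx : x ∈ layer S l) (hy : y ∈ layer S l') :
    sbr x y ∈ layer S (l + l') := by
  refine mem_layer.2 fun k => ?_
  -- The whole power of `s` is carried by the left factor.
  have h := sbr_mem_of_mem_sup hS (mem_layer.1 hx k) (mem_layer.1 hy 0)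
  rw [sbr_tens, mon_mul, add_zero] at h
  rw [eq_sub_of_add_eq (rfl : tens B (sbr x y) (mon k (l + l')) +
    cen B (B.form x y • cls (mon k l) (mon 0 l')) = _)]
  exact sub_mem (Submodule.mem_sup_left h) (Submodule.mem_sup_right ⟨_, rfl⟩)

/-- Full layers mean that `S` together with the centre is everything, so `S` contains all brackets.
Perfectness of `g`, in the form `hp`, then gives every `x ⊗ a`, and the pair `x₀`, `y₀` gives the
centre. -/
theorem eq_top_of_layer (hp : ∀ J : Submodule ℂ g, (∀ x y, sbr x y ∈ J) → J = ⊤) {x₀ y₀ : g}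
    (h0 : B.form x₀ y₀ ≠ 0)
    {S : Submodule ℂ (Toroidal B)} (hS : ∀ x ∈ S, ∀ y ∈ S, sbr x y ∈ S)
    (h : ∀ l, layer S l = ⊤) : S = ⊤ := by
  have hsup : S ⊔ LinearMap.range (cenHom B) = ⊤ :=
    eq_top_of_tens_of_cen B (fun x k l => mem_layer.1 (by rw [h]; trivial) k)
      fun ω => Submodule.mem_sup_right ⟨ω, rfl⟩
  have hbr : ∀ x y : Toroidal B, sbr x y ∈ S := fun x y =>
    sbr_mem_of_mem_sup hS (hsup ▸ Submodule.mem_top) (hsup ▸ Submodule.mem_top)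
  have hten : ∀ (x : g) (a : R2), tens B x a ∈ S := by
    intro x a
    have : S.comap (tensHom B a) = ⊤ := by
      refine hp _ fun x y => ?_
      rw [Submodule.mem_comap, tensHom_apply]
      -- Brackets with `x ⊗ 1` have no central term, since `d1 = 0`.
      have h1 := hbr (tens B x 1) (tens B y a)
      have h2 : cls 1 a = 0 := by rw [cls, Derivation.map_one_eq_zero, smul_zero, map_zero]
      rwa [sbr_tens, one_mul, h2, smul_zero, cen_zero, add_zero] at h1
    exact (this ▸ Submodule.mem_top : x ∈ S.comap (tensHom B a))
  refine eq_top_of_tens_of_cen B (fun x k l => hten x _) fun ω => ?_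
  have : S.comap (cenHom B) = ⊤ := by
    refine span_cls fun a b => ?_
    have h1 := hbr (tens B x₀ a) (tens B y₀ b)
    rw [sbr_tens] at h1
    have h2 := (Submodule.add_mem_iff_right S (hten _ _)).1 h1
    rw [cen_smul] at h2
    exact (Submodule.smul_mem_iff S h0).1 h2
  exact (this ▸ Submodule.mem_top : ω ∈ S.comap (cenHom B))

end Toroidal

/-! ### The images of the generators generate `T(𝔤)` -/

namespace SuperType

variable {X : SuperType}
open Toroidal

/-- If `h_i` is in the ideal and `α_j` is not orthogonal to `α_i`, bracketing yields `e_j`, `f_j`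
and then `h_j`. Connectedness of the extended diagram spreads this from node `0` to all nodes. -/
theorem eq_top_of_ideal (hX : X.Valid) {J : Submodule ℂ X.G} (hl : ∀ x, ∀ y ∈ J, sbr x y ∈ J)
    (hr : ∀ x, ∀ y ∈ J, sbr y x ∈ J) (h0 : X.h 0 ∈ J) : J = ⊤ := by
  have key : ∀ i j, i ≤ X.rank → j ≤ X.rank → X.rootForm i j ≠ 0 → X.h i ∈ J →
      X.e j ∈ J ∧ X.f j ∈ J := by
    intro i j hi hj hij h
    have hc : (X.cartan i j : ℂ) ≠ 0 := by
      rw [cartan, Rat.cast_div]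
      exact div_ne_zero (by exact_mod_cast hij) (d_ne_zero hX hi)
    have h1 := hr (X.e j) _ h
    have h2 := hr (X.f j) _ h
    rw [sbr_h_e hX hi hj] at h1
    rw [sbr_h_f hX hi hj] at h2
    exact ⟨(Submodule.smul_mem_iff J hc).1 h1, (Submodule.smul_mem_iff J (neg_ne_zero.2 hc)).1 h2⟩
  have hh : ∀ j, j ≤ X.rank → X.h j ∈ J := by
    intro j
    induction j using Nat.strong_induction_on with
    | _ j ih =>
      intro hj
      rcases Nat.eq_zero_or_pos j with rfl | h1
      · exact h0
      · obtain ⟨i, hij, hne⟩ := exists_adjacent hX h1 hj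
        exact hl _ _ (key i j (by omega) hj hne (ih i hij (by omega))).2
  refine eq_top_of_generators hX (fun x _ y hy => hl x y hy) fun j h1 hj => ?_
  obtain ⟨i, hij, hne⟩ := exists_adjacent hX h1 hj
  exact key i j (by omega) hj hne (hh i (by omega))

theorem eq_top_of_genImage_mem (hX : X.Valid) {S : Submodule ℂ X.T}
    (hS : ∀ x ∈ S, ∀ y ∈ S, sbr x y ∈ S) (h : ∀ a, X.genImage a ∈ S) : S = ⊤ := by
  have hrv : ∀ (t : ℤˣ), ∀ i ≤ X.rank, X.rv t i ∈ layer S (tExp t i) := fun t i hi =>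
    mem_layer.2 fun k => Submodule.mem_sup_left (by
      have := h (.x t ⟨i, Nat.lt_succ_of_le hi⟩ k)
      rwa [genImage_x] at this)
  have he : ∀ i ≤ X.rank, X.e i ∈ layer S (tExp 1 i) := fun i hi => by
    have := hrv 1 i hi
    rwa [rv_one] at this
  have hf : ∀ i ≤ X.rank, X.f i ∈ layer S (tExp (-1) i) := fun i hi => by
    have := hrv (-1) i hi
    rwa [rv_neg_one, Submodule.neg_mem_iff] at this
  have h0 : layer S 0 = ⊤ := by
    refine eq_top_of_generators hX (fun x hx y hy => ?_) fun i h1 hi => ?_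
    · have := sbr_mem_layer hS hx hy
      rwa [add_zero] at this
    · have h2 := he i hi
      have h3 := hf i hi
      rw [tExp, if_neg (by omega)] at h2 h3
      exact ⟨h2, h3⟩
  have hl : ∀ l, ∀ x, ∀ y ∈ layer S l, sbr x y ∈ layer S l := fun l x y hy => by
    have := sbr_mem_layer hS (h0 ▸ Submodule.mem_top : x ∈ layer S 0) hy
    rwa [zero_add] at this
  have hr : ∀ l, ∀ x, ∀ y ∈ layer S l, sbr y x ∈ layer S l := fun l x y hy => by
    have := sbr_mem_layer hS hy (h0 ▸ Submodule.mem_top : x ∈ layer S 0)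
    rwa [add_zero] at this
  -- This is layer `1`, which contains `f_0`. Layer `0` is all of `𝔤`, in particular contains `e_0`,
  -- so layer `1` is an ideal containing `h_0 = [e_0, f_0]`.
  have h1 : layer S (tExp (-1) 0) = ⊤ :=
    eq_top_of_ideal hX (hl _) (hr _) (hl _ (X.e 0) _ (hf 0 (Nat.zero_le _)))
  have h1' : layer S (tExp 1 0) = ⊤ :=
    eq_top_of_ideal hX (hl _) (hr _) (hr _ (X.f 0) _ (he 0 (Nat.zero_le _)))
  -- Perfectness of `𝔤`: a subspace containing all brackets is an ideal containing `h_0`.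
  have hp : ∀ J : Submodule ℂ X.G, (∀ x y, sbr x y ∈ J) → J = ⊤ := fun J hJ =>
    eq_top_of_ideal hX (fun x y _ => hJ x y) (fun x y _ => hJ y x) (hJ (X.e 0) (X.f 0))
  have hlay : ∀ l, layer S l = ⊤ := by
    intro l
    induction l using Int.induction_on with
    | zero => exact h0
    | succ l ih =>
      rw [show (l : ℤ) + 1 = l + tExp (-1) 0 by simp [tExp]]
      exact hp _ fun x y => sbr_mem_layer hS (ih ▸ Submodule.mem_top) (h1 ▸ Submodule.mem_top)
    | pred l ih =>
      rw [show -(l : ℤ) - 1 = -l + tExp 1 0 by simp [tExp, sub_eq_add_neg]]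
      exact hp _ fun x y => sbr_mem_layer hS (ih ▸ Submodule.mem_top) (h1' ▸ Submodule.mem_top)
  refine eq_top_of_layer hp (x₀ := X.e 0) (y₀ := X.f 0) ?_ hS hlay
  rw [form_e_f hX (Nat.zero_le _)]
  exact one_div_ne_zero (d_ne_zero hX (Nat.zero_le _))

end SuperType

/-! ### The homomorphism -/

namespace LoopT

open SuperType

variable {X : SuperType} {L : Type} [AddCommGroup L] [Module ℂ L] [Superalgebra L]

theorem hom_ext {φ ψ : SuperHom (LoopT X) L} (h : ∀ a, φ (gen X a) = ψ (gen X a)) : φ = ψ := by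
  have hl : φ.toLinearMap = ψ.toLinearMap := by
    refine Submodule.linearMap_qext _ (free_hom_ext (fun x y => ?_) (fun x y => ?_) h)
    · exact φ.map_sbr ((relIdeal (genParity X) (TRel X)).mkQ x)
        ((relIdeal (genParity X) (TRel X)).mkQ y)
    · exact ψ.map_sbr ((relIdeal (genParity X) (TRel X)).mkQ x)
        ((relIdeal (genParity X) (TRel X)).mkQ y)
  cases φ
  cases ψ
  cases hl
  rfl

/-- The homomorphism from `𝔗(X)` with given values on the generators. -/
def lift [IsLieSuperalgebra L] (g : Gen X → L) (hg : ∀ a, g a ∈ homog L (genParity X a))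
    (hR : ∀ u v, TRel X u v → freeLift g u = freeLift g v) : SuperHom (LoopT X) L where
  toLinearMap := (relIdeal (genParity X) (TRel X)).liftQ (freeLift g) (relIdeal_le_ker hg hR)
  map_parity x := by
    obtain ⟨x, rfl⟩ := Submodule.mkQ_surjective _ x
    exact freeLift_parity hg x
  map_sbr x y := by
    obtain ⟨x, rfl⟩ := Submodule.mkQ_surjective _ x
    obtain ⟨y, rfl⟩ := Submodule.mkQ_surjective _ y
    exact freeLift_sbr g x y

theorem lift_gen [IsLieSuperalgebra L] (g : Gen X → L) (hg : ∀ a, g a ∈ homog L (genParity X a))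
    (hR : ∀ u v, TRel X u v → freeLift g u = freeLift g v) (a : Gen X) :
    lift g hg hR (gen X a) = g a :=
  freeLift_of g a

end LoopT

end ToroidalSuper

end

theorem mainTheorem3 (X : ToroidalSuper.SuperType) (hX : X.Valid) :
    ∃ φ : ToroidalSuper.SuperHom (ToroidalSuper.LoopT X) X.T,
      (∀ a : ToroidalSuper.Gen X, φ (ToroidalSuper.LoopT.gen X a) = X.genImage a) ∧
      Function.Surjective φ ∧
      ∀ ψ : ToroidalSuper.SuperHom (ToroidalSuper.LoopT X) X.T,
        (∀ a : ToroidalSuper.Gen X, ψ (ToroidalSuper.LoopT.gen X a) = X.genImage a) → ψ = φ := by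
  have hgen := ToroidalSuper.LoopT.lift_gen X.genImage
    (ToroidalSuper.SuperType.genImage_mem_homog hX) (ToroidalSuper.SuperType.freeLift_rel hX)
  refine ⟨ToroidalSuper.LoopT.lift X.genImage (ToroidalSuper.SuperType.genImage_mem_homog hX)
    (ToroidalSuper.SuperType.freeLift_rel hX), hgen, ?_, fun ψ hψ =>
    ToroidalSuper.LoopT.hom_ext fun a => (hψ a).trans (hgen a).symm⟩
  -- The range is a subspace closed under brackets that contains the images of all generators.
  refine LinearMap.range_eq_top.1 (ToroidalSuper.SuperType.eq_top_of_genImage_mem hX ?_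
    fun a => ⟨_, hgen a⟩)
  rintro _ ⟨x, rfl⟩ _ ⟨y, rfl⟩
  exact ⟨_, ToroidalSuper.SuperHom.map_sbr _ x y⟩
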